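/- There are three alternatives $a,b,c$ and $n=3m$ voters, where $m$ is odd. Each voter independently picks a uniformly random ranking of $a,b,c$ (impartial culture). For alternatives $k\neq k'$ let $\mathbf x^{(kk')}\in\{-1,1\}^n$ be the vector whose $i$-th entry is $1$ if voter $i$ prefers $k$ to $k'$ and $-1$ otherwise. Let $f:\{-1,1\}^n\to\{-1,1\}$ be the majority of triplets, $$f(x_1,\dots,x_n)=\operatorname{sgn}\Big(\sum_{i=1}^m \operatorname{sgn}(x_{3i-2}+x_{3i-1}+x_{3i})\Big).$$ For $\rho\in[-1,1]$ let $T_\rho f(\mathbf x)=\mathbb E[f(\mathbf y)]$, where the $y_i$ are independent, $y_i=-x_i$ with probability $\frac{1-\rho}{2}$ and $y_i=x_i$ otherwise. For $d>0$ let $\mathcal E_d$ be the event that $\big|\sum_{i=1}^n x^{(kk')}_i\big|\le d$ for every pair of distinct alternatives $k,k'$, and let $\mathcal F_{\rho,d}$ be the event that $$\max\big(|T_\rho f(\mathbf x^{(ab)})|,\,|T_\rho f(\mathbf x^{(bc)})|,\,|T_\rho f(\mathbf x^{(ca)})|\big)\le \frac{d}{\sqrt m}.$$ **Theorem.** There are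 a constant $\alpha^*$ with $|\alpha^*-0.232|\le 0.0005$ and a function $\alpha$ of $\rho\in(0,1)$ such that the following hold, all limits in $n$ being taken along $n=3m$ with $m$ odd. 1. With $d=\sqrt n/\log n$, $$\lim_{n\to\infty}\Pr\big[f(\mathbf x^{(ab)})=f(\mathbf x^{(bc)})=f(\mathbf x^{(ca)})\,\big|\,\mathcal E_d\big]=\alpha^*.$$ 2. For every fixed $\rho\in(0,1)$, with $d=\sqrt m/\log m$ (so that $\mathcal F_{\rho,d}$ bounds the three values $|T_\rho f|$ by $1/\log m$), $$\lim_{n\to\infty}\Pr\big[f(\mathbf x^{(ab)})=f(\mathbf x^{(bc)})=f(\mathbf x^{(ca)})\,\big|\,\mathcal F_{\rho,d}\big]=\alpha(\rho),\qquad \alpha(\rho)\in[0.17,\alpha^*].$$ 3. $\alpha(\rho)\to\alpha^*$ as $\rho\to0^+$. -/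

import Mathlib

open Filter Topology MeasureTheory ProbabilityTheory

namespace CondorcetTriplets

/-- A ranking of the three alternatives `a = 0`, `b = 1`, `c = 2`: a bijection that sends each
alternative to its position, position `0` being the most preferred one. -/
abbrev Ranking : Type := Equiv.Perm (Fin 3)

instance instMeasurableSpaceRanking : MeasurableSpace Ranking := ⊤

/-- Impartial culture: each of the `n` voters independently samples a uniformly random ranking. -/
noncomputable def impartialCulture (n : ℕ) : Measure (Fin n → Ranking) :=
  Measure.pi fun _ => uniformOn (Set.univ : Set Ranking)

/-- The vote vector `x^{(k k')} ∈ {-1, 1}^n` of a profile `r` of rankings: its `i`-th entry is `1`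
if voter `i` prefers `k` to `k'`, and `-1` otherwise. -/
def votes {n : ℕ} (r : Fin n → Ranking) (k k' : Fin 3) : Fin n → ℤˣ :=
  fun i => if r i k < r i k' then 1 else -1

/-- `S^{(k k')}`: the number of voters that prefer `k` to `k'`, minus the number of voters that
prefer `k'` to `k`. -/
def margin {n : ℕ} (r : Fin n → Ranking) (k k' : Fin 3) : ℤ :=
  ∑ i, (votes r k k' i : ℤ)

/-- The event that the elections are `d`-close: `|S^{(k k')}| ≤ d` for every pair of
alternatives. -/
def closeMargins (n : ℕ) (d : ℝ) : Set (Fin n → Ranking) :=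
  {r | ∀ k k' : Fin 3, k ≠ k' → |(margin r k k' : ℝ)| ≤ d}

/-- The sum `w_i = x_{3i} + x_{3i+1} + x_{3i+2}` of the votes of the `i`-th triplet of voters
(everything numbered from `0`). -/
def tripletSum {m : ℕ} (x : Fin (3 * m) → ℤˣ) (i : Fin m) : ℤ :=
  (x ⟨3 * i, by omega⟩ : ℤ) + (x ⟨3 * i + 1, by omega⟩ : ℤ) + (x ⟨3 * i + 2, by omega⟩ : ℤ)

/-- Majority of triplets on `{-1, 1}^{3m}`, with values in `{-1, 1}` when `m` is odd. -/
def majTriplets (m : ℕ) (x : Fin (3 * m) → ℤˣ) : ℤ :=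
  Int.sign (∑ i : Fin m, Int.sign (tripletSum x i))

/-- The probability of `y` under `N_ρ(x)`: the coordinates `y_i` are independent, with `y_i ≠ x_i`
(that is, `y_i = -x_i`) with probability `(1 - ρ) / 2` and `y_i = x_i` otherwise. -/
noncomputable def noiseProb {n : ℕ} (ρ : ℝ) (x y : Fin n → ℤˣ) : ℝ :=
  ∏ i, if y i = x i then (1 + ρ) / 2 else (1 - ρ) / 2

/-- The noise operator `T_ρ g (x) = E[g(y)]`, where `y` is distributed as `N_ρ(x)`. -/
noncomputable def noiseOp {n : ℕ} (ρ : ℝ) (g : (Fin n → ℤˣ) → ℝ) (x : Fin n → ℤˣ) : ℝ :=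
  ∑ y, noiseProb ρ x y * g y

/-- The event that `|T_ρ f(x^{(k k')})| ≤ d / √m` for `(k k')` in `{ab, bc, ca}`, where `f` is
majority of triplets. -/
noncomputable def closeNoise (m : ℕ) (ρ d : ℝ) : Set (Fin (3 * m) → Ranking) :=
  {r | max (max |noiseOp ρ (fun y => (majTriplets m y : ℝ)) (votes r 0 1)|
                |noiseOp ρ (fun y => (majTriplets m y : ℝ)) (votes r 1 2)|)
           |noiseOp ρ (fun y => (majTriplets m y : ℝ)) (votes r 2 0)| ≤ d / √m}

/-- The Condorcet paradox for pairwise elections decided by majority of triplets: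
`f(x^{(ab)}) = f(x^{(bc)}) = f(x^{(ca)})`. -/
def paradox (m : ℕ) : Set (Fin (3 * m) → Ranking) :=
  {r | majTriplets m (votes r 0 1) = majTriplets m (votes r 1 2) ∧
       majTriplets m (votes r 1 2) = majTriplets m (votes r 2 0)}

/-- The filter on `ℕ` of `m → ∞` along odd `m`. -/
def oddAtTop : Filter ℕ := atTop ⊓ 𝓟 {m | Odd m}

end CondorcetTriplets

open CondorcetTriplets

/-!
# Majority of triplets in close three-candidate elections

The voters are grouped into `m` independent triplets. In the election `k` (one of `ab`, `bc`,
`ca`) a triplet has a vote sum `S_k`, a vote product `Π_k` and a majority `A_k = (S_k - Π_k) / 2`,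
and majority of triplets is the sign of the sum of the `A_k`. Both conditioning events say,
exactly or approximately, that the sums over the triplets of a three-dimensional *latent vector*
`p S_k - q Π_k` are small: smaller than their natural order `√m` by a factor of order `log m`, so
that in the limit the latent sums are conditioned to vanish.

* For close margins this is immediate, with `p = 1` and `q = 0`.
* The mean of a noisy majority of three votes is `b_k = (ρ / 2) S_k - (ρ ^ 3 / 2) Π_k`, so `T_ρ f`
  is the mean sign of a sum of independent signs with means `b_k`. Dirichlet's integral for the
  sign of an odd integer turns it into an integral of a product of characteristic functions
  (`noiseOp_majTriplets`), and replacing these by Gaussian ones costs `O(1 / √m)`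
  (`exists_abs_signIntegral_sub_gaussErf_le`): `T_ρ f` is close to the Gaussian error function at
  `∑ b_k / √(∑ (1 - b_k ^ 2))`. The sum under the root is concentrated near a multiple of `m` by
  Chebyshev's inequality, so up to events of probability `O(1 / m)` the event
  `|T_ρ f| ≤ 1 / log m` is squeezed between two events of the form `|∑ b_k| ≤ c √m / log m` with
  almost equal constants `c` (`tendsto_noiseBox`).

The joint behaviour of the latent sums and the majorities is given by a local limit theorem
(`tendsto_pow_mul_measureReal_local`): the probability that the latent sums are in a box of size
`√m / L`, with `L → ∞` and `L ^ 4 ≤ m`, and that the sums of two of the majorities have the same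
sign, is asymptotic to a constant times `L ^ (-3)` times the probability of the same sign under
the Gaussian law of the residuals of the majorities after linear regression on the latent vector.
Since `L` grows slowly, no lattice structure is seen. For the proof, the law of the sums is tilted
by a Gaussian weight in `L / √m` times the latent sums. Fourier inversion of the weight writes the
characteristic function of the tilted law as an integral of `m`-th powers of the characteristic
function of a single triplet, to which dominated convergence applies; Lévy's theorem gives weak convergence of
the tilted laws, and the weight, which is bounded below on the box, is then divided out.

All second moments are invariant under permutations of the elections (`integral_latent_sq`), so
the regression is diagonal along `(1, 1, 1)` and its orthogonal complement. The partial
correlation is `r = -1 / 27` for close margins and `-(27 + 175 ρ ^ 4) / (729 + 525 ρ ^ 4)` for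
close noisy elections. By Sheppard's formula two majorities agree with limiting probability
`1 / 2 + arcsin r / π`, and as either all three or exactly one of the three pairs of signs agree,
the paradox has limiting probability `(3 (1 / 2 + arcsin r / π) - 1) / 2`. This is monotone and
continuous in `r`, which gives the bounds and the limit `ρ → 0`.
-/

namespace CondorcetTriplets

/-! ### Characteristic functions of small centred variables -/

section CharacteristicFunction

open Complex

variable {Ω : Type*} [MeasurableSpace Ω] [Finite Ω] [MeasurableSingletonClass Ω]
  (P : Measure Ω) [IsProbabilityMeasure P]

lemma norm_cexp_mul_I_sub_le {x κ : ℝ} (hx : |x| ≤ κ) (hκ : κ ≤ 1) :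
    ‖cexp (x * I) - (1 + x * I - x ^ 2 / 2)‖ ≤ κ / 4 * x ^ 2 := by
  have h1 : ‖(x * I : ℂ)‖ = |x| := by simp
  have h := Complex.exp_bound (x := x * I) (by rw [h1]; linarith) (n := 3) (by norm_num)
  rw [h1] at h
  have e : ∑ k ∈ Finset.range 3, (x * I : ℂ) ^ k / (k.factorial : ℂ)
      = 1 + x * I - x ^ 2 / 2 := by
    simp [Finset.sum_range_succ, Nat.factorial, mul_pow]; ring
  rw [e] at h
  refine h.trans ?_
  have h2 : |x| ^ 3 ≤ κ * x ^ 2 := by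
    rw [pow_succ', sq_abs]; gcongr
  have h3 : (0:ℝ) ≤ κ * x ^ 2 := mul_nonneg ((abs_nonneg x).trans hx) (sq_nonneg x)
  norm_num [Nat.factorial]
  linarith

/-- Second order expansion of the characteristic function of a small centred random variable. -/
lemma norm_integral_cexp_sub_le {X : Ω → ℝ} {κ : ℝ} (hX : ∀ ω, |X ω| ≤ κ) (hκ : κ ≤ 1)
    (h0 : ∫ ω, X ω ∂P = 0) :
    ‖∫ ω, cexp (X ω * I) ∂P - (1 - ((∫ ω, X ω ^ 2 ∂P : ℝ) : ℂ) / 2)‖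
      ≤ κ / 4 * ∫ ω, X ω ^ 2 ∂P := by
  have e : (1 - ((∫ ω, X ω ^ 2 ∂P : ℝ) : ℂ) / 2)
      = ∫ ω, (1 + X ω * I - (X ω : ℂ) ^ 2 / 2) ∂P := by
    rw [integral_sub .of_finite .of_finite, integral_add .of_finite .of_finite,
      integral_mul_const, integral_div, integral_complex_ofReal, h0, ← integral_complex_ofReal]
    simp
  rw [e, ← integral_sub .of_finite .of_finite, ← integral_const_mul]
  refine (norm_integral_le_integral_norm _).trans
    (integral_mono .of_finite .of_finite fun ω => ?_)
  exact norm_cexp_mul_I_sub_le (hX ω) hκ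

/-- Gaussian domination of the characteristic function of a bounded centred random variable. -/
lemma norm_integral_cexp_le {X : Ω → ℝ} (hX : ∀ ω, |X ω| ≤ 1) (h0 : ∫ ω, X ω ∂P = 0) :
    ‖∫ ω, cexp (X ω * I) ∂P‖ ≤ Real.exp (-(∫ ω, X ω ^ 2 ∂P) / 4) := by
  have h := norm_integral_cexp_sub_le P hX le_rfl h0
  set v := ∫ ω, X ω ^ 2 ∂P
  have hv1 : v ≤ 1 := by
    have : ∫ ω, X ω ^ 2 ∂P ≤ ∫ _, (1:ℝ) ∂P :=
      integral_mono .of_finite .of_finite fun ω => (sq_le_one_iff_abs_le_one _).2 (hX ω)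
    simpa using this
  have h2 : ‖(1 - (v : ℂ) / 2)‖ = 1 - v / 2 := by
    rw [show (1 - (v : ℂ) / 2) = ((1 - v / 2 : ℝ) : ℂ) by push_cast; ring, Complex.norm_real,
      Real.norm_eq_abs, abs_of_nonneg (by linarith)]
  have h3 := norm_sub_norm_le (∫ ω, cexp (X ω * I) ∂P) (1 - (v : ℂ) / 2)
  have h4 := Real.add_one_le_exp (-v / 4)
  linarith

/-- Pointwise central limit theorem for characteristic functions. -/
lemma tendsto_integral_cexp_pow {X : Ω → ℝ} (h0 : ∫ ω, X ω ∂P = 0) :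
    Tendsto (fun m : ℕ => (∫ ω, cexp (((X ω / √m : ℝ) : ℂ) * I) ∂P) ^ m) atTop
      (𝓝 (cexp (-((∫ ω, X ω ^ 2 ∂P : ℝ) : ℂ) / 2))) := by
  obtain ⟨K, hK⟩ := (Set.finite_range fun ω => |X ω|).bddAbove
  have hK' : ∀ ω, |X ω| ≤ K := fun ω => hK ⟨ω, rfl⟩
  set v := ∫ ω, X ω ^ 2 ∂P with hv
  -- it is enough that `m` times the deviation of the factor from `1` converges
  have key : Tendsto (fun m : ℕ => (m : ℂ) * (∫ ω, cexp (((X ω / √m : ℝ) : ℂ) * I) ∂P - 1))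
      atTop (𝓝 (-(v : ℂ) / 2)) := by
    rw [tendsto_iff_norm_sub_tendsto_zero]
    have hlim : Tendsto (fun m : ℕ => K / √m / 4 * v) atTop (𝓝 0) := by
      have : Tendsto (fun m : ℕ => √(m : ℝ)) atTop atTop :=
        Real.tendsto_sqrt_atTop.comp tendsto_natCast_atTop_atTop
      simpa using ((tendsto_const_nhds (x := K)).div_atTop this |>.div_const 4).mul_const v
    have hs : Tendsto (fun m : ℕ => √(m : ℝ)) atTop atTop :=
      Real.tendsto_sqrt_atTop.comp tendsto_natCast_atTop_atTop
    refine squeeze_zero' (Eventually.of_forall fun _ => norm_nonneg _) ?_ hlim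
    filter_upwards [hs.eventually_ge_atTop K, eventually_gt_atTop 0] with m hm hm0
    have hm1 : (0:ℝ) < m := by exact_mod_cast hm0
    have hsm : 0 < √(m : ℝ) := Real.sqrt_pos.2 hm1
    have h := norm_integral_cexp_sub_le P (X := fun ω => X ω / √m) (κ := K / √m)
      (fun ω => by rw [abs_div, abs_of_pos hsm]; gcongr; exact hK' ω) ((div_le_one hsm).2 hm)
      (by rw [integral_div, h0, zero_div])
    have h5 : ∫ ω, (X ω / √m) ^ 2 ∂P = v / m := by
      simp_rw [div_pow, Real.sq_sqrt hm1.le]; rw [integral_div]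
    rw [h5] at h
    have hmc : (m : ℂ) ≠ 0 := by exact_mod_cast hm0.ne'
    have h6 : (m : ℂ) * (∫ ω, cexp (((X ω / √m : ℝ) : ℂ) * I) ∂P - 1) - -(v : ℂ) / 2
        = m * (∫ ω, cexp (((X ω / √m : ℝ) : ℂ) * I) ∂P - (1 - ((v / m : ℝ) : ℂ) / 2)) := by
      generalize ∫ ω, cexp (((X ω / √m : ℝ) : ℂ) * I) ∂P = z
      push_cast; field_simp; ring
    rw [h6, norm_mul, Complex.norm_natCast]
    calc _ ≤ m * (K / √m / 4 * (v / m)) := by gcongr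
      _ = _ := by field_simp
  have := Complex.tendsto_one_add_pow_exp_of_tendsto key
  simpa using this

end CharacteristicFunction

/-! ### Integrability of the dominating functions -/

section Domination

open scoped RealInnerProductSpace

variable {T : Type*} [NormedAddCommGroup T] [InnerProductSpace ℝ T] [FiniteDimensional ℝ T]
  [MeasurableSpace T] [BorelSpace T]

lemma integrable_exp_neg_mul_norm {c : ℝ} (hc : 0 < c) :
    Integrable fun t : T => Real.exp (-c * ‖t‖) := by
  set n : ℕ := Module.finrank ℝ T + 1 with hn
  have hint := integrable_one_add_norm (E := T) (μ := volume) (r := (n : ℝ))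
    (by rw [hn]; push_cast; linarith)
  -- `e^x ≥ x ^ n / n!` turns exponential decay into polynomial decay
  refine (hint.const_mul (n.factorial / c ^ n * Real.exp c)).mono' (by fun_prop)
    (Eventually.of_forall fun t => ?_)
  have hx : 0 ≤ c * (1 + ‖t‖) := by positivity
  have h1 := Real.pow_div_factorial_le_exp _ hx n
  rw [Real.norm_eq_abs, abs_of_pos (Real.exp_pos _), Real.rpow_neg (by positivity),
    Real.rpow_natCast]
  have h2 : Real.exp (-c * ‖t‖) = Real.exp c / Real.exp (c * (1 + ‖t‖)) := by
    rw [← Real.exp_sub]; congr 1; ring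
  rw [h2, div_le_iff₀ (Real.exp_pos _)]
  have h3 : 0 < (1 + ‖t‖) ^ n := by positivity
  calc Real.exp c = n.factorial / c ^ n * Real.exp c * ((1 + ‖t‖) ^ n)⁻¹
        * ((c * (1 + ‖t‖)) ^ n / n.factorial) := by
        rw [mul_pow]; field_simp
    _ ≤ _ := by gcongr

lemma integrable_exp_neg_mul_sq_norm {c : ℝ} (hc : 0 < c) :
    Integrable fun t : T => Real.exp (-c * ‖t‖ ^ 2) := by
  have := (GaussianFourier.integrable_cexp_neg_mul_sq_norm_add (V := T) (b := c)
    (by simpa using hc) 0 0).norm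
  refine this.congr (Eventually.of_forall fun t => ?_)
  simp only [Complex.norm_exp]
  congr 1
  simp [← Complex.ofReal_pow]

end Domination

/-! ### Characteristic functions of random walks under a Gaussian weight -/

section Fourier

open Complex
open scoped RealInnerProductSpace

variable {Ω : Type*} [MeasurableSpace Ω] (P : Measure Ω) [IsProbabilityMeasure P]
variable {T : Type*} [NormedAddCommGroup T] [InnerProductSpace ℝ T]
variable {W : Type*} [NormedAddCommGroup W] [InnerProductSpace ℝ W]

/-- The characteristic function of `m ^ (-1/2) ∑ (y, a)` at `(t, s)`, for `m` independent copies
of the pair `(y, a)`. -/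
noncomputable def walkCharFun (y : Ω → T) (a : Ω → W) (m : ℕ) (t : T) (s : W) : ℂ :=
  (∫ ω, cexp ((((⟪y ω, t⟫ + ⟪a ω, s⟫) / √m : ℝ) : ℂ) * I) ∂P) ^ m

lemma norm_walkCharFun_le_one (y : Ω → T) (a : Ω → W) (m : ℕ) (t : T) (s : W) :
    ‖walkCharFun P y a m t s‖ ≤ 1 := by
  rw [walkCharFun, norm_pow]
  refine pow_le_one₀ (norm_nonneg _) ((norm_integral_le_integral_norm _).trans ?_)
  simp_rw [norm_exp_ofReal_mul_I]
  simp

variable [Finite Ω] [MeasurableSingletonClass Ω]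

lemma continuous_walkCharFun (y : Ω → T) (a : Ω → W) (m : ℕ) (s : W) :
    Continuous fun t => walkCharFun P y a m t s := by
  have := Fintype.ofFinite Ω
  simp only [walkCharFun, integral_fintype .of_finite]
  fun_prop

lemma norm_walkCharFun_le {y : Ω → T} {a : Ω → W}
    (hy : ∀ t, ∫ ω, ⟪y ω, t⟫ ∂P = 0) (ha : ∀ s, ∫ ω, ⟪a ω, s⟫ ∂P = 0) {m : ℕ} (hm : 0 < m)
    {t : T} {s : W} (hX : ∀ ω, |⟪y ω, t⟫ + ⟪a ω, s⟫| ≤ √m) :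
    ‖walkCharFun P y a m t s‖ ≤ Real.exp (-(∫ ω, (⟪y ω, t⟫ + ⟪a ω, s⟫) ^ 2 ∂P) / 4) := by
  have hm1 : (0:ℝ) < m := by exact_mod_cast hm
  have hsm : 0 < √(m : ℝ) := Real.sqrt_pos.2 hm1
  have h := norm_integral_cexp_le P (X := fun ω => (⟪y ω, t⟫ + ⟪a ω, s⟫) / √m)
    (fun ω => by rw [abs_div, abs_of_pos hsm]; exact (div_le_one hsm).2 (hX ω))
    (by rw [integral_div, integral_add .of_finite .of_finite, hy, ha]; simp)
  rw [walkCharFun, norm_pow]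
  refine (pow_le_pow_left₀ (norm_nonneg _) h m).trans (le_of_eq ?_)
  rw [← Real.exp_nat_mul]
  congr 1
  simp_rw [div_pow, Real.sq_sqrt hm1.le]; rw [integral_div]
  field_simp

variable [FiniteDimensional ℝ T] [MeasurableSpace T] [BorelSpace T]

/-- The Fourier side of the local limit theorem. The Gaussian weight has width `L m`, which grows
so slowly (`L m ^ 4 ≤ m`) that outside of the range `‖t‖ ≤ ε √m`, where the characteristic function
is dominated by a Gaussian, the weight itself is at most a constant times `exp (-ε ‖t‖ / 4)`. -/
lemma tendsto_integral_weight_mul_walkCharFun {y : Ω → T} {a : Ω → W}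
    (hy : ∀ t, ∫ ω, ⟪y ω, t⟫ ∂P = 0) (ha : ∀ s, ∫ ω, ⟪a ω, s⟫ ∂P = 0)
    {M : W → T} {Q : W → ℝ}
    (hquad : ∀ t s, ∫ ω, (⟪y ω, t⟫ + ⟪a ω, s⟫) ^ 2 ∂P = ∫ ω, ⟪y ω, t + M s⟫ ^ 2 ∂P + Q s)
    {lam : ℝ} (hlam : 0 < lam) (hpos : ∀ t, lam * ‖t‖ ^ 2 ≤ ∫ ω, ⟪y ω, t⟫ ^ 2 ∂P)
    {L : ℕ → ℝ} (hL : Tendsto L atTop atTop) (hLm : ∀ᶠ m : ℕ in atTop, L m ^ 4 ≤ m)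
    (τ : T) (s : W) :
    Tendsto (fun m => ∫ t, (Real.exp (-‖(L m)⁻¹ • t - τ‖ ^ 2 / 2) : ℂ) * walkCharFun P y a m t s)
      atTop (𝓝 ((Real.exp (-‖τ‖ ^ 2 / 2) * Real.exp (-Q s / 2) *
        ∫ t, Real.exp (-(∫ ω, ⟪y ω, t⟫ ^ 2 ∂P) / 2) : ℝ) : ℂ)) := by
  obtain ⟨Ky, hKy⟩ := (Set.finite_range fun ω => ‖y ω‖).bddAbove
  obtain ⟨Ka, hKa⟩ := (Set.finite_range fun ω => ‖a ω‖).bddAbove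
  have hKy' : ∀ ω, ‖y ω‖ ≤ Ky := fun ω => hKy ⟨ω, rfl⟩
  have hKa' : ∀ ω, ‖a ω‖ ≤ Ka := fun ω => hKa ⟨ω, rfl⟩
  have hne : Nonempty Ω := P.nonempty_of_neZero
  have hKy0 : 0 ≤ Ky := (norm_nonneg _).trans (hKy' hne.some)
  have hQ : 0 ≤ Q s := by
    have h := hquad (-M s) s
    have h2 : 0 ≤ ∫ ω, (⟪y ω, -M s⟫ + ⟪a ω, s⟫) ^ 2 ∂P := integral_nonneg fun ω => sq_nonneg _
    simp at h
    simp at h2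
    linarith
  -- for `‖t‖ ≤ ε √m` the exponent of the characteristic function of one step is at most `1`
  set ε : ℝ := 1 / (2 * (Ky + 1)) with hε
  have hε0 : 0 < ε := by positivity
  have hs : Tendsto (fun m : ℕ => √(m : ℝ)) atTop atTop :=
    Real.tendsto_sqrt_atTop.comp tendsto_natCast_atTop_atTop
  have hlimval : (Real.exp (-‖τ‖ ^ 2 / 2) * Real.exp (-Q s / 2) *
        ∫ t, Real.exp (-(∫ ω, ⟪y ω, t⟫ ^ 2 ∂P) / 2) : ℝ) =
      ∫ t, Real.exp (-‖τ‖ ^ 2 / 2) * Real.exp (-(∫ ω, (⟪y ω, t⟫ + ⟪a ω, s⟫) ^ 2 ∂P) / 2) := by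
    rw [integral_const_mul, mul_assoc]
    congr 1
    simp_rw [hquad]
    have := integral_add_right_eq_self (μ := (volume : Measure T))
      (fun t => Real.exp (-Q s / 2) * Real.exp (-(∫ ω, ⟪y ω, t⟫ ^ 2 ∂P) / 2)) (M s)
    rw [← integral_const_mul, ← this]
    congr 1 with t
    rw [← Real.exp_add]; congr 1; ring
  rw [hlimval, ← integral_complex_ofReal]
  refine tendsto_integral_filter_of_dominated_convergence
    (fun t => Real.exp (-(lam / 4) * ‖t + M s‖ ^ 2)
      + Real.exp (‖τ‖ ^ 2 / 2) * Real.exp (-(ε / 4) * ‖t‖)) ?_ ?_ ?_ ?_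
  · refine Eventually.of_forall fun m => Continuous.aestronglyMeasurable ?_
    have := continuous_walkCharFun P y a m s
    fun_prop
  · filter_upwards [hLm, hL.eventually_gt_atTop 0, hs.eventually_ge_atTop (2 * Ka * ‖s‖),
      eventually_gt_atTop 0] with m hm hm0 hms hmpos
    refine Eventually.of_forall fun t => ?_
    have hm1 : (0:ℝ) < m := by exact_mod_cast hmpos
    have hsm : 0 < √(m : ℝ) := Real.sqrt_pos.2 hm1
    rw [norm_mul, Complex.norm_real, Real.norm_eq_abs, abs_of_pos (Real.exp_pos _)]
    rcases le_or_gt ‖t‖ (ε * √m) with ht | ht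
    · have hX : ∀ ω, |⟪y ω, t⟫ + ⟪a ω, s⟫| ≤ √m := fun ω => by
        have h1 : |⟪y ω, t⟫| ≤ Ky * (ε * √m) :=
          (abs_real_inner_le_norm _ _).trans (by gcongr; exact hKy' ω)
        have h2 : |⟪a ω, s⟫| ≤ Ka * ‖s‖ :=
          (abs_real_inner_le_norm _ _).trans (by gcongr; exact hKa' ω)
        have h3 : Ky * ε ≤ 1 / 2 := by
          rw [hε, mul_one_div, div_le_iff₀ (by positivity)]; linarith
        have h4 : Ky * (ε * √m) ≤ 1 / 2 * √m := by rw [← mul_assoc]; gcongr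
        have := abs_add_le ⟪y ω, t⟫ ⟪a ω, s⟫
        linarith
      have h1 := norm_walkCharFun_le P hy ha hmpos hX
      have h2 : Real.exp (-‖(L m)⁻¹ • t - τ‖ ^ 2 / 2) ≤ 1 := by
        rw [Real.exp_le_one_iff]; have := sq_nonneg ‖(L m)⁻¹ • t - τ‖; linarith
      have h3 : Real.exp (-(∫ ω, (⟪y ω, t⟫ + ⟪a ω, s⟫) ^ 2 ∂P) / 4)
          ≤ Real.exp (-(lam / 4) * ‖t + M s‖ ^ 2) := by
        rw [Real.exp_le_exp, hquad]; have := hpos (t + M s); linarith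
      have h4 : 0 ≤ Real.exp (‖τ‖ ^ 2 / 2) * Real.exp (-(ε / 4) * ‖t‖) := by positivity
      have h5 := mul_le_mul h2 h1 (norm_nonneg _) zero_le_one
      linarith
    · have h1 := norm_walkCharFun_le_one P y a m t s
      have hL2 : L m ^ 2 ≤ √m := Real.le_sqrt_of_sq_le (by rw [← pow_mul]; exact hm)
      have hL3 : ε * L m ^ 2 ≤ ‖t‖ := (by gcongr : ε * L m ^ 2 ≤ ε * √m).trans ht.le
      have h2 : ε * ‖t‖ ≤ ‖(L m)⁻¹ • t‖ ^ 2 := by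
        rw [norm_smul, norm_inv, Real.norm_eq_abs, abs_of_pos hm0, mul_pow, inv_pow,
          inv_mul_eq_div, le_div_iff₀ (by positivity)]
        nlinarith [norm_nonneg t]
      have h3 : ‖(L m)⁻¹ • t‖ ^ 2 / 2 - ‖τ‖ ^ 2 ≤ ‖(L m)⁻¹ • t - τ‖ ^ 2 := by
        have h4 := norm_sub_norm_le ((L m)⁻¹ • t) τ
        have h6 : ‖(L m)⁻¹ • t‖ ≤ ‖(L m)⁻¹ • t - τ‖ + ‖τ‖ := by linarith
        have h7 : ‖(L m)⁻¹ • t‖ ^ 2 ≤ (‖(L m)⁻¹ • t - τ‖ + ‖τ‖) ^ 2 := by gcongr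
        nlinarith [sq_nonneg (‖(L m)⁻¹ • t - τ‖ - ‖τ‖)]
      have h5 : Real.exp (-‖(L m)⁻¹ • t - τ‖ ^ 2 / 2)
          ≤ Real.exp (‖τ‖ ^ 2 / 2) * Real.exp (-(ε / 4) * ‖t‖) := by
        rw [← Real.exp_add, Real.exp_le_exp]; linarith
      have h6 := mul_le_mul h5 h1 (norm_nonneg _) (by positivity)
      have h7 : 0 ≤ Real.exp (-(lam / 4) * ‖t + M s‖ ^ 2) := (Real.exp_pos _).le
      linarith
  · exact ((integrable_exp_neg_mul_sq_norm (T := T) (by positivity : 0 < lam / 4)).comp_add_right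
      (M s)).add ((integrable_exp_neg_mul_norm (by positivity)).const_mul _)
  · refine Eventually.of_forall fun t => ?_
    push_cast
    refine Tendsto.mul ?_ ?_
    · have h1 : Tendsto (fun m => (L m)⁻¹ • t - τ) atTop (𝓝 ((0:ℝ) • t - τ)) :=
        ((tendsto_inv_atTop_zero.comp hL).smul_const t).sub_const τ
      have h2 : Continuous fun x : T => cexp (-(‖x‖ : ℂ) ^ 2 / 2) := by fun_prop
      have h3 := (h2.tendsto _).comp h1
      simpa [Function.comp_def] using h3
    · have h0 : ∫ ω, (⟪y ω, t⟫ + ⟪a ω, s⟫) ∂P = 0 := by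
        rw [integral_add .of_finite .of_finite, hy, ha, add_zero]
      have h1 := tendsto_integral_cexp_pow P h0
      exact h1

end Fourier

/-! ### Weak convergence with a density -/

section Portmanteau

variable {E : Type*} [MeasurableSpace E] [TopologicalSpace E] [OpensMeasurableSpace E]
  [HasOuterApproxClosed E]

/-- The portmanteau theorem with a bounded continuous density `exp g`: integrals of `exp g` over a
set with null frontier converge. The density is absorbed by exponentially tilting all measures. -/
lemma tendsto_setIntegral_exp_of_null_frontier {μs : ℕ → ProbabilityMeasure E}
    {μ : ProbabilityMeasure E} (h : Tendsto μs atTop (𝓝 μ)) {g : E → ℝ} (hg : Continuous g)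
    {R : ℝ} (hR : ∀ x, |g x| ≤ R) {S : Set E} (hS : (μ : Measure E) (frontier S) = 0) :
    Tendsto (fun n => ∫ x in S, Real.exp (g x) ∂(μs n : Measure E)) atTop
      (𝓝 (∫ x in S, Real.exp (g x) ∂(μ : Measure E))) := by
  set e : BoundedContinuousFunction E ℝ := BoundedContinuousFunction.ofNormedAddCommGroup
    (fun x => Real.exp (g x)) (by fun_prop) (Real.exp R) (fun x => by
      rw [Real.norm_eq_abs, abs_of_pos (Real.exp_pos _), Real.exp_le_exp]
      exact (le_abs_self _).trans (hR x)) with he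
  have he' : ∀ x, e x = Real.exp (g x) := fun x => rfl
  have hint : ∀ ν : ProbabilityMeasure E, Integrable (fun x => Real.exp (g x)) (ν : Measure E) :=
    fun ν => e.integrable (ν : Measure E)
  have hprob : ∀ ν : ProbabilityMeasure E, IsProbabilityMeasure ((ν : Measure E).tilted g) :=
    fun ν => isProbabilityMeasure_tilted (hint ν)
  have hZ : ∀ ν : ProbabilityMeasure E, 0 < ∫ x, Real.exp (g x) ∂(ν : Measure E) :=
    fun ν => integral_exp_pos (hint ν)
  rw [ProbabilityMeasure.tendsto_iff_forall_integral_tendsto] at h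
  have hZlim : Tendsto (fun n => ∫ x, Real.exp (g x) ∂(μs n : Measure E)) atTop
      (𝓝 (∫ x, Real.exp (g x) ∂(μ : Measure E))) := h e
  let tl : ProbabilityMeasure E → ProbabilityMeasure E := fun ν =>
    ⟨(ν : Measure E).tilted g, hprob ν⟩
  have htl : ∀ ν, ((tl ν : ProbabilityMeasure E) : Measure E) = (ν : Measure E).tilted g :=
    fun ν => rfl
  have hint' : ∀ (ν : ProbabilityMeasure E) (f : E → ℝ),
      ∫ x, f x ∂(tl ν : Measure E)
        = (∫ x, Real.exp (g x) ∂(ν : Measure E))⁻¹ *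
          ∫ x, Real.exp (g x) * f x ∂(ν : Measure E) := by
    intro ν f
    rw [htl, integral_tilted, ← integral_const_mul]
    congr 1 with x
    rw [smul_eq_mul]; ring
  have hweak : Tendsto (fun n => tl (μs n)) atTop (𝓝 (tl μ)) := by
    rw [ProbabilityMeasure.tendsto_iff_forall_integral_tendsto]
    intro f
    simp_rw [hint']
    exact (hZlim.inv₀ (hZ μ).ne').mul (h (e * f))
  have hnull : ((tl μ : ProbabilityMeasure E) : Measure E) (frontier S) = 0 :=
    tilted_absolutelyContinuous _ _ hS
  have hlim := ProbabilityMeasure.tendsto_measure_of_null_frontier_of_tendsto' hweak hnull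
  have hval : ∀ ν : ProbabilityMeasure E, ((tl ν : Measure E) S).toReal
      = (∫ x, Real.exp (g x) ∂(ν : Measure E))⁻¹ * ∫ x in S, Real.exp (g x) ∂(ν : Measure E) := by
    intro ν
    rw [htl, tilted_apply_eq_ofReal_integral, ENNReal.toReal_ofReal, ← integral_const_mul]
    · congr 1 with x; ring
    · exact integral_nonneg fun x => div_nonneg (Real.exp_pos _).le (hZ ν).le
  have hlim2 := (ENNReal.tendsto_toReal (measure_ne_top _ _)).comp hlim
  simp only [Function.comp_def, hval] at hlim2
  have hlim3 := hZlim.mul hlim2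
  have hc : ∀ ν : ProbabilityMeasure E, (∫ x, Real.exp (g x) ∂(ν : Measure E)) *
      ((∫ x, Real.exp (g x) ∂(ν : Measure E))⁻¹ * ∫ x in S, Real.exp (g x) ∂(ν : Measure E))
      = ∫ x in S, Real.exp (g x) ∂(ν : Measure E) := fun ν => by
    rw [← mul_assoc, mul_inv_cancel₀ (hZ ν).ne', one_mul]
  simpa only [hc] using hlim3

end Portmanteau

/-! ### Fourier representation of the weighted characteristic function -/

section LocalLimit

open Complex
open scoped RealInnerProductSpace

variable {Ω : Type*} [MeasurableSpace Ω] (P : Measure Ω) [IsProbabilityMeasure P]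
variable {T : Type*} [NormedAddCommGroup T] [InnerProductSpace ℝ T]
variable {W : Type*} [NormedAddCommGroup W] [InnerProductSpace ℝ W]

lemma integral_cexp_sum_eq_walkCharFun (y : Ω → T) (a : Ω → W) (m : ℕ) (t : T) (s : W) :
    ∫ ω, cexp (((⟪(√m)⁻¹ • ∑ i, y (ω i), t⟫ + ⟪(√m)⁻¹ • ∑ i, a (ω i), s⟫ : ℝ) : ℂ) * I)
      ∂(Measure.pi fun _ : Fin m => P) = walkCharFun P y a m t s := by
  have h := integral_fintype_prod_eq_pow (ι := Fin m) (μ := P)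
    (fun ω => cexp ((((⟪y ω, t⟫ + ⟪a ω, s⟫) / √m : ℝ) : ℂ) * I))
  rw [Fintype.card_fin] at h
  rw [walkCharFun, ← h]
  congr 1 with ω
  rw [← Complex.exp_sum, ← Finset.sum_mul, ← Complex.ofReal_sum]
  congr 3
  rw [← Finset.sum_div, Finset.sum_add_distrib, real_inner_smul_left, real_inner_smul_left,
    sum_inner, sum_inner]
  ring

variable [FiniteDimensional ℝ T] [MeasurableSpace T] [BorelSpace T]

lemma integral_exp_neg_sq_norm_pos : 0 < ∫ z : T, Real.exp (-‖z‖ ^ 2 / 2) := by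
  have h := integrable_exp_neg_mul_sq_norm (T := T) (c := 1 / 2) (by norm_num)
  refine integral_exp_pos (f := fun z : T => -‖z‖ ^ 2 / 2) (h.congr ?_)
  exact Eventually.of_forall fun z => by dsimp only; congr 1; ring

/-- The Fourier transform of a Gaussian of width `l` centred at `l • τ`. -/
lemma integral_weight_mul_cexp {l : ℝ} (hl : 0 < l) (u τ : T) :
    ∫ t, (Real.exp (-‖l⁻¹ • t - τ‖ ^ 2 / 2) : ℂ) * cexp ((⟪u, t⟫ : ℝ) * I)
      = (l ^ Module.finrank ℝ T * ∫ z : T, Real.exp (-‖z‖ ^ 2 / 2) : ℝ) *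
        ((Real.exp (-‖l • u‖ ^ 2 / 2) : ℂ) * cexp ((⟪l • u, τ⟫ : ℝ) * I)) := by
  have h1 := Measure.integral_comp_inv_smul (volume : Measure T)
    (fun z => (Real.exp (-‖z - τ‖ ^ 2 / 2) : ℂ) * cexp ((⟪l • u, z⟫ : ℝ) * I)) l
  have h2 : ∀ t : T, ⟪l • u, l⁻¹ • t⟫ = ⟪u, t⟫ := fun t => by
    rw [real_inner_smul_left, real_inner_smul_right]; field_simp
  simp_rw [h2] at h1
  rw [h1, ← integral_add_right_eq_self _ τ, abs_of_pos (pow_pos hl _), real_smul]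
  simp only [add_sub_cancel_right]
  have h3 := GaussianFourier.integral_cexp_neg_mul_sq_norm_add (V := T) (b := 1 / 2)
    (by norm_num) I (l • u)
  rw [← GaussianFourier.integral_cexp_neg_mul_sq_norm (V := T) (b := 1 / 2) (by norm_num)] at h3
  have h4 : ∫ z : T, cexp (-(1 / 2) * ‖z‖ ^ 2)
      = ((∫ z : T, Real.exp (-‖z‖ ^ 2 / 2) : ℝ) : ℂ) := by
    rw [← integral_complex_ofReal]
    congr 1 with z; push_cast; congr 1; ring
  have h5 : ∫ z : T, (Real.exp (-‖z‖ ^ 2 / 2) : ℂ) * cexp ((⟪l • u, z + τ⟫ : ℝ) * I)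
      = cexp ((⟪l • u, τ⟫ : ℝ) * I) *
        ∫ z : T, cexp (-(1 / 2) * ‖z‖ ^ 2 + I * (⟪l • u, z⟫ : ℝ)) := by
    rw [← integral_const_mul]
    congr 1 with z
    push_cast
    rw [← Complex.exp_add, ← Complex.exp_add, inner_add_right]
    congr 1; push_cast; ring
  rw [h5, h3, h4]
  push_cast
  have h6 : cexp (I ^ 2 * (‖l • u‖ : ℂ) ^ 2 / (4 * (1 / 2))) = cexp (-(‖l • u‖ : ℂ) ^ 2 / 2) := by
    congr 1; rw [I_sq]; ring
  rw [h6]; ring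

variable [Finite Ω] [MeasurableSingletonClass Ω]

/-- Fourier representation of the characteristic function of `m ^ (-1/2) ∑ (y, a)`, weighted by a
Gaussian of width `l⁻¹` in the first component. -/
lemma integral_weighted_cexp_eq {l : ℝ} (hl : 0 < l) (y : Ω → T) (a : Ω → W) (m : ℕ)
    (τ : T) (s : W) :
    (l ^ Module.finrank ℝ T * ∫ z : T, Real.exp (-‖z‖ ^ 2 / 2) : ℝ) *
      ∫ ω, (Real.exp (-‖l • (√m)⁻¹ • ∑ i, y (ω i)‖ ^ 2 / 2) : ℂ) *
        cexp (((⟪l • (√m)⁻¹ • ∑ i, y (ω i), τ⟫ + ⟪(√m)⁻¹ • ∑ i, a (ω i), s⟫ : ℝ) : ℂ) * I)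
          ∂(Measure.pi fun _ : Fin m => P)
      = ∫ t, (Real.exp (-‖l⁻¹ • t - τ‖ ^ 2 / 2) : ℂ) * walkCharFun P y a m t s := by
  set U : (Fin m → Ω) → T := fun ω => (√m)⁻¹ • ∑ i, y (ω i) with hU
  set V : (Fin m → Ω) → W := fun ω => (√m)⁻¹ • ∑ i, a (ω i) with hV
  have hgauss : Integrable fun t : T => Real.exp (-‖l⁻¹ • t - τ‖ ^ 2 / 2) := by
    have h := integrable_exp_neg_mul_sq_norm (T := T) (c := 1 / 2) (by norm_num)
    have h' : Integrable fun t : T => Real.exp (-‖t - τ‖ ^ 2 / 2) := by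
      refine (h.comp_sub_right τ).congr (Eventually.of_forall fun z => ?_)
      dsimp only; congr 1; ring
    exact (integrable_comp_smul_iff volume _ (inv_ne_zero hl.ne')).2 h'
  calc _ = ∫ ω, cexp ((⟪V ω, s⟫ : ℝ) * I) *
          ((l ^ Module.finrank ℝ T * ∫ z : T, Real.exp (-‖z‖ ^ 2 / 2) : ℝ) *
            ((Real.exp (-‖l • U ω‖ ^ 2 / 2) : ℂ) * cexp ((⟪l • U ω, τ⟫ : ℝ) * I)))
          ∂(Measure.pi fun _ : Fin m => P) := by
        rw [← integral_const_mul]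
        congr 1 with ω
        have : cexp (((⟪l • U ω, τ⟫ + ⟪V ω, s⟫ : ℝ) : ℂ) * I)
            = cexp ((⟪l • U ω, τ⟫ : ℝ) * I) * cexp ((⟪V ω, s⟫ : ℝ) * I) := by
          rw [← Complex.exp_add]; push_cast; congr 1; ring
        rw [this]; ring
    _ = ∫ ω, (∫ t, (Real.exp (-‖l⁻¹ • t - τ‖ ^ 2 / 2) : ℂ) *
          cexp (((⟪U ω, t⟫ + ⟪V ω, s⟫ : ℝ) : ℂ) * I)) ∂(Measure.pi fun _ : Fin m => P) := by
        congr 1 with ω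
        rw [← integral_weight_mul_cexp hl, ← integral_const_mul]
        congr 1 with t
        have : cexp (((⟪U ω, t⟫ + ⟪V ω, s⟫ : ℝ) : ℂ) * I)
            = cexp ((⟪U ω, t⟫ : ℝ) * I) * cexp ((⟪V ω, s⟫ : ℝ) * I) := by
          rw [← Complex.exp_add]; push_cast; congr 1; ring
        rw [this]; ring
    _ = ∫ t, ∫ ω, (Real.exp (-‖l⁻¹ • t - τ‖ ^ 2 / 2) : ℂ) *
          cexp (((⟪U ω, t⟫ + ⟪V ω, s⟫ : ℝ) : ℂ) * I) ∂(Measure.pi fun _ : Fin m => P) := by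
        refine integral_integral_swap ?_
        have hd := (integrable_const (1:ℝ) (μ := Measure.pi fun _ : Fin m => P)).mul_prod hgauss
        have hUm : Measurable U := measurable_of_finite _
        have hVm : Measurable fun ω => ⟪V ω, s⟫ := measurable_of_finite _
        have hm : Measurable fun p : (Fin m → Ω) × T => ⟪U p.1, p.2⟫ :=
          (hUm.comp measurable_fst).inner measurable_snd
        have hm' : Measurable fun p : (Fin m → Ω) × T => ⟪V p.1, s⟫ := hVm.comp measurable_fst
        refine hd.mono' ?_ (Eventually.of_forall fun p => ?_)
        · refine Measurable.aestronglyMeasurable ?_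
          have : Measurable fun p : (Fin m → Ω) × T => p.2 := measurable_snd
          refine Measurable.mul (by fun_prop) ?_
          exact Complex.measurable_exp.comp
            ((Complex.measurable_ofReal.comp (hm.add hm')).mul_const I)
        · simp only [Function.uncurry, norm_mul, norm_exp_ofReal_mul_I, Complex.norm_real,
            Real.norm_eq_abs, abs_of_pos (Real.exp_pos _)]
          linarith
    _ = _ := by
        congr 1 with t
        rw [integral_const_mul, integral_cexp_sum_eq_walkCharFun]

end LocalLimit

/-! ### The local limit theorem -/

section LocalLimitTheorem

open Complex
open scoped RealInnerProductSpace

variable {Ω : Type*} [MeasurableSpace Ω] (P : Measure Ω) [IsProbabilityMeasure P]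
variable {T : Type*} [NormedAddCommGroup T] [InnerProductSpace ℝ T]
  [FiniteDimensional ℝ T] [MeasurableSpace T] [BorelSpace T]

/-- The limiting density at the origin of `m ^ (-1/2) ∑ y`, times the Lebesgue measure of `B`.
The latter is written as the integral over `B` of the inverse of the standard Gaussian density,
which is the form in which it arises. -/
noncomputable def localDensity (y : Ω → T) (B : Set T) : ℝ :=
  (∫ t, Real.exp (-(∫ ω, ⟪y ω, t⟫ ^ 2 ∂P) / 2)) / (∫ z : T, Real.exp (-‖z‖ ^ 2 / 2)) *
    ∫ u in B, Real.exp (‖u‖ ^ 2 / 2) ∂(stdGaussian T)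

variable [Finite Ω] [MeasurableSingletonClass Ω]

lemma integral_exp_neg_quadratic_pos {y : Ω → T} {lam : ℝ} (hlam : 0 < lam)
    (hpos : ∀ t, lam * ‖t‖ ^ 2 ≤ ∫ ω, ⟪y ω, t⟫ ^ 2 ∂P) :
    0 < ∫ t, Real.exp (-(∫ ω, ⟪y ω, t⟫ ^ 2 ∂P) / 2) := by
  refine integral_exp_pos (f := fun t => -(∫ ω, ⟪y ω, t⟫ ^ 2 ∂P) / 2) ?_
  refine (integrable_exp_neg_mul_sq_norm (T := T) (half_pos hlam)).mono' ?_
    (Eventually.of_forall fun t => ?_)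
  · have := Fintype.ofFinite Ω
    simp only [integral_fintype .of_finite]
    exact Continuous.aestronglyMeasurable (by fun_prop)
  · rw [Real.norm_eq_abs, abs_of_pos (Real.exp_pos _), Real.exp_le_exp]
    have := hpos t; linarith

lemma localDensity_pos {y : Ω → T} {lam : ℝ} (hlam : 0 < lam)
    (hpos : ∀ t, lam * ‖t‖ ^ 2 ≤ ∫ ω, ⟪y ω, t⟫ ^ 2 ∂P) {B : Set T} (hB : Bornology.IsBounded B)
    (hBm : MeasurableSet B) (hB0 : stdGaussian T B ≠ 0) : 0 < localDensity P y B := by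
  have h1 : 0 < ∫ t, Real.exp (-(∫ ω, ⟪y ω, t⟫ ^ 2 ∂P) / 2) :=
    integral_exp_neg_quadratic_pos P hlam hpos
  obtain ⟨R, hR⟩ := hB.exists_norm_le
  have h2 : 0 < ∫ u in B, Real.exp (‖u‖ ^ 2 / 2) ∂(stdGaussian T) := by
    rw [setIntegral_pos_iff_support_of_nonneg_ae]
    · have : Function.support (fun u : T => Real.exp (‖u‖ ^ 2 / 2)) = Set.univ :=
        Set.eq_univ_of_forall fun u => (Real.exp_pos _).ne'
      rw [this, Set.univ_inter]
      exact pos_iff_ne_zero.2 hB0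
    · exact Eventually.of_forall fun u => (Real.exp_pos _).le
    · refine Measure.integrableOn_of_bounded (M := Real.exp (R ^ 2 / 2)) (measure_ne_top _ _)
        (Continuous.aestronglyMeasurable (by fun_prop)) ?_
      refine (ae_restrict_iff' hBm).2 (Eventually.of_forall fun u hu => ?_)
      rw [Real.norm_eq_abs, abs_of_pos (Real.exp_pos _), Real.exp_le_exp]
      have := hR u hu
      gcongr
  exact mul_pos (div_pos h1 integral_exp_neg_sq_norm_pos) h2

variable {W : Type*} [NormedAddCommGroup W] [InnerProductSpace ℝ W]
  [FiniteDimensional ℝ W] [MeasurableSpace W] [BorelSpace W]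

/-- A local limit theorem: the probability that `m ^ (-1/2) ∑ y` lies in the small set `(L m)⁻¹ B`,
while `m ^ (-1/2) ∑ a` lies in `O`, is asymptotic to `L m ^ (-d)` times the limiting density of the
former at `0`, times the mass of `O` under the centred Gaussian law `γ`. The quadratic form `Q` of
`γ` is what remains of the covariance form of `(y, a)` after completing the square with `M`, so that
`γ` is the conditional limiting law of `m ^ (-1/2) ∑ a` given that `m ^ (-1/2) ∑ y` vanishes. -/
theorem tendsto_pow_mul_measureReal_local {y : Ω → T} {a : Ω → W}
    (hy : ∀ t, ∫ ω, ⟪y ω, t⟫ ∂P = 0) (ha : ∀ s, ∫ ω, ⟪a ω, s⟫ ∂P = 0)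
    {M : W → T} {Q : W → ℝ}
    (hquad : ∀ t s, ∫ ω, (⟪y ω, t⟫ + ⟪a ω, s⟫) ^ 2 ∂P = ∫ ω, ⟪y ω, t + M s⟫ ^ 2 ∂P + Q s)
    {lam : ℝ} (hlam : 0 < lam) (hpos : ∀ t, lam * ‖t‖ ^ 2 ≤ ∫ ω, ⟪y ω, t⟫ ^ 2 ∂P)
    {γ : Measure W} [IsProbabilityMeasure γ] (hγ : ∀ s, charFun γ s = (Real.exp (-Q s / 2) : ℂ))
    {L : ℕ → ℝ} (hL : Tendsto L atTop atTop) (hLm : ∀ᶠ m : ℕ in atTop, L m ^ 4 ≤ m)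
    {B : Set T} (hB : Bornology.IsBounded B) (hBm : MeasurableSet B)
    (hBf : stdGaussian T (frontier B) = 0)
    {O : Set W} (hOm : MeasurableSet O) (hOf : γ (frontier O) = 0) :
    Tendsto (fun m : ℕ => L m ^ Module.finrank ℝ T *
        (Measure.pi fun _ : Fin m => P).real
          {ω | L m • (√m)⁻¹ • ∑ i, y (ω i) ∈ B ∧ (√m)⁻¹ • ∑ i, a (ω i) ∈ O})
      atTop (𝓝 (localDensity P y B * γ.real O)) := by
  set U : (m : ℕ) → (Fin m → Ω) → T := fun m ω => L m • (√m)⁻¹ • ∑ i, y (ω i) with hU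
  set V : (m : ℕ) → (Fin m → Ω) → W := fun m ω => (√m)⁻¹ • ∑ i, a (ω i) with hV
  set Pm : (m : ℕ) → Measure (Fin m → Ω) := fun m => Measure.pi fun _ : Fin m => P with hPm
  set f : (m : ℕ) → (Fin m → Ω) → ℝ := fun m ω => -‖U m ω‖ ^ 2 / 2 with hf
  set N : ℕ → ℝ := fun m => ∫ ω, Real.exp (f m ω) ∂(Pm m) with hN
  set d := Module.finrank ℝ T with hd
  set G : ℝ := ∫ z : T, Real.exp (-‖z‖ ^ 2 / 2) with hG
  set D : ℝ := ∫ t, Real.exp (-(∫ ω, ⟪y ω, t⟫ ^ 2 ∂P) / 2) with hD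
  have hG0 : 0 < G := integral_exp_neg_sq_norm_pos
  have hN0 : ∀ m, 0 < N m := fun m => integral_exp_pos .of_finite
  have hQ0 : Real.exp (-Q 0 / 2) = 1 := by
    have h := hγ 0
    rw [charFun_zero, probReal_univ] at h
    exact_mod_cast h.symm
  -- convergence of the weighted characteristic functions, before normalization
  have hchar : ∀ τ s, Tendsto (fun m => (L m ^ d * G : ℝ) *
      ∫ ω, (Real.exp (f m ω) : ℂ) * cexp (((⟪U m ω, τ⟫ + ⟪V m ω, s⟫ : ℝ) : ℂ) * I) ∂(Pm m)) atTop
      (𝓝 ((Real.exp (-‖τ‖ ^ 2 / 2) * Real.exp (-Q s / 2) * D : ℝ) : ℂ)) := by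
    intro τ s
    refine (tendsto_integral_weight_mul_walkCharFun P hy ha hquad hlam hpos hL hLm τ s).congr' ?_
    filter_upwards [hL.eventually_gt_atTop 0] with m hm
    exact (integral_weighted_cexp_eq P hm y a m τ s).symm
  have hmass : Tendsto (fun m => L m ^ d * G * N m) atTop (𝓝 D) := by
    have h := hchar 0 0
    simp only [inner_zero_right, add_zero, ofReal_zero, zero_mul, Complex.exp_zero, mul_one,
      norm_zero, hQ0] at h
    have h' : ∀ m, ((L m ^ d * G : ℝ) : ℂ) * ∫ ω, (Real.exp (f m ω) : ℂ) ∂(Pm m)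
        = ((L m ^ d * G * N m : ℝ) : ℂ) := fun m => by
      rw [integral_complex_ofReal]; push_cast; rfl
    simp only [h'] at h
    have h2 : Tendsto (fun m => L m ^ d * G * N m) atTop (𝓝 (Real.exp (-0 ^ 2 / 2) * D)) :=
      (Complex.continuous_re.tendsto _).comp h
    simpa using h2
  have hD0 : 0 < D :=
    integral_exp_neg_quadratic_pos P hlam hpos
  -- the normalized weighted laws converge weakly, by Lévy's theorem
  have hprob : ∀ m, IsProbabilityMeasure ((Pm m).tilted (f m)) := fun m =>
    isProbabilityMeasure_tilted .of_finite
  set X : (m : ℕ) → (Fin m → Ω) → WithLp 2 (T × W) := fun m ω => WithLp.toLp 2 (U m ω, V m ω)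
    with hX
  have hXm : ∀ m, Measurable (X m) := fun m => measurable_of_finite _
  let ν : ℕ → ProbabilityMeasure (WithLp 2 (T × W)) := fun m =>
    ⟨((Pm m).tilted (f m)).map (X m), Measure.isProbabilityMeasure_map (hXm m).aemeasurable⟩
  have hν : ∀ m, (ν m : Measure (WithLp 2 (T × W))) = ((Pm m).tilted (f m)).map (X m) :=
    fun m => rfl
  let ν₀ : ProbabilityMeasure (WithLp 2 (T × W)) :=
    ⟨((stdGaussian T).prod γ).map (WithLp.toLp 2),
      Measure.isProbabilityMeasure_map (Measurable.aemeasurable (by fun_prop))⟩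
  have hν₀ : (ν₀ : Measure (WithLp 2 (T × W))) = ((stdGaussian T).prod γ).map (WithLp.toLp 2) := rfl
  have hweak : Tendsto ν atTop (𝓝 ν₀) := by
    refine ProbabilityMeasure.tendsto_of_tendsto_charFun fun x => ?_
    set τ := (WithLp.ofLp x).1
    set s := (WithLp.ofLp x).2
    have h1 : charFun (ν₀ : Measure (WithLp 2 (T × W))) x
        = ((Real.exp (-‖τ‖ ^ 2 / 2) * Real.exp (-Q s / 2) : ℝ) : ℂ) := by
      rw [hν₀, charFun_prod, hγ, charFun_stdGaussian]
      push_cast; rfl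
    have h2 : ∀ m, charFun (ν m : Measure (WithLp 2 (T × W))) x = ((N m)⁻¹ : ℝ) *
        ∫ ω, (Real.exp (f m ω) : ℂ) * cexp (((⟪U m ω, τ⟫ + ⟪V m ω, s⟫ : ℝ) : ℂ) * I) ∂(Pm m) := by
      intro m
      rw [hν, charFun_apply, integral_map (hXm m).aemeasurable
        (Continuous.aestronglyMeasurable (by fun_prop)), integral_tilted, ← integral_const_mul]
      congr 1 with ω
      rw [WithLp.prod_inner_apply, real_smul]
      push_cast
      ring
    rw [h1]
    have h3 := ((Complex.continuous_ofReal.tendsto _).comp (hmass.inv₀ hD0.ne')).mul (hchar τ s)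
    have h4 : ((D⁻¹ : ℝ) : ℂ) * ((Real.exp (-‖τ‖ ^ 2 / 2) * Real.exp (-Q s / 2) * D : ℝ) : ℂ)
        = ((Real.exp (-‖τ‖ ^ 2 / 2) * Real.exp (-Q s / 2) : ℝ) : ℂ) := by
      rw [← ofReal_mul]; congr 1; field_simp
    rw [h4] at h3
    refine h3.congr' ?_
    filter_upwards [hL.eventually_gt_atTop 0] with m hm
    rw [h2 m]
    have : (N m)⁻¹ = (L m ^ d * G * N m)⁻¹ * (L m ^ d * G) := by
      have := (hN0 m).ne'; have := hG0.ne'; field_simp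
    rw [this, Function.comp_apply, ← mul_assoc, ← ofReal_mul]
  -- undo the weighting on the bounded set `B`
  obtain ⟨R, hR⟩ := hB.exists_norm_le
  set S : Set (WithLp 2 (T × W)) := WithLp.ofLp ⁻¹' (B ×ˢ O) with hS
  have hSm : MeasurableSet S := by
    have : Measurable (WithLp.ofLp : WithLp 2 (T × W) → T × W) := by fun_prop
    exact this (hBm.prod hOm)
  set g : WithLp 2 (T × W) → ℝ := fun x => min (‖(WithLp.ofLp x).1‖ ^ 2 / 2) (R ^ 2 / 2) with hg
  have hgS : ∀ x ∈ S, g x = ‖(WithLp.ofLp x).1‖ ^ 2 / 2 := fun x hx => by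
    refine min_eq_left ?_
    have h : (WithLp.ofLp x).1 ∈ B := hx.1
    have := hR _ h
    gcongr
  have hgc : Continuous g := by fun_prop
  have hgb : ∀ x, |g x| ≤ R ^ 2 / 2 := fun x => by
    rw [abs_of_nonneg (le_min (by positivity) (by positivity))]; exact min_le_right _ _
  have hfr : (ν₀ : Measure (WithLp 2 (T × W))) (frontier S) = 0 := by
    have h1 : frontier S = WithLp.ofLp ⁻¹' (frontier (B ×ˢ O)) :=
      ((WithLp.homeomorphProd 2 T W).preimage_frontier (B ×ˢ O)).symm
    rw [h1, hν₀, Measure.map_apply (by fun_prop)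
      ((by fun_prop : Measurable (WithLp.ofLp : WithLp 2 (T × W) → T × W))
        isClosed_frontier.measurableSet)]
    have h2 : (WithLp.toLp 2 : T × W → WithLp 2 (T × W)) ⁻¹' (WithLp.ofLp ⁻¹' frontier (B ×ˢ O))
        = frontier (B ×ˢ O) := rfl
    rw [h2, frontier_prod_eq]
    refine measure_union_null ?_ ?_
    · rw [Measure.prod_prod, hOf, mul_zero]
    · rw [Measure.prod_prod, hBf, zero_mul]
  have hlim := tendsto_setIntegral_exp_of_null_frontier hweak hgc hgb hfr
  have hlim0 : ∫ x in S, Real.exp (g x) ∂(ν₀ : Measure (WithLp 2 (T × W)))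
      = (∫ u in B, Real.exp (‖u‖ ^ 2 / 2) ∂(stdGaussian T)) * γ.real O := by
    rw [setIntegral_congr_fun hSm (g := fun x => Real.exp (‖(WithLp.ofLp x).1‖ ^ 2 / 2))
      (fun x hx => by simp only [hgS x hx]), hν₀, setIntegral_map hSm
        (Continuous.aestronglyMeasurable (by fun_prop)) (by fun_prop)]
    have h := setIntegral_prod_mul (μ := stdGaussian T) (ν := γ)
      (fun u => Real.exp (‖u‖ ^ 2 / 2)) (fun _ => (1:ℝ)) B O
    simp only [mul_one, setIntegral_const, smul_eq_mul] at h
    exact h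
  have hval : ∀ m, (Pm m).real {ω | U m ω ∈ B ∧ V m ω ∈ O}
      = N m * ∫ x in S, Real.exp (g x) ∂(ν m : Measure (WithLp 2 (T × W))) := by
    intro m
    rw [setIntegral_congr_fun hSm (g := fun x => Real.exp (‖(WithLp.ofLp x).1‖ ^ 2 / 2))
      (fun x hx => by simp only [hgS x hx]), hν, setIntegral_map hSm
        (Continuous.aestronglyMeasurable (by fun_prop)) (hXm m).aemeasurable,
      setIntegral_tilted, ← integral_const_mul]
    have h1 : ∀ ω, N m * ((Real.exp (f m ω) / ∫ ω, Real.exp (f m ω) ∂(Pm m)) *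
        Real.exp (‖(WithLp.ofLp (X m ω)).1‖ ^ 2 / 2)) = 1 := fun ω => by
      have h2 : Real.exp (f m ω) * Real.exp (‖(WithLp.ofLp (X m ω)).1‖ ^ 2 / 2) = 1 := by
        rw [← Real.exp_add, Real.exp_eq_one_iff]
        simp only [hf, hX]; ring
      have h3 := (hN0 m).ne'
      rw [div_mul_eq_mul_div, h2]
      exact mul_one_div_cancel h3
    simp only [smul_eq_mul, h1, setIntegral_const, mul_one]
    rfl
  have hfin := (hmass.div_const G).mul hlim
  rw [hlim0] at hfin
  have e : localDensity P y B * γ.real O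
      = D / G * ((∫ u in B, Real.exp (‖u‖ ^ 2 / 2) ∂(stdGaussian T)) * γ.real O) := by
    rw [localDensity, mul_assoc]
  rw [e]
  refine hfin.congr fun m => ?_
  rw [hval m]
  field_simp

end LocalLimitTheorem

/-! ### Sheppard's formula -/

section Sheppard

open Real

/-- A planar standard Gaussian law gives a cone, described by the set `Θ` of its angles, mass
proportional to the length of `Θ`. -/
lemma gaussianReal_prod_apply_cone {A : Set (ℝ × ℝ)} (hA : MeasurableSet A) {Θ : Set ℝ}
    (hΘ : MeasurableSet Θ)
    (h : ∀ r θ : ℝ, 0 < r → ((r * cos θ, r * sin θ) ∈ A ↔ θ ∈ Θ)) :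
    ((gaussianReal 0 1).prod (gaussianReal 0 1)) A
      = (∫⁻ r in Set.Ioi (0:ℝ), ENNReal.ofReal (r * ((2 * π)⁻¹ * exp (-r ^ 2 / 2)))) *
        volume (Θ ∩ Set.Ioo (-π) π) := by
  have hpdf : ∀ z : ℝ × ℝ, gaussianPDF 0 1 z.1 * gaussianPDF 0 1 z.2
      = ENNReal.ofReal ((2 * π)⁻¹ * exp (-(z.1 ^ 2 + z.2 ^ 2) / 2)) := fun z => by
    rw [gaussianPDF, gaussianPDF, ← ENNReal.ofReal_mul (gaussianPDFReal_nonneg _ _ _)]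
    congr 1
    simp only [gaussianPDFReal, NNReal.coe_one, mul_one, sub_zero]
    rw [mul_mul_mul_comm, ← Real.exp_add, ← mul_inv, Real.mul_self_sqrt (by positivity)]
    congr 2; ring
  rw [gaussianReal_of_var_ne_zero _ one_ne_zero,
    prod_withDensity (measurable_gaussianPDF _ _) (measurable_gaussianPDF _ _),
    withDensity_apply _ hA, ← lintegral_indicator hA, ← Measure.volume_eq_prod,
    ← lintegral_comp_polarCoord_symm]
  have h1 : ∀ p ∈ polarCoord.target, ENNReal.ofReal p.1 • A.indicator
      (fun z : ℝ × ℝ => gaussianPDF 0 1 z.1 * gaussianPDF 0 1 z.2) (polarCoord.symm p)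
      = ENNReal.ofReal (p.1 * ((2 * π)⁻¹ * exp (-p.1 ^ 2 / 2))) * Θ.indicator 1 p.2 := by
    rintro ⟨r, θ⟩ hp
    have hr : 0 < r := hp.1
    simp only [polarCoord_symm_apply]
    by_cases hθ : θ ∈ Θ
    · rw [Set.indicator_of_mem ((h r θ hr).2 hθ), Set.indicator_of_mem hθ, hpdf, smul_eq_mul,
        ← ENNReal.ofReal_mul hr.le, Pi.one_apply, mul_one]
      congr 4
      have := Real.cos_sq_add_sin_sq θ
      linear_combination (-r ^ 2 / 2) * this
    · rw [Set.indicator_of_notMem (fun hc => hθ ((h r θ hr).1 hc)), Set.indicator_of_notMem hθ]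
      simp
  rw [setLIntegral_congr_fun polarCoord.open_target.measurableSet h1]
  have h2 : polarCoord.target = Set.Ioi (0:ℝ) ×ˢ Set.Ioo (-π) π := rfl
  rw [h2, Measure.volume_eq_prod, ← Measure.prod_restrict,
    lintegral_prod_mul (f := fun r => ENNReal.ofReal (r * ((2 * π)⁻¹ * exp (-r ^ 2 / 2))))
      (g := Θ.indicator 1) (by fun_prop) ((measurable_one.indicator hΘ).aemeasurable)]
  congr 1
  rw [lintegral_indicator_one hΘ, Measure.restrict_apply hΘ]

lemma gaussianReal_prod_real_cone {A : Set (ℝ × ℝ)} (hA : MeasurableSet A) {Θ : Set ℝ}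
    (hΘ : MeasurableSet Θ)
    (h : ∀ r θ : ℝ, 0 < r → ((r * cos θ, r * sin θ) ∈ A ↔ θ ∈ Θ)) :
    ((gaussianReal 0 1).prod (gaussianReal 0 1)).real A
      = volume.real (Θ ∩ Set.Ioo (-π) π) / (2 * π) := by
  have h0 := gaussianReal_prod_apply_cone MeasurableSet.univ MeasurableSet.univ
    (fun r θ _ => by simp)
  rw [measure_univ, Set.univ_inter, Real.volume_Ioo] at h0
  have h1 := gaussianReal_prod_apply_cone hA hΘ h
  set C := ∫⁻ r in Set.Ioi (0:ℝ), ENNReal.ofReal (r * ((2 * π)⁻¹ * exp (-r ^ 2 / 2)))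
  have h0' := congrArg ENNReal.toReal h0
  rw [ENNReal.toReal_one, ENNReal.toReal_mul, ENNReal.toReal_ofReal (by linarith [pi_pos])] at h0'
  have hC : C.toReal = 1 / (2 * π) := by
    rw [eq_div_iff (by positivity)]; linarith
  rw [Measure.real, h1, ENNReal.toReal_mul, hC, Measure.real]
  ring

lemma measurableSet_quadrant (ψ : ℝ) :
    MeasurableSet {z : ℝ × ℝ | 0 < z.1 ∧ 0 < sin ψ * z.1 + cos ψ * z.2} :=
  MeasurableSet.inter (s₁ := {z : ℝ × ℝ | 0 < z.1})
    (s₂ := {z : ℝ × ℝ | 0 < sin ψ * z.1 + cos ψ * z.2})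
    (measurableSet_lt measurable_const measurable_fst)
    (measurableSet_lt measurable_const (by fun_prop))

lemma gaussianReal_prod_real_quadrant {ψ : ℝ} (hψ : ψ ∈ Set.Ioo (-(π / 2)) (π / 2)) :
    ((gaussianReal 0 1).prod (gaussianReal 0 1)).real
      {z : ℝ × ℝ | 0 < z.1 ∧ 0 < sin ψ * z.1 + cos ψ * z.2} = 1 / 4 + ψ / (2 * π) := by
  have hΘ : MeasurableSet {θ : ℝ | 0 < cos θ ∧ 0 < sin (θ + ψ)} :=
    MeasurableSet.inter (s₁ := {θ : ℝ | 0 < cos θ}) (s₂ := {θ : ℝ | 0 < sin (θ + ψ)})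
      (measurableSet_lt measurable_const (by fun_prop))
      (measurableSet_lt measurable_const (by fun_prop))
  rw [gaussianReal_prod_real_cone (measurableSet_quadrant ψ) hΘ]
  · have : {θ : ℝ | 0 < cos θ ∧ 0 < sin (θ + ψ)} ∩ Set.Ioo (-π) π = Set.Ioo (-ψ) (π / 2) := by
      obtain ⟨hψ1, hψ2⟩ := hψ
      ext θ
      simp only [Set.mem_inter_iff, Set.mem_ofPred_eq, Set.mem_Ioo]
      constructor
      · rintro ⟨⟨h1, h2⟩, h3, h4⟩
        have h5 : θ < π / 2 := by
          by_contra! hc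
          exact absurd (cos_nonpos_of_pi_div_two_le_of_le hc (by linarith)) (not_le.2 h1)
        have h6 : -(π / 2) < θ := by
          by_contra! hc
          have := cos_nonpos_of_pi_div_two_le_of_le (x := -θ) (by linarith) (by linarith)
          rw [cos_neg] at this
          exact absurd this (not_le.2 h1)
        refine ⟨?_, h5⟩
        by_contra! hc
        exact absurd (sin_nonpos_of_nonpos_of_neg_pi_le (x := θ + ψ) (by linarith) (by linarith))
          (not_le.2 h2)
      · rintro ⟨h1, h2⟩
        exact ⟨⟨cos_pos_of_mem_Ioo ⟨by linarith, h2⟩,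
          sin_pos_of_pos_of_lt_pi (by linarith) (by linarith)⟩, by linarith, by linarith⟩
    rw [this, Measure.real, Real.volume_Ioo, ENNReal.toReal_ofReal (by linarith [hψ.1])]
    have := pi_pos
    field_simp; ring
  · intro r θ hr
    have : sin ψ * (r * cos θ) + cos ψ * (r * sin θ) = r * sin (θ + ψ) := by rw [sin_add]; ring
    simp only [Set.mem_ofPred_eq, this, mul_pos_iff_of_pos_left hr]

/-- **Sheppard's formula**: the probability that two Gaussian variables with correlation `sin ψ`
have the same sign. -/
lemma gaussianReal_prod_real_same_sign {ψ : ℝ} (hψ : ψ ∈ Set.Ioo (-(π / 2)) (π / 2)) :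
    ((gaussianReal 0 1).prod (gaussianReal 0 1)).real
      {z : ℝ × ℝ | 0 < z.1 * (sin ψ * z.1 + cos ψ * z.2)} = 1 / 2 + ψ / π := by
  set G := (gaussianReal 0 1).prod (gaussianReal 0 1)
  set A := {z : ℝ × ℝ | 0 < z.1 ∧ 0 < sin ψ * z.1 + cos ψ * z.2} with hA
  have hneg : G.map (Prod.map Neg.neg Neg.neg) = G := by
    rw [← Measure.map_prod_map _ _ measurable_neg measurable_neg]
    have : (gaussianReal 0 1).map Neg.neg = gaussianReal 0 1 := by
      have := gaussianReal_map_neg (μ := 0) (v := 1)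
      simpa using this
    rw [this]
  have hsplit : {z : ℝ × ℝ | 0 < z.1 * (sin ψ * z.1 + cos ψ * z.2)}
      = A ∪ Prod.map Neg.neg Neg.neg ⁻¹' A := by
    ext z
    simp only [hA, Set.mem_ofPred_eq, Set.mem_union, Set.mem_preimage, Prod.map_fst, Prod.map_snd,
      mul_pos_iff]
    refine or_congr Iff.rfl (and_congr (by simp) ?_)
    constructor <;> intro h <;> linarith
  have hm : MeasurableSet (Prod.map Neg.neg Neg.neg ⁻¹' A) :=
    (measurable_neg.prodMap measurable_neg) (measurableSet_quadrant ψ)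
  have hdisj : Disjoint A (Prod.map Neg.neg Neg.neg ⁻¹' A) := by
    rw [Set.disjoint_left]
    rintro z hz hz'
    have h1 : 0 < z.1 := hz.1
    have h2 : 0 < -z.1 := hz'.1
    linarith
  have heq : G.real (Prod.map Neg.neg Neg.neg ⁻¹' A) = G.real A := by
    rw [Measure.real, Measure.real,
      ← Measure.map_apply (measurable_neg.prodMap measurable_neg) (measurableSet_quadrant ψ), hneg]
  rw [hsplit, measureReal_union hdisj hm, heq, gaussianReal_prod_real_quadrant hψ]
  have := pi_pos
  field_simp; ring

/-- The centred planar Gaussian law of two variables with standard deviation `σ` and correlation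
`sin ψ`. -/
noncomputable def corrGaussian (σ ψ : ℝ) : Measure (EuclideanSpace ℝ (Fin 2)) :=
  ((gaussianReal 0 1).prod (gaussianReal 0 1)).map
    fun z => !₂[σ * z.1, σ * (sin ψ * z.1 + cos ψ * z.2)]

lemma measurable_corrGaussian_map (σ ψ : ℝ) : Measurable fun z : ℝ × ℝ =>
    (!₂[σ * z.1, σ * (sin ψ * z.1 + cos ψ * z.2)] : EuclideanSpace ℝ (Fin 2)) := by
  refine Continuous.measurable ?_
  refine (PiLp.continuous_toLp 2 _).comp (continuous_pi fun i => ?_)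
  fin_cases i
  · simp; fun_prop
  · simp; fun_prop

instance isProbabilityMeasure_corrGaussian (σ ψ : ℝ) :
    IsProbabilityMeasure (corrGaussian σ ψ) :=
  Measure.isProbabilityMeasure_map (measurable_corrGaussian_map σ ψ).aemeasurable

lemma charFun_corrGaussian (σ ψ : ℝ) (s : EuclideanSpace ℝ (Fin 2)) :
    charFun (corrGaussian σ ψ) s =
      (exp (-(σ ^ 2 * (s 0 ^ 2 + s 1 ^ 2 + 2 * sin ψ * (s 0 * s 1))) / 2) : ℂ) := by
  rw [corrGaussian, charFun_apply, integral_map (measurable_corrGaussian_map σ ψ).aemeasurable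
    (Continuous.aestronglyMeasurable (by fun_prop))]
  have h1 : ∀ z : ℝ × ℝ, Complex.exp ((inner ℝ (!₂[σ * z.1, σ * (sin ψ * z.1 + cos ψ * z.2)] :
        EuclideanSpace ℝ (Fin 2)) s : ℝ) * Complex.I)
      = Complex.exp ((σ * (s 0 + sin ψ * s 1) : ℝ) * z.1 * Complex.I) *
        Complex.exp ((σ * (cos ψ * s 1) : ℝ) * z.2 * Complex.I) := fun z => by
    rw [← Complex.exp_add, PiLp.inner_apply, Fin.sum_univ_two]
    congr 1
    simp
    ring
  simp_rw [h1]
  rw [integral_prod_mul (μ := gaussianReal 0 1) (ν := gaussianReal 0 1)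
    (fun x : ℝ => Complex.exp ((σ * (s 0 + sin ψ * s 1) : ℝ) * x * Complex.I))
    (fun x : ℝ => Complex.exp ((σ * (cos ψ * s 1) : ℝ) * x * Complex.I)),
    ← charFun_apply_real, ← charFun_apply_real, charFun_gaussianReal, charFun_gaussianReal,
    ← Complex.exp_add, Complex.ofReal_exp]
  congr 1
  have hsc : cos ψ ^ 2 = 1 - sin ψ ^ 2 := by rw [← Real.cos_sq_add_sin_sq ψ]; ring
  have : -((σ * (s 0 + sin ψ * s 1)) ^ 2 / 2) - (σ * (cos ψ * s 1)) ^ 2 / 2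
      = -(σ ^ 2 * (s 0 ^ 2 + s 1 ^ 2 + 2 * sin ψ * (s 0 * s 1))) / 2 := by
    rw [show (σ * (cos ψ * s 1)) ^ 2 = σ ^ 2 * cos ψ ^ 2 * s 1 ^ 2 by ring, hsc]; ring
  rw [← this]
  push_cast
  ring

/-- The event that two real numbers have the same strict sign. -/
def sameSign : Set (EuclideanSpace ℝ (Fin 2)) := {v | 0 < v 0 * v 1}

lemma measurableSet_sameSign : MeasurableSet sameSign :=
  measurableSet_lt measurable_const (by fun_prop)

lemma corrGaussian_real_sameSign {σ ψ : ℝ} (hσ : σ ≠ 0) (hψ : ψ ∈ Set.Ioo (-(π / 2)) (π / 2)) :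
    (corrGaussian σ ψ).real sameSign = 1 / 2 + ψ / π := by
  rw [← gaussianReal_prod_real_same_sign hψ, corrGaussian, Measure.real,
    Measure.map_apply (measurable_corrGaussian_map σ ψ) measurableSet_sameSign, Measure.real]
  congr 2
  ext z
  have : σ * z.1 * (σ * (sin ψ * z.1 + cos ψ * z.2))
      = σ ^ 2 * (z.1 * (sin ψ * z.1 + cos ψ * z.2)) := by ring
  simp only [sameSign, Set.mem_preimage, Set.mem_ofPred_eq]
  simp only [Matrix.cons_val_zero, Matrix.cons_val_one, this]
  exact mul_pos_iff_of_pos_left (by positivity)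

lemma corrGaussian_frontier_sameSign {σ ψ : ℝ} (hσ : σ ≠ 0)
    (hψ : ψ ∈ Set.Ioo (-(π / 2)) (π / 2)) :
    corrGaussian σ ψ (frontier sameSign) = 0 := by
  have hsub : frontier sameSign ⊆ {v : EuclideanSpace ℝ (Fin 2) | 0 = v 0 * v 1} :=
    frontier_lt_subset_eq continuous_const (by fun_prop)
  refine measure_mono_null hsub ?_
  have hm : MeasurableSet {v : EuclideanSpace ℝ (Fin 2) | 0 = v 0 * v 1} :=
    measurableSet_eq_fun measurable_const (by fun_prop)
  rw [corrGaussian, Measure.map_apply (measurable_corrGaussian_map σ ψ) hm]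
  have hsub2 : (fun z : ℝ × ℝ => (!₂[σ * z.1, σ * (sin ψ * z.1 + cos ψ * z.2)] :
      EuclideanSpace ℝ (Fin 2))) ⁻¹' {v : EuclideanSpace ℝ (Fin 2) | 0 = v 0 * v 1}
      ⊆ ({0} ×ˢ Set.univ) ∪ {z | sin ψ * z.1 + cos ψ * z.2 = 0} := by
    intro z hz
    simp only [Set.mem_preimage, Set.mem_ofPred_eq] at hz
    simp only [Matrix.cons_val_zero, Matrix.cons_val_one] at hz
    have := mul_eq_zero.1 hz.symm
    simpa [hσ] using this
  have := nullSingletonClass_gaussianReal (μ := 0) one_ne_zero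
  refine measure_mono_null hsub2 (measure_union_null ?_ ?_)
  · rw [Measure.prod_prod, measure_singleton, zero_mul]
  · have hc : cos ψ ≠ 0 := (cos_pos_of_mem_Ioo hψ).ne'
    have hm2 : MeasurableSet {z : ℝ × ℝ | sin ψ * z.1 + cos ψ * z.2 = 0} :=
      measurableSet_eq_fun (by fun_prop) measurable_const
    rw [Measure.measure_prod_null hm2]
    refine Eventually.of_forall fun x => ?_
    refine measure_mono_null (t := {-(sin ψ * x) / cos ψ}) ?_ (measure_singleton _)
    intro w hw
    simp only [Set.mem_preimage, Set.mem_ofPred_eq] at hw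
    rw [Set.mem_singleton_iff, eq_div_iff hc]
    linarith

end Sheppard

/-! ### Dirichlet's integral for the sign -/

section SignIntegral

open Real

lemma integral_sin_odd_nat_div_sin (k : ℕ) :
    IntervalIntegrable (fun θ => sin ((2 * k + 1) * θ) / sin θ) volume (-(π / 2)) (π / 2) ∧
      ∫ θ in (-(π / 2))..(π / 2), sin ((2 * k + 1) * θ) / sin θ = π := by
  have hae : ∀ᵐ θ : ℝ ∂volume, θ ∈ Set.uIoc (-(π / 2)) (π / 2) → sin θ ≠ 0 := by
    have h0 : ∀ᵐ θ : ℝ ∂volume, θ ≠ 0 := by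
      simp [ae_iff, measure_singleton]
    filter_upwards [h0] with θ hθ hmem hs
    rw [Set.uIoc_of_le (by linarith [pi_pos])] at hmem
    rcases lt_or_gt_of_ne hθ with h | h
    · exact absurd hs (sin_neg_of_neg_of_neg_pi_lt h (by linarith [hmem.1, pi_pos])).ne
    · exact absurd hs (sin_pos_of_pos_of_lt_pi h (by linarith [hmem.2, pi_pos])).ne'
  induction k with
  | zero =>
    have h1 : (fun _ => (1:ℝ)) =ᵐ[volume.restrict (Set.uIoc (-(π / 2)) (π / 2))]
        (fun θ => sin ((2 * (0:ℕ) + 1) * θ) / sin θ) := by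
      refine (ae_restrict_iff' measurableSet_uIoc).2 ?_
      filter_upwards [hae] with θ hθ hmem
      simp [div_self (hθ hmem)]
    refine ⟨IntervalIntegrable.congr_ae intervalIntegrable_const h1, ?_⟩
    rw [← intervalIntegral.integral_congr_ae_restrict h1, intervalIntegral.integral_const]
    simp
  | succ k ih =>
    obtain ⟨ih1, ih2⟩ := ih
    have h1 : (fun θ => sin ((2 * k + 1) * θ) / sin θ + 2 * cos ((2 * k + 2) * θ))
        =ᵐ[volume.restrict (Set.uIoc (-(π / 2)) (π / 2))]
        (fun θ => sin ((2 * ((k + 1 : ℕ) : ℝ) + 1) * θ) / sin θ) := by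
      refine (ae_restrict_iff' measurableSet_uIoc).2 ?_
      filter_upwards [hae] with θ hθ hmem
      have hs := hθ hmem
      have e1 : (2 * (k:ℝ) + 1) * θ = (2 * k + 2) * θ - θ := by ring
      have e2 : (2 * ((k + 1 : ℕ) : ℝ) + 1) * θ = (2 * k + 2) * θ + θ := by push_cast; ring
      rw [e1, e2, sin_add, sin_sub]
      field_simp; ring
    have hc : IntervalIntegrable (fun θ => 2 * cos ((2 * k + 2) * θ)) volume
        (-(π / 2)) (π / 2) := Continuous.intervalIntegrable (by fun_prop) _ _
    refine ⟨IntervalIntegrable.congr_ae (ih1.add hc) h1, ?_⟩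
    rw [← intervalIntegral.integral_congr_ae_restrict h1, intervalIntegral.integral_add ih1 hc, ih2,
      intervalIntegral.integral_const_mul, intervalIntegral.integral_comp_mul_left (fun x => cos x)
        (by positivity : (2 * (k:ℝ) + 2) ≠ 0), integral_cos]
    have e3 : (2 * (k:ℝ) + 2) * (π / 2) = ((k + 1 : ℕ) : ℝ) * π := by push_cast; ring
    have e4 : (2 * (k:ℝ) + 2) * -(π / 2) = -(((k + 1 : ℕ) : ℝ) * π) := by push_cast; ring
    rw [e3, e4, sin_neg, sin_nat_mul_pi]
    simp

/-- Dirichlet's integral formula for the sign of an odd integer. -/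
lemma integral_sin_odd_div_sin {K : ℤ} (hK : Odd K) :
    IntervalIntegrable (fun θ => sin (K * θ) / sin θ) volume (-(π / 2)) (π / 2) ∧
      ∫ θ in (-(π / 2))..(π / 2), sin (K * θ) / sin θ = π * Int.sign K := by
  obtain ⟨j, rfl⟩ := hK
  rcases le_or_gt 0 j with hj | hj
  · obtain ⟨k, rfl⟩ := Int.eq_ofNat_of_zero_le hj
    have h := integral_sin_odd_nat_div_sin k
    have hs : Int.sign (2 * (k:ℤ) + 1) = 1 := Int.sign_eq_one_of_pos (by omega)
    rw [hs]
    push_cast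
    simpa using h
  · obtain ⟨k, hk⟩ := Int.eq_ofNat_of_zero_le (a := -j - 1) (by omega)
    have h := integral_sin_odd_nat_div_sin k
    have hs : Int.sign (2 * j + 1) = -1 := Int.sign_eq_neg_one_of_neg (by omega)
    have e : ∀ θ : ℝ, sin (((2 * j + 1 : ℤ) : ℝ) * θ) / sin θ
        = -(sin ((2 * k + 1) * θ) / sin θ) := fun θ => by
      have : (j : ℝ) = -(k : ℝ) - 1 := by
        have : (j : ℤ) = -(k : ℤ) - 1 := by omega
        exact_mod_cast this
      push_cast
      rw [this, ← neg_div, ← sin_neg]; ring_nf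
    simp_rw [e, hs]
    refine ⟨h.1.neg, ?_⟩
    rw [intervalIntegral.integral_neg, h.2]; push_cast; ring

end SignIntegral

/-! ### The Gaussian error function -/

section ErrorFunction

open Real

/-- The probability that a standard Gaussian lies in `[-x, x]`, extended to an odd function. -/
noncomputable def gaussErf (x : ℝ) : ℝ := √(2 / π) * ∫ u in (0:ℝ)..x, exp (-u ^ 2 / 2)

lemma integral_cos_mul_gaussian {V : ℝ} (hV : 0 < V) (u : ℝ) :
    ∫ θ : ℝ, cos (u * θ) * exp (-V * θ ^ 2 / 2) = √(2 * π / V) * exp (-u ^ 2 / (2 * V)) := by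
  have hb : 0 < ((V / 2 : ℝ) : ℂ).re := by rw [Complex.ofReal_re]; linarith
  have h := fourierIntegral_gaussian hb u
  have h0 := fourierIntegral_gaussian hb 0
  have h1 : ∫ x : ℝ, Complex.exp (Complex.I * 0 * x) * Complex.exp (-((V / 2 : ℝ) : ℂ) * x ^ 2)
      = (√(2 * π / V) : ℝ) := by
    have := integral_gaussian (V / 2)
    rw [show 2 * π / V = π / (V / 2) by field_simp, ← this, ← integral_complex_ofReal]
    congr 1 with x
    simp
  rw [h1] at h0
  simp only [ne_eq, OfNat.ofNat_ne_zero, not_false_eq_true, zero_pow, neg_zero, zero_div,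
    Complex.exp_zero, mul_one] at h0
  rw [← h0] at h
  have hint : Integrable fun x : ℝ => Complex.exp (Complex.I * u * x) *
      Complex.exp (-((V / 2 : ℝ) : ℂ) * x ^ 2) := by
    refine ((integrable_exp_neg_mul_sq (half_pos hV)).ofReal (𝕜 := ℂ)).mono
      (Continuous.aestronglyMeasurable (by fun_prop)) (Eventually.of_forall fun x => ?_)
    rw [norm_mul, show Complex.I * u * x = ((u * x : ℝ) : ℂ) * Complex.I by push_cast; ring,
      Complex.norm_exp_ofReal_mul_I, one_mul]
    simp [Complex.norm_exp, ← Complex.ofReal_pow]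
  have h2 := congrArg Complex.re h
  have h3 := integral_re hint
  simp only [RCLike.re_to_complex] at h3
  rw [← h3] at h2
  have e1 : ∀ x : ℝ, (Complex.exp (Complex.I * u * x) *
      Complex.exp (-((V / 2 : ℝ) : ℂ) * x ^ 2)).re = cos (u * x) * exp (-V * x ^ 2 / 2) := by
    intro x
    rw [show Complex.I * u * x = ((u * x : ℝ) : ℂ) * Complex.I by push_cast; ring,
      show -((V / 2 : ℝ) : ℂ) * x ^ 2 = ((-V * x ^ 2 / 2 : ℝ) : ℂ) by push_cast; ring,
      ← Complex.ofReal_exp, Complex.re_mul_ofReal, Complex.exp_ofReal_mul_I_re]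
  simp_rw [e1] at h2
  rw [h2, show -(u : ℂ) ^ 2 / (4 * ((V / 2 : ℝ) : ℂ)) = ((-u ^ 2 / (2 * V) : ℝ) : ℂ) by
    push_cast; field_simp; ring, ← Complex.ofReal_exp, ← Complex.ofReal_mul, Complex.ofReal_re]

lemma integrable_gaussian_half {V : ℝ} (hV : 0 < V) :
    Integrable fun θ : ℝ => exp (-V * θ ^ 2 / 2) := by
  refine (integrable_exp_neg_mul_sq (half_pos hV)).congr (Eventually.of_forall fun x => ?_)
  dsimp only; congr 1; ring

/-- The Gaussian counterpart of the Dirichlet integral, by integrating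
`∫ cos (u θ) exp (-V θ ^ 2 / 2) dθ` over `u` from `0` to `S`. At `θ = 0` the integrand has the junk
value `0`, on a null set. -/
lemma integral_sin_div_mul_gaussian {V : ℝ} (hV : 0 < V) (S : ℝ) :
    ∫ θ : ℝ, sin (S * θ) / θ * exp (-V * θ ^ 2 / 2) = π * gaussErf (S / √V) := by
  have hsV : 0 < √V := Real.sqrt_pos.2 hV
  have hswap : ∫ u in (0:ℝ)..S, ∫ θ : ℝ, cos (u * θ) * exp (-V * θ ^ 2 / 2)
      = ∫ θ : ℝ, ∫ u in (0:ℝ)..S, cos (u * θ) * exp (-V * θ ^ 2 / 2) := by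
    refine intervalIntegral_integral_swap ?_
    have hfin : IsFiniteMeasure (volume.restrict (Set.uIoc 0 S)) := by
      refine ⟨?_⟩
      rw [Measure.restrict_apply_univ]
      exact measure_Ioc_lt_top
    have hd := (integrable_const (1:ℝ) (μ := volume.restrict (Set.uIoc 0 S))).mul_prod
      (integrable_gaussian_half hV)
    refine hd.mono' (Continuous.aestronglyMeasurable (by fun_prop))
      (Eventually.of_forall fun p => ?_)
    simp only [Function.uncurry, norm_mul, norm_eq_abs, abs_exp]
    gcongr
    exact abs_cos_le_one _
  have hL : ∫ u in (0:ℝ)..S, ∫ θ : ℝ, cos (u * θ) * exp (-V * θ ^ 2 / 2)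
      = π * gaussErf (S / √V) := by
    simp_rw [integral_cos_mul_gaussian hV]
    rw [intervalIntegral.integral_const_mul, gaussErf]
    have h1 := intervalIntegral.integral_comp_div (a := 0) (b := S)
      (fun u => exp (-u ^ 2 / 2)) hsV.ne'
    rw [zero_div] at h1
    have h2 : ∀ u : ℝ, exp (-u ^ 2 / (2 * V)) = exp (-(u / √V) ^ 2 / 2) := fun u => by
      rw [div_pow, Real.sq_sqrt hV.le]; congr 1; field_simp
    simp_rw [h2]
    rw [h1, smul_eq_mul, ← mul_assoc, ← mul_assoc]
    congr 1
    rw [← Real.sqrt_mul (by positivity), show 2 * π / V * V = π ^ 2 * (2 / π) by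
      field_simp, Real.sqrt_mul (by positivity), Real.sqrt_sq pi_pos.le]
  rw [← hL, hswap]
  refine integral_congr_ae ?_
  have h0 : ∀ᵐ θ : ℝ ∂volume, θ ≠ 0 := by
    simp [ae_iff, measure_singleton]
  filter_upwards [h0] with θ hθ
  rw [intervalIntegral.integral_mul_const]
  congr 1
  have h3 := intervalIntegral.integral_comp_mul_right (a := 0) (b := S) (fun x => cos x) hθ
  rw [h3, integral_cos]
  simp; field_simp

lemma gaussErf_strictMono : StrictMono gaussErf := by
  intro x y hxy
  have hi : ∀ a b : ℝ, IntervalIntegrable (fun u : ℝ => exp (-u ^ 2 / 2)) volume a b :=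
    fun a b => Continuous.intervalIntegrable (by fun_prop) a b
  have h1 := intervalIntegral.integral_interval_sub_left (hi 0 y) (hi 0 x)
  have h2 : 0 < ∫ u in x..y, exp (-u ^ 2 / 2) :=
    intervalIntegral.intervalIntegral_pos_of_pos (hi x y) (fun u => exp_pos _) hxy
  have h3 : 0 < √(2 / π) := Real.sqrt_pos.2 (by positivity)
  rw [gaussErf, gaussErf]
  exact mul_lt_mul_of_pos_left (by linarith) h3

lemma gaussErf_neg (x : ℝ) : gaussErf (-x) = -gaussErf x := by
  have h := intervalIntegral.integral_comp_neg (a := 0) (b := x) (fun u => exp (-u ^ 2 / 2))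
  simp only [neg_zero, neg_sq] at h
  rw [gaussErf, gaussErf, h, intervalIntegral.integral_symm]
  ring

lemma abs_gaussErf (x : ℝ) : |gaussErf x| = gaussErf |x| := by
  have h0 : gaussErf 0 = 0 := by simp [gaussErf]
  have hpos : ∀ y, 0 ≤ y → 0 ≤ gaussErf y := fun y hy => by
    rw [← h0]; exact gaussErf_strictMono.monotone hy
  rcases le_total 0 x with h | h
  · rw [abs_of_nonneg h, abs_of_nonneg (hpos x h)]
  · rw [abs_of_nonpos h, gaussErf_neg, abs_of_nonpos]
    have := hpos (-x) (by linarith)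
    rw [gaussErf_neg] at this; linarith

lemma gaussErf_le {x : ℝ} (hx : 0 ≤ x) : gaussErf x ≤ √(2 / π) * x := by
  rw [gaussErf]
  gcongr
  have h : ∫ u in (0:ℝ)..x, exp (-u ^ 2 / 2) ≤ ∫ _ in (0:ℝ)..x, (1:ℝ) :=
    intervalIntegral.integral_mono hx (Continuous.intervalIntegrable (by fun_prop) _ _)
      intervalIntegrable_const fun u => by
        rw [exp_le_one_iff]; have := sq_nonneg u; linarith
  simpa using h

lemma le_gaussErf {x : ℝ} (hx : 0 ≤ x) : √(2 / π) * (x * exp (-x ^ 2 / 2)) ≤ gaussErf x := by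
  rw [gaussErf]
  gcongr
  have h : ∫ _ in (0:ℝ)..x, exp (-x ^ 2 / 2) ≤ ∫ u in (0:ℝ)..x, exp (-u ^ 2 / 2) :=
    intervalIntegral.integral_mono_on hx intervalIntegrable_const
      (Continuous.intervalIntegrable (by fun_prop) _ _) fun u hu => by
        rw [exp_le_exp]
        have : u ^ 2 ≤ x ^ 2 := by have := hu.1; have := hu.2; gcongr
        linarith
  simpa using h

end ErrorFunction

/-! ### Comparison of products of characteristic functions -/

section ProductComparison

open Real

/-- Telescoping bound for the difference of two products of numbers of norm at most `r`. The factor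
`r` on the left avoids the exponent `m - 1` on the right. -/
lemma norm_prod_sub_prod_mul_le {m : ℕ} {a b : Fin m → ℂ} {r δ : ℝ} (hr : 0 ≤ r)
    (ha : ∀ i, ‖a i‖ ≤ r) (hb : ∀ i, ‖b i‖ ≤ r) (hab : ∀ i, ‖a i - b i‖ ≤ δ) :
    ‖∏ i, a i - ∏ i, b i‖ * r ≤ m * δ * r ^ m := by
  induction m with
  | zero => simp
  | succ n ih =>
    have h := ih (a := fun i => a i.succ) (b := fun i => b i.succ) (fun i => ha _)
      (fun i => hb _) (fun i => hab _)
    have hδ : 0 ≤ δ := (norm_nonneg _).trans (hab 0)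
    have hprod : ‖∏ i : Fin n, b i.succ‖ ≤ r ^ n := by
      rw [norm_prod]
      refine (Finset.prod_le_prod (fun _ _ => norm_nonneg _) (fun i _ => hb _)).trans ?_
      simp
    rw [Fin.prod_univ_succ, Fin.prod_univ_succ]
    have e : a 0 * ∏ i : Fin n, a i.succ - b 0 * ∏ i : Fin n, b i.succ
        = a 0 * (∏ i : Fin n, a i.succ - ∏ i : Fin n, b i.succ)
          + (a 0 - b 0) * ∏ i : Fin n, b i.succ := by ring
    rw [e]
    calc _ ≤ (‖a 0‖ * ‖∏ i : Fin n, a i.succ - ∏ i : Fin n, b i.succ‖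
          + ‖a 0 - b 0‖ * ‖∏ i : Fin n, b i.succ‖) * r := by
          gcongr
          refine (norm_add_le _ _).trans ?_
          rw [norm_mul, norm_mul]
      _ = ‖a 0‖ * (‖∏ i : Fin n, a i.succ - ∏ i : Fin n, b i.succ‖ * r)
          + ‖a 0 - b 0‖ * ‖∏ i : Fin n, b i.succ‖ * r := by ring
      _ ≤ r * (n * δ * r ^ n) + δ * r ^ n * r := by
          gcongr
          · exact ha 0
          · exact hab 0
      _ = _ := by push_cast; ring

/-- The characteristic function `cos θ + i b sin θ` of a sign with mean `b`. -/
noncomputable def signFactor (b θ : ℝ) : ℂ := (cos θ : ℂ) + (b * sin θ : ℝ) * Complex.I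

/-- The characteristic function of a Gaussian variable with mean `b` and variance `1 - b ^ 2`. -/
noncomputable def gaussFactor (b θ : ℝ) : ℂ :=
  Complex.exp ((b * θ : ℝ) * Complex.I - ((1 - b ^ 2) * θ ^ 2 / 2 : ℝ))

lemma norm_gaussFactor (b θ : ℝ) : ‖gaussFactor b θ‖ = exp (-((1 - b ^ 2) * θ ^ 2 / 2)) := by
  rw [gaussFactor, Complex.norm_exp]
  congr 1
  simp only [Complex.sub_re, Complex.re_ofReal_mul, Complex.I_re, mul_zero, Complex.ofReal_re,
    zero_sub]

lemma sq_norm_signFactor (b θ : ℝ) : ‖signFactor b θ‖ ^ 2 = 1 - (1 - b ^ 2) * sin θ ^ 2 := by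
  rw [signFactor, ← Complex.normSq_eq_norm_sq, Complex.normSq_add_mul_I]
  have := Real.sin_sq_add_cos_sq θ
  linear_combination this

/-- Gaussian domination of `signFactor`, by Jordan's inequality `2 |θ| / π ≤ |sin θ|`. -/
lemma norm_signFactor_le {b β θ : ℝ} (hb : |b| ≤ β) (hβ : β < 1) (hθ : |θ| ≤ π / 2) :
    ‖signFactor b θ‖ ≤ exp (-(2 * (1 - β ^ 2) / π ^ 2) * θ ^ 2) := by
  have hb2 : b ^ 2 ≤ β ^ 2 := by rw [← sq_abs]; gcongr
  have hβ0 : 0 ≤ β := (abs_nonneg b).trans hb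
  have hβ1 : 0 ≤ 1 - β ^ 2 := by nlinarith
  have hs : (2 / π * |θ|) ^ 2 ≤ sin θ ^ 2 := by
    rw [← sq_abs (sin θ)]
    have := mul_abs_le_abs_sin hθ
    gcongr
  rw [mul_pow, sq_abs, div_pow] at hs
  have h1 : ‖signFactor b θ‖ ^ 2 ≤ exp (-(2 * (1 - β ^ 2) / π ^ 2) * θ ^ 2) ^ 2 := by
    rw [sq_norm_signFactor, ← Real.exp_nat_mul]
    have h2 := Real.add_one_le_exp (((2:ℕ):ℝ) * (-(2 * (1 - β ^ 2) / π ^ 2) * θ ^ 2))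
    refine le_trans ?_ h2
    have h3 : (1 - β ^ 2) * (2 ^ 2 / π ^ 2 * θ ^ 2) ≤ (1 - b ^ 2) * sin θ ^ 2 := by
      gcongr
      linarith
    push_cast
    have h4 : (2:ℝ) * (-(2 * (1 - β ^ 2) / π ^ 2) * θ ^ 2)
        = -((1 - β ^ 2) * (2 ^ 2 / π ^ 2 * θ ^ 2)) := by ring
    rw [h4]; linarith
  exact le_of_sq_le_sq h1 (exp_pos _).le

lemma norm_gaussFactor_le {b β θ : ℝ} (hb : |b| ≤ β) (hβ : β < 1) :
    ‖gaussFactor b θ‖ ≤ exp (-(2 * (1 - β ^ 2) / π ^ 2) * θ ^ 2) := by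
  have hb2 : b ^ 2 ≤ β ^ 2 := by rw [← sq_abs]; gcongr
  have hβ0 : 0 ≤ β := (abs_nonneg b).trans hb
  have hβ1 : 0 ≤ 1 - β ^ 2 := by nlinarith
  rw [norm_gaussFactor, exp_le_exp]
  have hπ : 2 * (1 - β ^ 2) / π ^ 2 ≤ (1 - β ^ 2) / 2 := by
    rw [div_le_div_iff₀ (by positivity) (by norm_num)]
    have : 4 ≤ π ^ 2 := by nlinarith [pi_gt_three]
    nlinarith
  have h1 : 2 * (1 - β ^ 2) / π ^ 2 * θ ^ 2 ≤ (1 - β ^ 2) / 2 * θ ^ 2 := by gcongr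
  have h2 : (1 - β ^ 2) * θ ^ 2 ≤ (1 - b ^ 2) * θ ^ 2 := by gcongr
  linarith

/-- The two factors agree to second order at `0`, because the means and the variances agree. -/
lemma norm_signFactor_sub_gaussFactor_le {b θ : ℝ} (hb : |b| ≤ 1) :
    ‖signFactor b θ - gaussFactor b θ‖ ≤ 16 * |θ| ^ 3 := by
  have hb2 : b ^ 2 ≤ 1 := (sq_le_one_iff_abs_le_one b).2 hb
  have hb0 := sq_nonneg b
  rcases le_or_gt |θ| (1 / 2) with hθ | hθ
  · have hθ0 := abs_nonneg θ
    have hθ4 : |θ| ^ 4 ≤ 1 / 2 * |θ| ^ 3 := by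
      rw [pow_succ']; gcongr
    have hθ2 : θ ^ 2 = |θ| ^ 2 := (sq_abs θ).symm
    set z : ℂ := (b * θ : ℝ) * Complex.I - ((1 - b ^ 2) * θ ^ 2 / 2 : ℝ) with hz
    have hzn : ‖z‖ ≤ 5 / 4 * |θ| := by
      refine (norm_sub_le _ _).trans ?_
      rw [norm_mul, Complex.norm_I, mul_one, Complex.norm_real, Complex.norm_real, norm_eq_abs,
        norm_eq_abs, abs_mul, abs_of_nonneg (a := (1 - b ^ 2) * θ ^ 2 / 2)
          (by have : 0 ≤ 1 - b ^ 2 := by linarith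
              positivity), hθ2]
      have h1 : |b| * |θ| ≤ 1 * |θ| := by gcongr
      have h2 : (1 - b ^ 2) * |θ| ^ 2 ≤ 1 * |θ| ^ 2 := by gcongr; linarith
      nlinarith
    have h1 := Complex.exp_bound (x := z) (by linarith) (n := 3) (by norm_num)
    have e : ∑ k ∈ Finset.range 3, z ^ k / (k.factorial : ℂ) = 1 + z + z ^ 2 / 2 := by
      simp [Finset.sum_range_succ, Nat.factorial]
    rw [e] at h1
    have h1' : ‖gaussFactor b θ - (1 + z + z ^ 2 / 2)‖ ≤ 1 * |θ| ^ 3 := by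
      refine h1.trans ?_
      have : ‖z‖ ^ 3 ≤ (5 / 4 * |θ|) ^ 3 := by gcongr
      have h3 : 0 ≤ |θ| ^ 3 := by positivity
      rw [mul_pow] at this
      norm_num [Nat.factorial] at this ⊢
      linarith
    have h2 : ‖signFactor b θ - (1 + z + z ^ 2 / 2)‖ ≤ 2 * |θ| ^ 3 := by
      have e2 : signFactor b θ - (1 + z + z ^ 2 / 2)
          = ((cos θ - (1 - θ ^ 2 / 2) : ℝ) : ℂ) - (b * (θ - sin θ) : ℝ) * Complex.I
            + ((b * (1 - b ^ 2) / 2 * θ ^ 3 : ℝ) * Complex.I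
            - ((1 - b ^ 2) ^ 2 / 8 * θ ^ 4 : ℝ)) := by
        rw [signFactor, hz]; push_cast
        linear_combination (b ^ 2 * θ ^ 2 / 2) * (-Complex.I_sq)
      rw [e2]
      refine (norm_add_le _ _).trans ?_
      have h3 := norm_sub_le ((cos θ - (1 - θ ^ 2 / 2) : ℝ) : ℂ)
        ((b * (θ - sin θ) : ℝ) * Complex.I)
      have h4 := norm_sub_le ((b * (1 - b ^ 2) / 2 * θ ^ 3 : ℝ) * Complex.I)
        (((1 - b ^ 2) ^ 2 / 8 * θ ^ 4 : ℝ) : ℂ)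
      simp only [norm_mul, Complex.norm_I, mul_one, Complex.norm_real, norm_eq_abs] at h3 h4
      have h5 := cos_bound (x := θ) (by linarith)
      have h6 := abs_sub_sin_le θ
      have h7 : |b * (θ - sin θ)| ≤ 1 * (|θ| ^ 3 / 6) := by rw [abs_mul]; gcongr
      have h8 : |b * (1 - b ^ 2) / 2 * θ ^ 3| ≤ 1 / 2 * |θ| ^ 3 := by
        rw [abs_mul, abs_pow]
        gcongr
        rw [abs_div, abs_mul, abs_of_nonneg (a := 1 - b ^ 2) (by linarith), abs_two]
        have : |b| * (1 - b ^ 2) ≤ 1 * 1 := by gcongr; linarith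
        linarith
      have h9 : |(1 - b ^ 2) ^ 2 / 8 * θ ^ 4| ≤ 1 / 8 * |θ| ^ 4 := by
        rw [abs_mul, abs_pow]
        gcongr
        rw [abs_of_nonneg (by positivity)]
        have : (1 - b ^ 2) ^ 2 ≤ 1 := pow_le_one₀ (by linarith) (by linarith)
        linarith
      have h10 : 0 ≤ |θ| ^ 3 := by positivity
      rw [abs_mul] at h7 h8 h9
      linarith
    have h3 : signFactor b θ - gaussFactor b θ = (signFactor b θ - (1 + z + z ^ 2 / 2))
        - (gaussFactor b θ - (1 + z + z ^ 2 / 2)) := by ring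
    rw [h3]
    have := norm_sub_le (signFactor b θ - (1 + z + z ^ 2 / 2))
      (gaussFactor b θ - (1 + z + z ^ 2 / 2))
    have h10 : 0 ≤ |θ| ^ 3 := by positivity
    linarith
  · have h1 : ‖signFactor b θ‖ ≤ 1 := by
      have : ‖signFactor b θ‖ ^ 2 ≤ 1 ^ 2 := by
        rw [sq_norm_signFactor]
        have : 0 ≤ (1 - b ^ 2) * sin θ ^ 2 := mul_nonneg (by linarith) (sq_nonneg _)
        linarith
      exact le_of_sq_le_sq this zero_le_one
    have h2 : ‖gaussFactor b θ‖ ≤ 1 := by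
      rw [norm_gaussFactor, exp_le_one_iff]
      have : 0 ≤ (1 - b ^ 2) * θ ^ 2 := mul_nonneg (by linarith) (sq_nonneg _)
      linarith
    have h3 : (1 / 2) ^ 3 ≤ |θ| ^ 3 := by gcongr
    have := norm_sub_le (signFactor b θ) (gaussFactor b θ)
    linarith

end ProductComparison

/-! ### The mean sign of a sum of independent signs -/

section SignIntegralAsymptotics

open Real

lemma prod_gaussFactor_im {m : ℕ} (b : Fin m → ℝ) (θ : ℝ) :
    (∏ i, gaussFactor (b i) θ).im
      = sin ((∑ i, b i) * θ) * exp (-(∑ i, (1 - b i ^ 2)) * θ ^ 2 / 2) := by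
  have h : ∏ i, gaussFactor (b i) θ
      = Complex.exp (((∑ i, b i) * θ : ℝ) * Complex.I) *
        ((exp (-(∑ i, (1 - b i ^ 2)) * θ ^ 2 / 2) : ℝ) : ℂ) := by
    simp only [gaussFactor]
    rw [← Complex.exp_sum, Complex.ofReal_exp, ← Complex.exp_add]
    congr 1
    rw [Finset.sum_sub_distrib, ← Finset.sum_mul, ← Complex.ofReal_sum, ← Complex.ofReal_sum,
      ← Finset.sum_mul, ← Finset.sum_div, ← Finset.sum_mul, sub_eq_add_neg, ← Complex.ofReal_neg]
    congr 3
    ring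
  rw [h, Complex.im_mul_ofReal, Complex.exp_ofReal_mul_I_im]

lemma continuous_prod_signFactor {m : ℕ} (b : Fin m → ℝ) :
    Continuous fun θ => (∏ i, signFactor (b i) θ).im := by
  simp only [signFactor]
  fun_prop

/-- The mean of the sign of a sum of an odd number of independent signs with means `b i`, written as
a Dirichlet integral. -/
noncomputable def signIntegral {m : ℕ} (b : Fin m → ℝ) : ℝ :=
  π⁻¹ * ∫ θ in (-(π / 2))..(π / 2), (∏ i, signFactor (b i) θ).im / sin θ

/-- Comparison of the integrand of the Dirichlet integral with its Gaussian counterpart. -/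
lemma abs_signIntegrand_sub_le {β : ℝ} (hβ0 : 0 ≤ β) (hβ : β < 1) {m : ℕ} {b : Fin m → ℝ}
    (hb : ∀ i, |b i| ≤ β) {c : ℝ} (hc : c = 2 * (1 - β ^ 2) / π ^ 2) {θ : ℝ} (hθ : |θ| ≤ π / 2) :
    |(∏ i, signFactor (b i) θ).im / sin θ
        - sin ((∑ i, b i) * θ) / θ * exp (-(∑ i, (1 - b i ^ 2)) * θ ^ 2 / 2)|
      ≤ (16 * π / c * exp (c * (π / 2) ^ 2) + π) * exp (-(c * m) * θ ^ 2 / 2) := by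
  have hβ1 : 0 < 1 - β ^ 2 := by nlinarith
  have hc0 : 0 < c := by rw [hc]; positivity
  have hπ := pi_pos
  rcases eq_or_ne θ 0 with rfl | hθ0
  · simp; positivity
  have hθp : 0 < |θ| := abs_pos.2 hθ0
  have hsin := mul_abs_le_abs_sin hθ
  have hsinp : 0 < |sin θ| := lt_of_lt_of_le (by positivity) hsin
  have hs0 : sin θ ≠ 0 := abs_pos.1 hsinp
  set A := ∏ i, signFactor (b i) θ
  set B := ∏ i, gaussFactor (b i) θ
  set r := exp (-c * θ ^ 2) with hr
  have hrm : r ^ m = exp (-(c * m) * θ ^ 2) := by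
    rw [hr, ← Real.exp_nat_mul]; congr 1; ring
  have hE : exp (-(c * m) * θ ^ 2) ≤ exp (-(c * m) * θ ^ 2 / 2) := by
    rw [exp_le_exp]; have : 0 ≤ c * m * θ ^ 2 := by positivity
    linarith
  have hBn : ‖B‖ ≤ r ^ m := by
    rw [norm_prod]
    refine (Finset.prod_le_prod (fun _ _ => norm_nonneg _) (fun i _ => ?_)).trans
      (by simp : ∏ _i : Fin m, r ≤ r ^ m)
    rw [hr, hc]; exact norm_gaussFactor_le (hb i) hβ
  have hAB := norm_prod_sub_prod_mul_le (a := fun i => signFactor (b i) θ)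
    (b := fun i => gaussFactor (b i) θ) (r := r) (δ := 16 * |θ| ^ 3) (exp_pos _).le
    (fun i => by rw [hr, hc]; exact norm_signFactor_le (hb i) hβ hθ)
    (fun i => by rw [hr, hc]; exact norm_gaussFactor_le (hb i) hβ)
    (fun i => norm_signFactor_sub_gaussFactor_le ((hb i).trans hβ.le))
  have hrinv : 1 ≤ r * exp (c * (π / 2) ^ 2) := by
    rw [hr, ← Real.exp_add, one_le_exp_iff]
    have : θ ^ 2 ≤ (π / 2) ^ 2 := by rw [← sq_abs]; gcongr
    have : c * θ ^ 2 ≤ c * (π / 2) ^ 2 := by gcongr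
    linarith
  have hAB' : ‖A - B‖ ≤ m * (16 * |θ| ^ 3) * r ^ m * exp (c * (π / 2) ^ 2) := by
    calc ‖A - B‖ = ‖A - B‖ * 1 := (mul_one _).symm
      _ ≤ ‖A - B‖ * (r * exp (c * (π / 2) ^ 2)) := by gcongr
      _ = ‖A - B‖ * r * exp (c * (π / 2) ^ 2) := by ring
      _ ≤ _ := by gcongr
  -- the polynomial factor is absorbed by half of the Gaussian decay
  have habs : m * θ ^ 2 * r ^ m ≤ 2 / c * exp (-(c * m) * θ ^ 2 / 2) := by
    have h1 := Real.add_one_le_exp (c * m * θ ^ 2 / 2)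
    have h2 : exp (-(c * m) * θ ^ 2 / 2) = exp (c * m * θ ^ 2 / 2) * r ^ m := by
      rw [hrm, ← Real.exp_add]; congr 1; ring
    have h3 : m * θ ^ 2 ≤ 2 / c * exp (c * m * θ ^ 2 / 2) := by
      rw [div_mul_eq_mul_div, le_div_iff₀ hc0]
      linarith
    rw [h2, ← mul_assoc]
    gcongr
  have hinv : |(sin θ)⁻¹| ≤ π / 2 * |θ|⁻¹ := by
    rw [abs_inv, ← inv_inv (π / 2), ← mul_inv]
    refine inv_anti₀ (by positivity) ?_
    rwa [inv_div]
  have hinv2 : |(sin θ)⁻¹ - θ⁻¹| ≤ π := by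
    have e : (sin θ)⁻¹ - θ⁻¹ = (θ - sin θ) * ((sin θ)⁻¹ * θ⁻¹) := by field_simp
    rw [e, abs_mul, abs_mul, abs_inv θ]
    calc |θ - sin θ| * (|(sin θ)⁻¹| * |θ|⁻¹) ≤ |θ| ^ 3 / 6 * (π / 2 * |θ|⁻¹ * |θ|⁻¹) := by
          gcongr; exact abs_sub_sin_le θ
      _ = π / 12 * |θ| := by field_simp; ring
      _ ≤ π / 12 * (π / 2) := by gcongr
      _ ≤ π := by nlinarith [pi_lt_four]
  have hsplit : A.im / sin θ - sin ((∑ i, b i) * θ) / θ * exp (-(∑ i, (1 - b i ^ 2)) * θ ^ 2 / 2)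
      = (A - B).im * (sin θ)⁻¹ + B.im * ((sin θ)⁻¹ - θ⁻¹) := by
    have hBim : B.im = _ := prod_gaussFactor_im b θ
    rw [Complex.sub_im, hBim]
    field_simp; ring
  rw [hsplit]
  refine (abs_add_le _ _).trans ?_
  rw [abs_mul, abs_mul, add_mul]
  refine add_le_add ?_ ?_
  · calc |(A - B).im| * |(sin θ)⁻¹|
        ≤ (m * (16 * |θ| ^ 3) * r ^ m * exp (c * (π / 2) ^ 2)) * (π / 2 * |θ|⁻¹) := by
          gcongr; exact (Complex.abs_im_le_norm _).trans hAB'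
      _ = 8 * π * exp (c * (π / 2) ^ 2) * (m * |θ| ^ 2 * r ^ m) := by field_simp; ring
      _ = 8 * π * exp (c * (π / 2) ^ 2) * (m * θ ^ 2 * r ^ m) := by rw [sq_abs]
      _ ≤ 8 * π * exp (c * (π / 2) ^ 2) * (2 / c * exp (-(c * m) * θ ^ 2 / 2)) := by gcongr
      _ = _ := by ring
  · calc |B.im| * |(sin θ)⁻¹ - θ⁻¹| ≤ r ^ m * π := by
          gcongr; exact (Complex.abs_im_le_norm _).trans hBn
      _ ≤ _ := by rw [hrm, mul_comm]; gcongr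

/-- A Berry–Esseen bound for the mean sign of a sum of `m` independent signs with means `b i`. -/
lemma exists_abs_signIntegral_sub_gaussErf_le {β : ℝ} (hβ0 : 0 ≤ β) (hβ : β < 1) :
    ∃ C : ℝ, 0 ≤ C ∧ ∀ (m : ℕ) (b : Fin m → ℝ), 0 < m → (∀ i, |b i| ≤ β) →
      |signIntegral b - gaussErf ((∑ i, b i) / √(∑ i, (1 - b i ^ 2)))| ≤ C / √m := by
  have hπ := pi_pos
  have hβ1 : 0 < 1 - β ^ 2 := by nlinarith
  obtain ⟨c, hc⟩ : ∃ c, c = 2 * (1 - β ^ 2) / π ^ 2 := ⟨_, rfl⟩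
  have hc0 : 0 < c := by rw [hc]; positivity
  set K := 16 * π / c * exp (c * (π / 2) ^ 2) + π with hK
  have hK1 : 1 ≤ K := by
    have : 0 ≤ 16 * π / c * exp (c * (π / 2) ^ 2) := by positivity
    linarith [pi_gt_three]
  refine ⟨π⁻¹ * (K * √(2 * π / c)), by positivity, fun m b hm hb => ?_⟩
  rw [signIntegral]
  have hm0 : (0:ℝ) < m := by exact_mod_cast hm
  set S := ∑ i, b i
  set V := ∑ i, (1 - b i ^ 2) with hV
  have hVm : (1 - β ^ 2) * m ≤ V := by
    have : ∑ _i : Fin m, (1 - β ^ 2) ≤ V := Finset.sum_le_sum fun i _ => by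
      have : b i ^ 2 ≤ β ^ 2 := by rw [← sq_abs]; have := hb i; gcongr
      linarith
    rw [Finset.sum_const, Finset.card_univ, Fintype.card_fin, nsmul_eq_mul] at this
    linarith
  have hV0 : 0 < V := lt_of_lt_of_le (by positivity) hVm
  have hcm : c * m ≤ V := by
    refine le_trans ?_ hVm
    gcongr
    rw [hc, div_le_iff₀ (by positivity)]
    have : 2 ≤ π ^ 2 := by nlinarith [pi_gt_three]
    nlinarith
  set g : ℝ → ℝ := fun θ => sin (S * θ) / θ * exp (-V * θ ^ 2 / 2) with hg
  set f : ℝ → ℝ := (Set.Ioc (-(π / 2)) (π / 2)).indicator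
    (fun θ => (∏ i, signFactor (b i) θ).im / sin θ) with hf
  have hbound : ∀ θ, |f θ - g θ| ≤ K * exp (-(c * m) * θ ^ 2 / 2) := by
    intro θ
    by_cases hθ : θ ∈ Set.Ioc (-(π / 2)) (π / 2)
    · rw [hf, Set.indicator_of_mem hθ]
      exact abs_signIntegrand_sub_le hβ0 hβ hb hc (abs_le.2 ⟨hθ.1.le, hθ.2⟩)
    · -- outside of the range of integration `|θ| ≥ 1`, and the Gaussian integrand is small
      rw [hf, Set.indicator_of_notMem hθ, zero_sub, abs_neg, hg]
      have hθ1 : 1 ≤ |θ| := by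
        rw [le_abs]
        by_contra! hcon
        exact hθ ⟨by linarith [pi_gt_three], by linarith [pi_gt_three]⟩
      dsimp only
      rw [abs_mul, abs_exp, abs_div]
      have h1 : |sin (S * θ)| / |θ| ≤ K := by
        refine le_trans ?_ hK1
        rw [div_le_one (by linarith)]
        exact (abs_sin_le_one _).trans hθ1
      have h2 : exp (-V * θ ^ 2 / 2) ≤ exp (-(c * m) * θ ^ 2 / 2) := by
        rw [exp_le_exp]
        have : c * m * θ ^ 2 ≤ V * θ ^ 2 := by gcongr
        linarith
      gcongr
  have hgi : Integrable g := by
    refine ((integrable_gaussian_half hV0).const_mul |S|).mono' ?_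
      (Eventually.of_forall fun θ => ?_)
    · exact Measurable.aestronglyMeasurable (by fun_prop)
    · rw [hg, norm_eq_abs, abs_mul, abs_exp, abs_div]
      gcongr
      rcases eq_or_ne θ 0 with rfl | h0
      · simp
      · rw [div_le_iff₀ (abs_pos.2 h0), ← abs_mul]
        exact abs_sin_le_abs
  have hKi : Integrable fun θ : ℝ => K * exp (-(c * m) * θ ^ 2 / 2) :=
    (integrable_gaussian_half (by positivity)).const_mul K
  have hfm : Measurable f := by
    refine Measurable.indicator ?_ measurableSet_Ioc
    exact (continuous_prod_signFactor b).measurable.div measurable_sin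
  have hgm : Measurable g := by fun_prop
  have hfgi : Integrable (fun θ => f θ - g θ) :=
    hKi.mono' (hfm.sub hgm).aestronglyMeasurable (Eventually.of_forall hbound)
  have hfi : Integrable f := by
    refine (hfgi.add hgi).congr (Eventually.of_forall fun θ => ?_)
    simp
  have hint : ∫ θ in (-(π / 2))..(π / 2), (∏ i, signFactor (b i) θ).im / sin θ = ∫ θ, f θ := by
    rw [intervalIntegral.integral_of_le (by linarith), hf, integral_indicator measurableSet_Ioc]
  have hgint : ∫ θ, g θ = π * gaussErf (S / √V) := integral_sin_div_mul_gaussian hV0 S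
  have e : gaussErf (S / √V) = π⁻¹ * ∫ θ, g θ := by rw [hgint]; field_simp
  rw [hint, e, ← mul_sub, ← integral_sub hfi hgi, abs_mul, abs_of_pos (inv_pos.2 hπ), mul_div_assoc]
  gcongr
  refine (norm_integral_le_integral_norm (f := fun θ => f θ - g θ)).trans ?_
  refine (integral_mono hfgi.norm hKi fun θ => hbound θ).trans (le_of_eq ?_)
  rw [integral_const_mul]
  have h3 := integral_gaussian (c * m / 2)
  have h4 : ∀ θ : ℝ, -(c * m) * θ ^ 2 / 2 = -(c * m / 2) * θ ^ 2 := fun θ => by ring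
  simp_rw [h4]
  rw [h3, mul_div_assoc K, ← Real.sqrt_div (by positivity)]
  congr 2
  field_simp

end SignIntegralAsymptotics

/-! ### Triplets of voters -/

section Triplets

/-- Voter `3 i + j`, as the `j`-th member of the `i`-th triplet. -/
def tripletIndex (m : ℕ) : Fin m × Fin 3 ≃ Fin (3 * m) :=
  finProdFinEquiv.trans (finCongr (mul_comm m 3))

lemma tripletIndex_val {m : ℕ} (i : Fin m) (j : Fin 3) :
    (tripletIndex m (i, j) : ℕ) = 3 * i + j := by
  simp [tripletIndex, finProdFinEquiv]; omega

/-- A family indexed by the voters, as a family of triplets. -/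
def tripletsEquiv (m : ℕ) (X : Type*) : (Fin (3 * m) → X) ≃ (Fin m → Fin 3 → X) :=
  (Equiv.arrowCongr (tripletIndex m).symm (Equiv.refl X)).trans (Equiv.curry _ _ _)

lemma tripletsEquiv_apply {m : ℕ} {X : Type*} (x : Fin (3 * m) → X) (i : Fin m) (j : Fin 3) :
    tripletsEquiv m X x i j = x (tripletIndex m (i, j)) := rfl

lemma sum_fin_three_arrow {X M : Type*} [Fintype X] [AddCommMonoid M] (f : (Fin 3 → X) → M) :
    ∑ z, f z = ∑ a, ∑ b, ∑ c, f ![a, b, c] := by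
  let e : (Fin 3 → X) ≃ X × X × X :=
    { toFun := fun z => (z 0, z 1, z 2)
      invFun := fun p => ![p.1, p.2.1, p.2.2]
      left_inv := fun z => by ext i; fin_cases i <;> rfl
      right_inv := fun p => rfl }
  rw [← e.symm.sum_comp, Fintype.sum_prod_type]
  simp_rw [Fintype.sum_prod_type]
  rfl

/-- The sum of the votes of a triplet. -/
def voteSum (z : Fin 3 → ℤˣ) : ℤ := z 0 + z 1 + z 2

/-- The product of the votes of a triplet. -/
def voteProd (z : Fin 3 → ℤˣ) : ℤ := z 0 * z 1 * z 2

lemma tripletSum_eq {m : ℕ} (x : Fin (3 * m) → ℤˣ) (i : Fin m) :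
    tripletSum x i = voteSum (tripletsEquiv m ℤˣ x i) := by
  have h : ∀ j : Fin 3, tripletIndex m (i, j) = ⟨3 * i + j, by omega⟩ := fun j =>
    Fin.ext (tripletIndex_val i j)
  simp only [tripletSum, voteSum, tripletsEquiv_apply, h]
  rfl

/-- The Fourier expansion of the majority of three votes. -/
lemma two_mul_sign_voteSum (z : Fin 3 → ℤˣ) :
    2 * Int.sign (voteSum z) = voteSum z - voteProd z := by
  have h : ∀ a b c : ℤˣ, 2 * Int.sign ((a : ℤ) + b + c) = (a + b + c : ℤ) - a * b * c := by decide
  exact h _ _ _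

lemma sign_voteSum_eq (z : Fin 3 → ℤˣ) :
    Int.sign (voteSum z) = 1 ∨ Int.sign (voteSum z) = -1 := by
  have h : ∀ a b c : ℤˣ, Int.sign ((a : ℤ) + b + c) = 1 ∨ Int.sign ((a : ℤ) + b + c) = -1 := by
    decide
  exact h _ _ _

lemma sum_sign_voteSum_odd {m : ℕ} (hm : Odd m) (z : Fin m → Fin 3 → ℤˣ) :
    Odd (∑ i, Int.sign (voteSum (z i))) := by
  have h : ∀ i, ∃ k : ℤ, Int.sign (voteSum (z i)) = 2 * k + 1 := fun i => by
    rcases sign_voteSum_eq (z i) with h | h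
    · exact ⟨0, by rw [h]; rfl⟩
    · exact ⟨-1, by rw [h]; rfl⟩
  choose k hk using h
  have hm' : Odd (m : ℤ) := by exact_mod_cast hm
  simp_rw [hk, Finset.sum_add_distrib, ← Finset.mul_sum]
  simpa using (even_two_mul (∑ i, k i)).add_odd hm'

lemma majTriplets_eq {m : ℕ} (x : Fin (3 * m) → ℤˣ) :
    majTriplets m x = Int.sign (∑ i, Int.sign (voteSum (tripletsEquiv m ℤˣ x i))) := by
  simp only [majTriplets, tripletSum_eq]

end Triplets

/-! ### Noise on the majority of triplets -/

section Noise

open Real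

/-- The mean of the majority of three votes with noise: `T_ρ Maj₃ = (ρ / 2) w - (ρ ^ 3 / 2) χ`,
with `w` the sum and `χ` the product of the votes. -/
noncomputable def noisyMajority (ρ : ℝ) (z : Fin 3 → ℤˣ) : ℝ :=
  ρ / 2 * voteSum z - ρ ^ 3 / 2 * voteProd z

lemma sum_intUnits {M : Type*} [AddCommMonoid M] (f : ℤˣ → M) : ∑ u, f u = f 1 + f (-1) := by
  rw [show (Finset.univ : Finset ℤˣ) = {1, -1} from rfl, Finset.sum_pair (by decide)]

lemma sum_noiseProb_eq_one (ρ : ℝ) (x : Fin 3 → ℤˣ) : ∑ z, noiseProb ρ x z = 1 := by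
  have h1 : ∀ u : ℤˣ, ∑ v : ℤˣ, (if v = u then (1 + ρ) / 2 else (1 - ρ) / 2) = 1 := by
    intro u
    rcases Int.units_eq_one_or u with rfl | rfl <;> rw [sum_intUnits] <;> norm_num <;> ring
  have h := Finset.prod_univ_sum (fun _ : Fin 3 => (Finset.univ : Finset ℤˣ))
    (fun j v => if v = x j then (1 + ρ) / 2 else (1 - ρ) / 2)
  simp only [h1, Finset.prod_const_one, Fintype.piFinset_univ] at h
  exact h.symm

lemma sum_noiseProb_mul_sign (ρ : ℝ) (x : Fin 3 → ℤˣ) :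
    ∑ z, noiseProb ρ x z * (Int.sign (voteSum z) : ℝ) = noisyMajority ρ x := by
  have hs : ∀ z, (Int.sign (voteSum z) : ℝ) = ((voteSum z : ℝ) - voteProd z) / 2 := fun z => by
    have h := two_mul_sign_voteSum z
    have : (2:ℝ) * (Int.sign (voteSum z) : ℝ) = (voteSum z : ℝ) - voteProd z := by exact_mod_cast h
    linarith
  simp_rw [hs]
  rw [sum_fin_three_arrow]
  simp only [sum_intUnits, noiseProb, voteSum, voteProd, noisyMajority, Fin.prod_univ_three,
    Matrix.cons_val_zero, Matrix.cons_val_one, Matrix.cons_val]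
  rcases Int.units_eq_one_or (x 0) with h0 | h0 <;>
    rcases Int.units_eq_one_or (x 1) with h1 | h1 <;>
    rcases Int.units_eq_one_or (x 2) with h2 | h2 <;> rw [h0, h1, h2] <;> norm_num <;> ring

lemma abs_noisyMajority_le {ρ : ℝ} (hρ : ρ ∈ Set.Icc (0:ℝ) 1) (z : Fin 3 → ℤˣ) :
    |noisyMajority ρ z| ≤ 3 * ρ / 2 - ρ ^ 3 / 2 := by
  have hc : ρ ^ 3 ≤ ρ := by
    have := hρ.1; have := hρ.2
    nlinarith [mul_nonneg hρ.1 (sub_nonneg.2 hρ.2), mul_nonneg (mul_nonneg hρ.1 hρ.1)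
      (sub_nonneg.2 hρ.2)]
  have hc0 : 0 ≤ ρ ^ 3 := pow_nonneg hρ.1 3
  have := hρ.1
  simp only [noisyMajority, voteSum, voteProd]
  rcases Int.units_eq_one_or (z 0) with h0 | h0 <;>
    rcases Int.units_eq_one_or (z 1) with h1 | h1 <;>
    rcases Int.units_eq_one_or (z 2) with h2 | h2 <;> rw [h0, h1, h2] <;> norm_num <;>
    rw [abs_le] <;> constructor <;> linarith

lemma noisyMajority_bound_lt_one {ρ : ℝ} (hρ : ρ ∈ Set.Ioo (0:ℝ) 1) :
    0 ≤ 3 * ρ / 2 - ρ ^ 3 / 2 ∧ 3 * ρ / 2 - ρ ^ 3 / 2 < 1 := by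
  obtain ⟨h0, h1⟩ := hρ
  constructor
  · have : 0 ≤ ρ * (3 - ρ ^ 2) := mul_nonneg h0.le (by nlinarith)
    linarith
  · -- `1 - 3 ρ / 2 + ρ ^ 3 / 2 = (1 - ρ) ^ 2 (2 + ρ) / 2`
    have : 0 < (1 - ρ) ^ 2 * (2 + ρ) := mul_pos (pow_pos (by linarith) 2) (by linarith)
    nlinarith

/-- The noisy majority of a triplet is a random sign with mean `noisyMajority`. -/
lemma sum_noiseProb_mul_cexp (ρ : ℝ) (x : Fin 3 → ℤˣ) (θ : ℝ) :
    ∑ z, (noiseProb ρ x z : ℂ) * Complex.exp ((Int.sign (voteSum z) * θ : ℝ) * Complex.I)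
      = signFactor (noisyMajority ρ x) θ := by
  have h : ∀ z, Complex.exp ((Int.sign (voteSum z) * θ : ℝ) * Complex.I)
      = (cos θ : ℂ) + ((Int.sign (voteSum z) : ℝ) : ℂ) * (sin θ * Complex.I) := fun z => by
    rcases sign_voteSum_eq z with h3 | h3
    · rw [h3]; push_cast; rw [one_mul, one_mul, Complex.exp_mul_I]
    · rw [h3]; push_cast; rw [neg_one_mul, Complex.exp_mul_I, Complex.cos_neg, Complex.sin_neg]
      ring
  simp_rw [h, mul_add, Finset.sum_add_distrib, ← mul_assoc, ← Finset.sum_mul]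
  have e1 : ∑ z, (noiseProb ρ x z : ℂ) = 1 := by
    rw [← Complex.ofReal_sum, sum_noiseProb_eq_one, Complex.ofReal_one]
  have e2 : ∑ z, (noiseProb ρ x z : ℂ) * ((Int.sign (voteSum z) : ℝ) : ℂ)
      = (noisyMajority ρ x : ℂ) := by
    rw [← sum_noiseProb_mul_sign]; push_cast; rfl
  rw [e1, e2, signFactor]
  push_cast; ring

lemma noiseProb_eq_prod_triplets {m : ℕ} (ρ : ℝ) (x y : Fin (3 * m) → ℤˣ) :
    noiseProb ρ x y = ∏ i, noiseProb ρ (tripletsEquiv m ℤˣ x i) (tripletsEquiv m ℤˣ y i) := by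
  simp only [noiseProb, tripletsEquiv_apply]
  rw [← (tripletIndex m).prod_comp, Fintype.prod_prod_type]
  rfl

/-- The noise operator applied to the majority of triplets, as a Dirichlet integral. -/
lemma noiseOp_majTriplets {m : ℕ} (hm : Odd m) (ρ : ℝ) (x : Fin (3 * m) → ℤˣ) :
    noiseOp ρ (fun y => (majTriplets m y : ℝ)) x
      = signIntegral fun i => noisyMajority ρ (tripletsEquiv m ℤˣ x i) := by
  rw [signIntegral]
  have hπ := pi_pos
  set N : (Fin (3 * m) → ℤˣ) → ℤ :=
    fun y => ∑ i, Int.sign (voteSum (tripletsEquiv m ℤˣ y i)) with hN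
  have hodd : ∀ y, Odd (N y) := fun y => sum_sign_voteSum_odd hm _
  have h1 : ∀ y, (majTriplets m y : ℝ)
      = π⁻¹ * ∫ θ in (-(π / 2))..(π / 2), sin (N y * θ) / sin θ := fun y => by
    rw [(integral_sin_odd_div_sin (hodd y)).2, majTriplets_eq]; field_simp; rfl
  have h2 : ∀ θ, ∑ y, noiseProb ρ x y * sin (N y * θ)
      = (∏ i, signFactor (noisyMajority ρ (tripletsEquiv m ℤˣ x i)) θ).im := by
    intro θ
    have h3 := Finset.prod_univ_sum (fun _ : Fin m => (Finset.univ : Finset (Fin 3 → ℤˣ)))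
      (fun i z => (noiseProb ρ (tripletsEquiv m ℤˣ x i) z : ℂ) *
        Complex.exp ((Int.sign (voteSum z) * θ : ℝ) * Complex.I))
    simp only [sum_noiseProb_mul_cexp, Fintype.piFinset_univ] at h3
    rw [h3, ← (tripletsEquiv m ℤˣ).sum_comp, Complex.im_sum]
    refine Finset.sum_congr rfl fun y _ => ?_
    rw [Finset.prod_mul_distrib, ← Complex.exp_sum, ← Complex.ofReal_prod,
      ← noiseProb_eq_prod_triplets, ← Finset.sum_mul, ← Complex.ofReal_sum, ← Finset.sum_mul,
      Complex.im_ofReal_mul, Complex.exp_ofReal_mul_I_im, hN]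
    push_cast; rfl
  simp_rw [noiseOp, h1, ← h2, Finset.sum_div]
  rw [intervalIntegral.integral_finsetSum, Finset.mul_sum]
  · refine Finset.sum_congr rfl fun y _ => ?_
    simp_rw [mul_div_assoc]
    rw [intervalIntegral.integral_const_mul]; ring
  · intro y _
    simp_rw [mul_div_assoc]
    exact (integral_sin_odd_div_sin (hodd y)).1.const_mul _

end Noise

/-! ### Impartial culture on three voters -/

section Model

lemma impartialCulture_singleton {n : ℕ} (r : Fin n → Ranking) :
    impartialCulture n {r} = (6⁻¹ : ENNReal) ^ n := by
  have h : ∀ σ : Ranking, uniformOn (Set.univ : Set Ranking) {σ} = 6⁻¹ := fun σ => by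
    rw [uniformOn_univ]
    have : Fintype.card Ranking = 6 := by decide
    rw [this, Measure.count_singleton]
    simp
  rw [impartialCulture, Measure.pi_singleton]
  simp [h]

instance isProbabilityMeasure_impartialCulture (n : ℕ) :
    IsProbabilityMeasure (impartialCulture n) := by
  have : IsProbabilityMeasure (uniformOn (Set.univ : Set Ranking)) :=
    isProbabilityMeasure_uniformOn Set.finite_univ Set.univ_nonempty
  rw [impartialCulture]
  infer_instance

/-- Under impartial culture, the triplets of voters are independent copies of three voters. -/
lemma impartialCulture_real_preimage {m : ℕ} (S : Set (Fin m → Fin 3 → Ranking)) :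
    (impartialCulture (3 * m)).real (tripletsEquiv m Ranking ⁻¹' S)
      = (Measure.pi fun _ : Fin m => impartialCulture 3).real S := by
  have h : (impartialCulture (3 * m)).map (tripletsEquiv m Ranking)
      = Measure.pi fun _ : Fin m => impartialCulture 3 := by
    refine Measure.ext_of_singleton fun z => ?_
    rw [Measure.map_apply (measurable_of_finite _) (measurableSet_singleton _),
      Measure.pi_singleton]
    have : (tripletsEquiv m Ranking) ⁻¹' {z} = {(tripletsEquiv m Ranking).symm z} := by
      ext r; simp [Equiv.eq_symm_apply]
    rw [this, impartialCulture_singleton]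
    simp [impartialCulture_singleton, pow_mul]
  rw [← h, Measure.real, Measure.real,
    Measure.map_apply (measurable_of_finite _) S.toFinite.measurableSet]

lemma integral_impartialCulture_three (g : (Fin 3 → Ranking) → ℝ) :
    ∫ ω, g ω ∂(impartialCulture 3) = (∑ a, ∑ b, ∑ c, g ![a, b, c]) / 216 := by
  rw [integral_fintype .of_finite, ← sum_fin_three_arrow (fun ω => g ω), Finset.sum_div]
  refine Finset.sum_congr rfl fun ω _ => ?_
  rw [Measure.real, impartialCulture_singleton, smul_eq_mul]
  norm_num [ENNReal.toReal_inv]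
  ring

/-- The vote of a single voter in the elections `ab`, `bc`, `ca`. -/
def ballot (σ : Ranking) (k : Fin 3) : ℤˣ := if σ k < σ (k + 1) then 1 else -1

lemma votes_eq_ballot {n : ℕ} (r : Fin n → Ranking) (k : Fin 3) (i : Fin n) :
    votes r k (k + 1) i = ballot (r i) k := rfl

/-- The ballots of the six rankings are the six non-constant sign vectors. -/
lemma sum_ranking {M : Type*} [AddCommMonoid M] (f : (Fin 3 → ℤˣ) → M) :
    ∑ σ : Ranking, f (ballot σ) = f ![1, 1, -1] + f ![1, -1, 1] + f ![-1, 1, 1]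
      + f ![-1, -1, 1] + f ![-1, 1, -1] + f ![1, -1, -1] := by
  have h : (Finset.univ : Finset Ranking).val.map ballot
      = {![1, 1, -1], ![1, -1, 1], ![-1, 1, 1], ![-1, -1, 1], ![-1, 1, -1], ![1, -1, -1]} := by
    decide
  have h2 := congrArg (fun s => (s.map f).sum) h
  simp only [Multiset.map_map] at h2
  rw [show ∑ σ : Ranking, f (ballot σ)
    = (Multiset.map (f ∘ ballot) (Finset.univ : Finset Ranking).val).sum from rfl, h2]
  simp [add_assoc]

/-- The sum of the three votes in the `k`-th election. -/
def ballotSum (ω : Fin 3 → Ranking) (k : Fin 3) : ℝ := voteSum (votes ω k (k + 1))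

/-- The product of the three votes in the `k`-th election. -/
def ballotProd (ω : Fin 3 → Ranking) (k : Fin 3) : ℝ := voteProd (votes ω k (k + 1))

lemma ballotSum_cons (a b c : Ranking) (k : Fin 3) : ballotSum ![a, b, c] k
    = ((ballot a k : ℤ) : ℝ) + ((ballot b k : ℤ) : ℝ) + ((ballot c k : ℤ) : ℝ) := by
  simp [ballotSum, voteSum, votes_eq_ballot]

lemma ballotProd_cons (a b c : Ranking) (k : Fin 3) : ballotProd ![a, b, c] k
    = ((ballot a k : ℤ) : ℝ) * ((ballot b k : ℤ) : ℝ) * ((ballot c k : ℤ) : ℝ) := by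
  simp [ballotProd, voteProd, votes_eq_ballot]

lemma sum_ranking_linear (A : ℝ) (γ : Fin 3 → ℝ) :
    ∑ c : Ranking, (A + ∑ k, γ k * ((ballot c k : ℤ) : ℝ)) = 6 * A := by
  refine (sum_ranking fun x : Fin 3 → ℤˣ => A + ∑ k, γ k * ((x k : ℤ) : ℝ)).trans ?_
  simp only [Fin.sum_univ_three, Matrix.cons_val_zero, Matrix.cons_val_one, Matrix.cons_val]
  push_cast
  ring

lemma sum_ranking_sq (A : ℝ) (γ : Fin 3 → ℝ) :
    ∑ c : Ranking, (A + ∑ k, γ k * ((ballot c k : ℤ) : ℝ)) ^ 2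
      = 6 * (A ^ 2 + ∑ k, γ k ^ 2) - 4 * (γ 0 * γ 1 + γ 1 * γ 2 + γ 2 * γ 0) := by
  refine (sum_ranking fun x : Fin 3 → ℤˣ => (A + ∑ k, γ k * ((x k : ℤ) : ℝ)) ^ 2).trans ?_
  simp only [Fin.sum_univ_three, Matrix.cons_val_zero, Matrix.cons_val_one, Matrix.cons_val]
  push_cast
  ring

/-- Splitting off the vote of the third voter. -/
lemma linear_ballot_cons (α β : Fin 3 → ℝ) (a b c : Ranking) :
    ∑ k, (α k * ballotSum ![a, b, c] k + β k * ballotProd ![a, b, c] k)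
      = (∑ k, α k * (((ballot a k : ℤ) : ℝ) + ((ballot b k : ℤ) : ℝ)))
        + ∑ k, (α k + β k * ((ballot a k : ℤ) : ℝ) * ((ballot b k : ℤ) : ℝ))
          * ((ballot c k : ℤ) : ℝ) := by
  rw [← Finset.sum_add_distrib]
  refine Finset.sum_congr rfl fun k _ => ?_
  rw [ballotSum_cons, ballotProd_cons]
  ring

lemma integral_linear_ballot (α β : Fin 3 → ℝ) :
    ∫ ω, ∑ k, (α k * ballotSum ω k + β k * ballotProd ω k) ∂(impartialCulture 3) = 0 := by
  rw [integral_impartialCulture_three, div_eq_zero_iff]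
  left
  simp_rw [linear_ballot_cons, sum_ranking_linear]
  refine (sum_ranking fun x : Fin 3 → ℤˣ => ∑ b : Ranking, 6 * ∑ k, α k * (((x k : ℤ) : ℝ) +
    ((ballot b k : ℤ) : ℝ))).trans ?_
  have h : ∀ x : Fin 3 → ℤˣ, ∑ b : Ranking, 6 * ∑ k, α k * (((x k : ℤ) : ℝ) +
      ((ballot b k : ℤ) : ℝ)) = 36 * ∑ k, α k * ((x k : ℤ) : ℝ) := fun x => by
    have := sum_ranking_linear (∑ k, α k * ((x k : ℤ) : ℝ)) α
    rw [← Finset.mul_sum]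
    simp_rw [mul_add, Finset.sum_add_distrib] at this ⊢
    linarith
  simp only [h]
  simp only [Fin.sum_univ_three, Matrix.cons_val_zero, Matrix.cons_val_one, Matrix.cons_val]
  push_cast
  ring

/-- The second moments of the vote sums and vote products of three voters: both families are
equicorrelated, with correlations `-1/3` and `(-1/3) ^ 3`, and they are uncorrelated. -/
lemma integral_linear_ballot_sq (α β : Fin 3 → ℝ) :
    ∫ ω, (∑ k, (α k * ballotSum ω k + β k * ballotProd ω k)) ^ 2 ∂(impartialCulture 3)
      = 3 * ∑ k, α k ^ 2 - 2 * (α 0 * α 1 + α 1 * α 2 + α 2 * α 0)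
        + ∑ k, β k ^ 2 - 2 / 27 * (β 0 * β 1 + β 1 * β 2 + β 2 * β 0) := by
  rw [integral_impartialCulture_three]
  simp_rw [linear_ballot_cons, sum_ranking_sq]
  refine (congrArg (· / 216) (sum_ranking fun x : Fin 3 → ℤˣ => ∑ b : Ranking,
    (6 * ((∑ k, α k * (((x k : ℤ) : ℝ) + ((ballot b k : ℤ) : ℝ))) ^ 2
      + ∑ k, (α k + β k * ((x k : ℤ) : ℝ) * ((ballot b k : ℤ) : ℝ)) ^ 2)
      - 4 * ((α 0 + β 0 * ((x 0 : ℤ) : ℝ) * ((ballot b 0 : ℤ) : ℝ))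
          * (α 1 + β 1 * ((x 1 : ℤ) : ℝ) * ((ballot b 1 : ℤ) : ℝ))
        + (α 1 + β 1 * ((x 1 : ℤ) : ℝ) * ((ballot b 1 : ℤ) : ℝ))
          * (α 2 + β 2 * ((x 2 : ℤ) : ℝ) * ((ballot b 2 : ℤ) : ℝ))
        + (α 2 + β 2 * ((x 2 : ℤ) : ℝ) * ((ballot b 2 : ℤ) : ℝ))
          * (α 0 + β 0 * ((x 0 : ℤ) : ℝ) * ((ballot b 0 : ℤ) : ℝ)))))).trans ?_
  have h : ∀ x : Fin 3 → ℤˣ, ∑ b : Ranking,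
    (6 * ((∑ k, α k * (((x k : ℤ) : ℝ) + ((ballot b k : ℤ) : ℝ))) ^ 2
      + ∑ k, (α k + β k * ((x k : ℤ) : ℝ) * ((ballot b k : ℤ) : ℝ)) ^ 2)
      - 4 * ((α 0 + β 0 * ((x 0 : ℤ) : ℝ) * ((ballot b 0 : ℤ) : ℝ))
          * (α 1 + β 1 * ((x 1 : ℤ) : ℝ) * ((ballot b 1 : ℤ) : ℝ))
        + (α 1 + β 1 * ((x 1 : ℤ) : ℝ) * ((ballot b 1 : ℤ) : ℝ))
          * (α 2 + β 2 * ((x 2 : ℤ) : ℝ) * ((ballot b 2 : ℤ) : ℝ))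
        + (α 2 + β 2 * ((x 2 : ℤ) : ℝ) * ((ballot b 2 : ℤ) : ℝ))
          * (α 0 + β 0 * ((x 0 : ℤ) : ℝ) * ((ballot b 0 : ℤ) : ℝ))))
      = 36 * ((∑ k, α k * ((x k : ℤ) : ℝ)) ^ 2 + 2 * ∑ k, α k ^ 2
          + ∑ k, (β k * ((x k : ℤ) : ℝ)) ^ 2)
        - 48 * (α 0 * α 1 + α 1 * α 2 + α 2 * α 0)
        + 8 * (β 0 * β 1 * ((x 0 : ℤ) : ℝ) * ((x 1 : ℤ) : ℝ)
          + β 1 * β 2 * ((x 1 : ℤ) : ℝ) * ((x 2 : ℤ) : ℝ)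
          + β 2 * β 0 * ((x 2 : ℤ) : ℝ) * ((x 0 : ℤ) : ℝ)) := fun x => by
    refine (sum_ranking fun y : Fin 3 → ℤˣ =>
      (6 * ((∑ k, α k * (((x k : ℤ) : ℝ) + ((y k : ℤ) : ℝ))) ^ 2
      + ∑ k, (α k + β k * ((x k : ℤ) : ℝ) * ((y k : ℤ) : ℝ)) ^ 2)
      - 4 * ((α 0 + β 0 * ((x 0 : ℤ) : ℝ) * ((y 0 : ℤ) : ℝ))
          * (α 1 + β 1 * ((x 1 : ℤ) : ℝ) * ((y 1 : ℤ) : ℝ))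
        + (α 1 + β 1 * ((x 1 : ℤ) : ℝ) * ((y 1 : ℤ) : ℝ))
          * (α 2 + β 2 * ((x 2 : ℤ) : ℝ) * ((y 2 : ℤ) : ℝ))
        + (α 2 + β 2 * ((x 2 : ℤ) : ℝ) * ((y 2 : ℤ) : ℝ))
          * (α 0 + β 0 * ((x 0 : ℤ) : ℝ) * ((y 0 : ℤ) : ℝ))))).trans ?_
    simp only [Fin.sum_univ_three, Matrix.cons_val_zero, Matrix.cons_val_one, Matrix.cons_val]
    push_cast
    ring
  simp only [h]
  simp only [Fin.sum_univ_three, Matrix.cons_val_zero, Matrix.cons_val_one, Matrix.cons_val]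
  push_cast
  ring

end Model

/-! ### The unit box -/

section UnitBox

/-- The cube `[-1, 1]³` in Euclidean space. -/
def unitBox : Set (EuclideanSpace ℝ (Fin 3)) := {u | ∀ k, |u k| ≤ 1}

lemma isBounded_unitBox : Bornology.IsBounded unitBox := by
  refine (Metric.isBounded_closedBall (x := (0 : EuclideanSpace ℝ (Fin 3))) (r := 3)).subset
    fun u hu => ?_
  rw [mem_closedBall_zero_iff, EuclideanSpace.norm_eq, Real.sqrt_le_left (by norm_num),
    Fin.sum_univ_three]
  have h : ∀ k, ‖u k‖ ^ 2 ≤ 1 := fun k => by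
    have := hu k
    rw [Real.norm_eq_abs]
    nlinarith [abs_nonneg (u k)]
  linarith [h 0, h 1, h 2]

lemma isClosed_unitBox : IsClosed unitBox := by
  have : unitBox = ⋂ k, {u : EuclideanSpace ℝ (Fin 3) | |u k| ≤ 1} := by
    ext u; simp [unitBox]
  rw [this]
  exact isClosed_iInter fun k => isClosed_le (by fun_prop) continuous_const

lemma frontier_unitBox_subset :
    frontier unitBox ⊆ ⋃ k, {u : EuclideanSpace ℝ (Fin 3) | |u k| = 1} := by
  intro u hu
  rw [isClosed_unitBox.frontier_eq] at hu
  by_contra hne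
  simp only [Set.mem_iUnion, not_exists] at hne
  have hopen : IsOpen (⋂ k, {u : EuclideanSpace ℝ (Fin 3) | |u k| < 1}) :=
    isOpen_iInter_of_finite fun k => isOpen_lt (by fun_prop) continuous_const
  refine hu.2 (mem_interior.2 ⟨_, ?_, hopen, ?_⟩)
  · intro v hv k
    exact (Set.mem_iInter.1 hv k).le
  · exact Set.mem_iInter.2 fun k => lt_of_le_of_ne (hu.1 k) (hne k)

lemma stdGaussian_frontier_unitBox :
    stdGaussian (EuclideanSpace ℝ (Fin 3)) (frontier unitBox) = 0 := by
  refine measure_mono_null frontier_unitBox_subset (measure_iUnion_null fun k => ?_)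
  have hm : Measurable fun x : Fin 3 → ℝ => (WithLp.toLp 2 x : EuclideanSpace ℝ (Fin 3)) := by
    fun_prop
  have hc : MeasurableSet {u : EuclideanSpace ℝ (Fin 3) | |u k| = 1} :=
    (isClosed_eq (by fun_prop) continuous_const).measurableSet
  rw [← map_pi_eq_stdGaussian, Measure.map_apply hm hc]
  have e : (fun x : Fin 3 → ℝ => (WithLp.toLp 2 x : EuclideanSpace ℝ (Fin 3))) ⁻¹'
      {u | |u k| = 1} = Function.eval k ⁻¹' {1, -1} := by
    ext x
    simp [abs_eq]
  rw [e, (measurePreserving_eval (fun _ : Fin 3 => gaussianReal 0 1) k).measure_preimage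
    (Set.toFinite _).measurableSet.nullMeasurableSet]
  have := nullSingletonClass_gaussianReal (μ := 0) (v := 1) one_ne_zero
  exact (Set.toFinite _).measure_zero _

lemma stdGaussian_unitBox_ne_zero : stdGaussian (EuclideanSpace ℝ (Fin 3)) unitBox ≠ 0 := by
  have hm : Measurable fun x : Fin 3 → ℝ => (WithLp.toLp 2 x : EuclideanSpace ℝ (Fin 3)) := by
    fun_prop
  rw [← map_pi_eq_stdGaussian, Measure.map_apply hm isClosed_unitBox.measurableSet]
  have e : (fun x : Fin 3 → ℝ => (WithLp.toLp 2 x : EuclideanSpace ℝ (Fin 3))) ⁻¹' unitBox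
      = Set.univ.pi fun _ => Set.Icc (-1) 1 := by
    ext x
    simp [unitBox, abs_le, Pi.le_def, forall_and]
  rw [e, Measure.pi_pi, Finset.prod_ne_zero_iff]
  intro k _ h0
  have hac : volume ≪ gaussianReal 0 1 := gaussianReal_absolutelyContinuous' 0 one_ne_zero
  have := hac h0
  norm_num at this

end UnitBox

/-! ### Regression of the majorities on the latent vector -/

section Moments

/-- The vector `(p S_k - q Π_k)_k` of a triplet of voters, where `S_k` and `Π_k` are the sum and the
product of its votes in the `k`-th election. With `p = ρ / 2` and `q = ρ ^ 3 / 2` its entries are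
the noisy majorities of the triplet; with `p = 1` and `q = 0` they are the vote margins. -/
noncomputable def latentVec (p q : ℝ) (ω : Fin 3 → Ranking) : EuclideanSpace ℝ (Fin 3) :=
  WithLp.toLp 2 fun k => p * ballotSum ω k - q * ballotProd ω k

/-- The majority of the votes of a triplet in the `k`-th election. -/
noncomputable def ballotMaj (ω : Fin 3 → Ranking) (k : Fin 3) : ℝ :=
  (ballotSum ω k - ballotProd ω k) / 2

/-- The majorities of a triplet of voters in the elections `i` and `j`. -/
noncomputable def majPair (i j : Fin 3) (ω : Fin 3 → Ranking) : EuclideanSpace ℝ (Fin 2) :=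
  !₂[ballotMaj ω i, ballotMaj ω j]

/-- A vector indexed by the elections `i` and `j`, extended by zero to all three elections. -/
def extendPair (i j : Fin 3) (s : EuclideanSpace ℝ (Fin 2)) (k : Fin 3) : ℝ :=
  (if k = i then s 0 else 0) + (if k = j then s 1 else 0)

open scoped RealInnerProductSpace

lemma inner_latentVec (p q : ℝ) (ω : Fin 3 → Ranking) (t : EuclideanSpace ℝ (Fin 3)) :
    ⟪latentVec p q ω, t⟫ = ∑ k, ((p * t k) * ballotSum ω k + (-q * t k) * ballotProd ω k) := by
  simp only [PiLp.inner_apply, latentVec, RCLike.inner_apply, conj_trivial]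
  exact Finset.sum_congr rfl fun k _ => by ring

lemma inner_majPair (i j : Fin 3) (ω : Fin 3 → Ranking) (s : EuclideanSpace ℝ (Fin 2)) :
    ⟪majPair i j ω, s⟫ = ∑ k, ((extendPair i j s k / 2) * ballotSum ω k
      + (-(extendPair i j s k / 2)) * ballotProd ω k) := by
  have h : ∀ k, (extendPair i j s k / 2) * ballotSum ω k
      + (-(extendPair i j s k / 2)) * ballotProd ω k
      = (if k = i then s 0 * ballotMaj ω k else 0)
        + (if k = j then s 1 * ballotMaj ω k else 0) := by
    intro k
    simp only [extendPair, ballotMaj]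
    split_ifs <;> ring
  simp only [h, Finset.sum_add_distrib, Finset.sum_ite_eq', Finset.mem_univ, if_true,
    PiLp.inner_apply, Fin.sum_univ_two, majPair, RCLike.inner_apply, conj_trivial]
  simp

/-- A quadratic form in three variables that is invariant under permutations splits into its values
on the diagonal and on the orthogonal complement of the diagonal; here the second moments of linear
statistics of a triplet are written in this way. -/
lemma integral_latent_sq (p q : ℝ) (t s : Fin 3 → ℝ) :
    ∫ ω, (∑ k, ((p * t k + s k) * ballotSum ω k + (-q * t k + -s k) * ballotProd ω k)) ^ 2
        ∂(impartialCulture 3)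
      = ((p * (t 0 + t 1 + t 2) + (s 0 + s 1 + s 2)) ^ 2
          + 25 / 27 * (q * (t 0 + t 1 + t 2) + (s 0 + s 1 + s 2)) ^ 2
          + 4 * ((p * (t 0 - t 1) + (s 0 - s 1)) ^ 2 + (p * (t 1 - t 2) + (s 1 - s 2)) ^ 2
            + (p * (t 2 - t 0) + (s 2 - s 0)) ^ 2)
          + 28 / 27 * ((q * (t 0 - t 1) + (s 0 - s 1)) ^ 2 + (q * (t 1 - t 2) + (s 1 - s 2)) ^ 2
            + (q * (t 2 - t 0) + (s 2 - s 0)) ^ 2)) / 3 := by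
  rw [integral_linear_ballot_sq, Fin.sum_univ_three, Fin.sum_univ_three]
  ring

/-- The variance of the latent vector along the diagonal, that is, in the direction of the unit
vector proportional to `(1, 1, 1)`. -/
noncomputable def latentVarDiag (p q : ℝ) : ℝ := p ^ 2 + 25 / 27 * q ^ 2

/-- The variance of the latent vector orthogonally to the diagonal. -/
noncomputable def latentVarPerp (p q : ℝ) : ℝ := 4 * p ^ 2 + 28 / 27 * q ^ 2

lemma integral_inner_latentVec_sq (p q : ℝ) (t : EuclideanSpace ℝ (Fin 3)) :
    ∫ ω, ⟪latentVec p q ω, t⟫ ^ 2 ∂(impartialCulture 3)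
      = (latentVarDiag p q * (t 0 + t 1 + t 2) ^ 2 + latentVarPerp p q *
        ((t 0 - t 1) ^ 2 + (t 1 - t 2) ^ 2 + (t 2 - t 0) ^ 2)) / 3 := by
  have := integral_latent_sq p q (fun k => t k) 0
  simp only [Pi.zero_apply, add_zero, neg_zero] at this
  simp_rw [inner_latentVec]
  rw [this, latentVarDiag, latentVarPerp]
  ring

lemma le_integral_inner_latentVec_sq (p q : ℝ) (t : EuclideanSpace ℝ (Fin 3)) :
    p ^ 2 * ‖t‖ ^ 2 ≤ ∫ ω, ⟪latentVec p q ω, t⟫ ^ 2 ∂(impartialCulture 3) := by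
  rw [integral_inner_latentVec_sq, EuclideanSpace.norm_sq_eq, Fin.sum_univ_three]
  simp only [Real.norm_eq_abs, sq_abs]
  have h1 : p ^ 2 ≤ latentVarDiag p q := by rw [latentVarDiag]; nlinarith [sq_nonneg q]
  have h2 : p ^ 2 ≤ latentVarPerp p q := by
    rw [latentVarPerp]; nlinarith [sq_nonneg q, sq_nonneg p]
  have h3 := mul_le_mul_of_nonneg_right h1 (sq_nonneg (t 0 + t 1 + t 2))
  have h4 := mul_le_mul_of_nonneg_right h2
    (by positivity : 0 ≤ (t 0 - t 1) ^ 2 + (t 1 - t 2) ^ 2 + (t 2 - t 0) ^ 2)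
  linarith

/-- The residual variance along the diagonal, up to the factor `(p - q) ^ 2 / 4`, of the majorities
of a triplet after regression on the latent vector. -/
noncomputable def residualDiag (p q : ℝ) : ℝ := 25 / 27 / latentVarDiag p q

/-- The residual variance orthogonally to the diagonal, up to the factor `(p - q) ^ 2 / 4`, of the
majorities of a triplet after regression on the latent vector. -/
noncomputable def residualPerp (p q : ℝ) : ℝ := 112 / 27 / latentVarPerp p q

/-- The variance of the majority of a triplet that is not explained linearly by the latent
vector. -/
noncomputable def residualVar (p q : ℝ) : ℝ :=
  (p - q) ^ 2 / 12 * (residualDiag p q + 2 * residualPerp p q)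

/-- The partial correlation of the majorities of a triplet in two elections, given the latent
vector. -/
noncomputable def partialCorr (p q : ℝ) : ℝ :=
  (residualDiag p q - residualPerp p q) / (residualDiag p q + 2 * residualPerp p q)

/-- The linear regression on the latent vector of the statistic with weights `s k` on the sums and
`-s k` on the products of the votes; half weights give linear combinations of majorities. -/
noncomputable def regression (p q : ℝ) (s : Fin 3 → ℝ) : EuclideanSpace ℝ (Fin 3) :=
  WithLp.toLp 2 fun k =>
    (p + 25 / 27 * q) / latentVarDiag p q * ((s 0 + s 1 + s 2) / 3)
      + (4 * p + 28 / 27 * q) / latentVarPerp p q * (s k - (s 0 + s 1 + s 2) / 3)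

variable {p q : ℝ}

lemma latentVarDiag_pos (hp : p ≠ 0) : 0 < latentVarDiag p q := by
  rw [latentVarDiag]; positivity

lemma latentVarPerp_pos (hp : p ≠ 0) : 0 < latentVarPerp p q := by
  rw [latentVarPerp]; positivity

lemma residualDiag_pos (hp : p ≠ 0) : 0 < residualDiag p q :=
  div_pos (by norm_num) (latentVarDiag_pos hp)

lemma residualPerp_pos (hp : p ≠ 0) : 0 < residualPerp p q :=
  div_pos (by norm_num) (latentVarPerp_pos hp)

lemma residualVar_pos (hp : p ≠ 0) (hpq : p ≠ q) : 0 < residualVar p q := by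
  have h1 := residualDiag_pos (q := q) hp
  have h2 := residualPerp_pos (q := q) hp
  have h3 : p - q ≠ 0 := sub_ne_zero.2 hpq
  rw [residualVar]
  positivity

lemma partialCorr_mem (hp : p ≠ 0) : partialCorr p q ∈ Set.Ioo (-1) 1 := by
  have h1 := residualDiag_pos (q := q) hp
  have h2 := residualPerp_pos (q := q) hp
  rw [partialCorr, Set.mem_Ioo, lt_div_iff₀ (by positivity), div_lt_one (by positivity)]
  constructor <;> linarith

/-- Completing the square in one variable. -/
lemma complete_square {p q W X D : ℝ} (hD : D ≠ 0) (e : D = W * p ^ 2 + X * q ^ 2) (t s : ℝ) :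
    W * (p * t + s) ^ 2 + X * (q * t + s) ^ 2
      = D * (t + (W * p + X * q) / D * s) ^ 2 + (p - q) ^ 2 * (W * X / D) * s ^ 2 := by
  have h : D * (t + (W * p + X * q) / D * s) ^ 2 + (p - q) ^ 2 * (W * X / D) * s ^ 2
      = D * t ^ 2 + 2 * (W * p + X * q) * t * s
        + ((W * p + X * q) ^ 2 + (p - q) ^ 2 * (W * X)) / D * s ^ 2 := by
    field_simp
    ring
  have h2 : ((W * p + X * q) ^ 2 + (p - q) ^ 2 * (W * X)) / D = W + X := by
    rw [div_eq_iff hD, e]; ring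
  rw [h, h2, e]
  ring

/-- The joint second moments of the latent vector and the majorities, after regression of the
majorities on the latent vector. -/
lemma integral_latentVec_add_majPair_sq (hp : p ≠ 0) {i j : Fin 3} (hij : i ≠ j)
    (t : EuclideanSpace ℝ (Fin 3)) (s : EuclideanSpace ℝ (Fin 2)) :
    ∫ ω, (⟪latentVec p q ω, t⟫ + ⟪majPair i j ω, s⟫) ^ 2 ∂(impartialCulture 3)
      = ∫ ω, ⟪latentVec p q ω, t + regression p q fun k => extendPair i j s k / 2⟫ ^ 2
          ∂(impartialCulture 3)
        + residualVar p q * (s 0 ^ 2 + s 1 ^ 2 + 2 * partialCorr p q * (s 0 * s 1)) := by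
  have hD := (latentVarDiag_pos (q := q) hp).ne'
  have hE := (latentVarPerp_pos (q := q) hp).ne'
  have hR : residualDiag p q + 2 * residualPerp p q ≠ 0 :=
    (add_pos (residualDiag_pos hp) (mul_pos two_pos (residualPerp_pos hp))).ne'
  set z : Fin 3 → ℝ := fun k => extendPair i j s k / 2 with hz
  have hl : ∫ ω, (⟪latentVec p q ω, t⟫ + ⟪majPair i j ω, s⟫) ^ 2 ∂(impartialCulture 3)
      = ∫ ω, (∑ k, ((p * t k + z k) * ballotSum ω k + (-q * t k + -z k) * ballotProd ω k)) ^ 2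
        ∂(impartialCulture 3) := by
    refine integral_congr_ae (Eventually.of_forall fun ω => ?_)
    simp only [inner_latentVec, inner_majPair]
    rw [← Finset.sum_add_distrib]
    congr 1
    exact Finset.sum_congr rfl fun k _ => by ring
  rw [hl, integral_latent_sq p q (fun k => t k) z, integral_inner_latentVec_sq]
  have hdiag := complete_square (p := p) (q := q) (W := 1) (X := 25 / 27) hD
    (by rw [latentVarDiag]; ring)
  have hperp := complete_square (p := p) (q := q) (W := 4) (X := 28 / 27) hE
    (by rw [latentVarPerp])
  have hq : residualVar p q * (s 0 ^ 2 + s 1 ^ 2 + 2 * partialCorr p q * (s 0 * s 1))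
      = (p - q) ^ 2 * (residualDiag p q * (z 0 + z 1 + z 2) ^ 2 + residualPerp p q *
        ((z 0 - z 1) ^ 2 + (z 1 - z 2) ^ 2 + (z 2 - z 0) ^ 2)) / 3 := by
    have h1 : residualVar p q * (s 0 ^ 2 + s 1 ^ 2 + 2 * partialCorr p q * (s 0 * s 1))
        = (p - q) ^ 2 / 12 * ((residualDiag p q + 2 * residualPerp p q) * (s 0 ^ 2 + s 1 ^ 2)
          + 2 * (residualDiag p q - residualPerp p q) * (s 0 * s 1)) := by
      rw [residualVar, partialCorr]
      field_simp
    rw [h1]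
    simp only [hz, extendPair]
    fin_cases i <;> fin_cases j <;> simp at hij ⊢ <;> ring
  have d0 := hdiag (t 0 + t 1 + t 2) (z 0 + z 1 + z 2)
  have d1 := hperp (t 0 - t 1) (z 0 - z 1)
  have d2 := hperp (t 1 - t 2) (z 1 - z 2)
  have d3 := hperp (t 2 - t 0) (z 2 - z 0)
  have e1 : (1 : ℝ) * (25 / 27) / latentVarDiag p q = residualDiag p q := by
    rw [residualDiag, one_mul]
  have e2 : (4 : ℝ) * (28 / 27) / latentVarPerp p q = residualPerp p q := by
    rw [residualPerp]; norm_num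
  rw [e1] at d0
  rw [e2] at d1 d2 d3
  rw [hq]
  simp only [PiLp.add_apply, regression]
  rw [one_mul] at d0
  set μ₁ := (p + 25 / 27 * q) / latentVarDiag p q with hμ₁
  set μ₂ := (4 * p + 28 / 27 * q) / latentVarPerp p q with hμ₂
  rw [one_mul, ← hμ₁] at d0
  linear_combination (d0 + d1 + d2 + d3) / 3

end Moments

/-! ### Asymptotics given small latent sums -/

section TripletLimit

open scoped RealInnerProductSpace

/-- The profiles, grouped into triplets of voters, whose three latent sums are at most `d` in
absolute value. -/
def latentBox (p q : ℝ) (m : ℕ) (d : ℝ) : Set (Fin m → Fin 3 → Ranking) :=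
  {ω | ∀ k, |∑ i, (p * ballotSum (ω i) k - q * ballotProd (ω i) k)| ≤ d}

/-- The profiles, grouped into triplets of voters, for which the sums of the majorities in the
elections `i` and `j` have the same strict sign. -/
def agree (i j : Fin 3) (m : ℕ) : Set (Fin m → Fin 3 → Ranking) :=
  {ω | 0 < (∑ l, ballotMaj (ω l) i) * ∑ l, ballotMaj (ω l) j}

variable {p q : ℝ}

lemma integral_inner_latentVec (t : EuclideanSpace ℝ (Fin 3)) :
    ∫ ω, ⟪latentVec p q ω, t⟫ ∂(impartialCulture 3) = 0 := by
  simp_rw [inner_latentVec]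
  exact integral_linear_ballot _ _

lemma integral_inner_majPair (i j : Fin 3) (s : EuclideanSpace ℝ (Fin 2)) :
    ∫ ω, ⟪majPair i j ω, s⟫ ∂(impartialCulture 3) = 0 := by
  simp_rw [inner_majPair]
  exact integral_linear_ballot _ _

lemma latent_smul_mem_unitBox_iff {m : ℕ} (hm : 0 < m) {L : ℝ} (hL : 0 < L)
    (ω : Fin m → Fin 3 → Ranking) :
    L • (√m)⁻¹ • ∑ i, latentVec p q (ω i) ∈ unitBox ↔ ω ∈ latentBox p q m (√m / L) := by
  have hs : 0 < √(m : ℝ) := Real.sqrt_pos.2 (Nat.cast_pos.2 hm)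
  refine forall_congr' fun k => ?_
  have e : (L • (√m)⁻¹ • ∑ i, latentVec p q (ω i)) k
      = L * ((√m)⁻¹ * ∑ i, (p * ballotSum (ω i) k - q * ballotProd (ω i) k)) := by
    simp [latentVec]
  rw [e, abs_mul, abs_mul, abs_of_pos hL, abs_of_pos (inv_pos.2 hs), le_div_iff₀ hL,
    mul_comm _ L, mul_left_comm, inv_mul_le_iff₀ hs, mul_one]

lemma maj_smul_mem_sameSign_iff {m : ℕ} (hm : 0 < m) (i j : Fin 3)
    (ω : Fin m → Fin 3 → Ranking) :
    (√m)⁻¹ • ∑ l, majPair i j (ω l) ∈ sameSign ↔ ω ∈ agree i j m := by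
  have hs : 0 < (√(m : ℝ))⁻¹ := inv_pos.2 (Real.sqrt_pos.2 (Nat.cast_pos.2 hm))
  have e0 : ((√m)⁻¹ • ∑ l, majPair i j (ω l)) 0 = (√m)⁻¹ * ∑ l, ballotMaj (ω l) i := by
    simp [majPair]
  have e1 : ((√m)⁻¹ • ∑ l, majPair i j (ω l)) 1 = (√m)⁻¹ * ∑ l, ballotMaj (ω l) j := by
    simp [majPair]
  rw [sameSign, agree, Set.mem_ofPred_eq, Set.mem_ofPred_eq, e0, e1, mul_mul_mul_comm,
    mul_pos_iff_of_pos_left (mul_pos hs hs)]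

/-- The limiting density at `0` of the latent sums, integrated over the unit box. -/
noncomputable def boxDensity (p q : ℝ) : ℝ :=
  localDensity (impartialCulture 3) (latentVec p q) unitBox

lemma boxDensity_pos (hp : p ≠ 0) : 0 < boxDensity p q :=
  localDensity_pos _ (by positivity : 0 < p ^ 2) (le_integral_inner_latentVec_sq p q)
    isBounded_unitBox isClosed_unitBox.measurableSet stdGaussian_unitBox_ne_zero

lemma tendsto_latentBox_inter (hp : p ≠ 0) (hpq : p ≠ q) {i j : Fin 3} (hij : i ≠ j) {L : ℕ → ℝ}
    (hL : Tendsto L atTop atTop) (hLm : ∀ᶠ m : ℕ in atTop, L m ^ 4 ≤ m)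
    {O : Set (EuclideanSpace ℝ (Fin 2))} (hOm : MeasurableSet O)
    (hOf : corrGaussian (√(residualVar p q)) (Real.arcsin (partialCorr p q)) (frontier O) = 0) :
    Tendsto (fun m : ℕ => L m ^ 3 * (Measure.pi fun _ : Fin m => impartialCulture 3).real
        {ω | ω ∈ latentBox p q m (√m / L m) ∧ (√m)⁻¹ • ∑ l, majPair i j (ω l) ∈ O}) atTop
      (𝓝 (boxDensity p q *
        (corrGaussian (√(residualVar p q)) (Real.arcsin (partialCorr p q))).real O)) := by
  have hr := partialCorr_mem (q := q) hp
  have h := tendsto_pow_mul_measureReal_local (impartialCulture 3) (y := latentVec p q)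
    (a := majPair i j) (M := fun s => regression p q fun k => extendPair i j s k / 2)
    (Q := fun s => residualVar p q * (s 0 ^ 2 + s 1 ^ 2 + 2 * partialCorr p q * (s 0 * s 1)))
    integral_inner_latentVec (integral_inner_majPair i j)
    (integral_latentVec_add_majPair_sq hp hij) (by positivity : 0 < p ^ 2)
    (le_integral_inner_latentVec_sq p q)
    (γ := corrGaussian (√(residualVar p q)) (Real.arcsin (partialCorr p q)))
    (fun s => by
      rw [charFun_corrGaussian, Real.sin_arcsin hr.1.le hr.2.le,
        Real.sq_sqrt (residualVar_pos hp hpq).le])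
    hL hLm isBounded_unitBox isClosed_unitBox.measurableSet stdGaussian_frontier_unitBox hOm hOf
  refine h.congr' ?_
  filter_upwards [hL.eventually_gt_atTop 0, eventually_gt_atTop 0] with m hLm hm
  rw [finrank_euclideanSpace_fin]
  congr 3
  ext ω
  exact and_congr_left fun _ => latent_smul_mem_unitBox_iff hm hLm ω

lemma tendsto_latentBox (hp : p ≠ 0) (hpq : p ≠ q) {L : ℕ → ℝ}
    (hL : Tendsto L atTop atTop) (hLm : ∀ᶠ m : ℕ in atTop, L m ^ 4 ≤ m) :
    Tendsto (fun m : ℕ => L m ^ 3 * (Measure.pi fun _ : Fin m => impartialCulture 3).real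
      (latentBox p q m (√m / L m))) atTop (𝓝 (boxDensity p q)) := by
  have h := tendsto_latentBox_inter hp hpq (zero_ne_one : (0 : Fin 3) ≠ 1) hL hLm
    MeasurableSet.univ (by simp)
  simpa using h

lemma tendsto_latentBox_inter_agree (hp : p ≠ 0) (hpq : p ≠ q) {i j : Fin 3} (hij : i ≠ j)
    {L : ℕ → ℝ} (hL : Tendsto L atTop atTop) (hLm : ∀ᶠ m : ℕ in atTop, L m ^ 4 ≤ m) :
    Tendsto (fun m : ℕ => L m ^ 3 * (Measure.pi fun _ : Fin m => impartialCulture 3).real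
        (latentBox p q m (√m / L m) ∩ agree i j m)) atTop
      (𝓝 (boxDensity p q * (1 / 2 + Real.arcsin (partialCorr p q) / Real.pi))) := by
  have hr := partialCorr_mem (q := q) hp
  have hσ : √(residualVar p q) ≠ 0 := (Real.sqrt_pos.2 (residualVar_pos hp hpq)).ne'
  have hψ : Real.arcsin (partialCorr p q) ∈ Set.Ioo (-(Real.pi / 2)) (Real.pi / 2) :=
    ⟨Real.neg_pi_div_two_lt_arcsin.2 hr.1, Real.arcsin_lt_pi_div_two.2 hr.2⟩
  have h := tendsto_latentBox_inter hp hpq hij hL hLm measurableSet_sameSign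
    (corrGaussian_frontier_sameSign hσ hψ)
  rw [corrGaussian_real_sameSign hσ hψ] at h
  refine h.congr' ?_
  filter_upwards [eventually_gt_atTop 0] with m hm
  congr 2
  ext ω
  exact and_congr_right fun _ => maj_smul_mem_sameSign_iff hm i j ω

end TripletLimit

/-! ### From agreement to the paradox -/

section Paradox

lemma ballotMaj_eq (ω : Fin 3 → Ranking) (k : Fin 3) :
    ballotMaj ω k = (Int.sign (voteSum (votes ω k (k + 1))) : ℤ) := by
  have h := two_mul_sign_voteSum (votes ω k (k + 1))
  have h2 : (2 : ℝ) * (Int.sign (voteSum (votes ω k (k + 1))) : ℤ)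
      = ballotSum ω k - ballotProd ω k := by
    rw [ballotSum, ballotProd]
    exact_mod_cast h
  rw [ballotMaj, ← h2]
  ring

lemma votes_tripletsEquiv {m : ℕ} (r : Fin (3 * m) → Ranking) (k k' : Fin 3) (i : Fin m) :
    tripletsEquiv m ℤˣ (votes r k k') i = votes (tripletsEquiv m Ranking r i) k k' := rfl

lemma majTriplets_votes {m : ℕ} (r : Fin (3 * m) → Ranking) (k : Fin 3) :
    (majTriplets m (votes r k (k + 1)) : ℝ)
      = SignType.sign (∑ i, ballotMaj (tripletsEquiv m Ranking r i) k) := by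
  rw [majTriplets_eq, Int.sign_eq_sign]
  simp only [votes_tripletsEquiv, ballotMaj_eq]
  rw [← Int.cast_sum, sign_intCast]
  exact SignType.intCast_cast _

lemma sum_ballotMaj_ne_zero {m : ℕ} (hm : Odd m) (ω : Fin m → Fin 3 → Ranking) (k : Fin 3) :
    ∑ i, ballotMaj (ω i) k ≠ 0 := by
  have h := sum_sign_voteSum_odd hm fun i => votes (ω i) k (k + 1)
  simp only [ballotMaj_eq]
  rw [← Int.cast_sum, Int.cast_ne_zero]
  intro h0
  rw [h0] at h
  exact absurd h (by decide)

lemma sign_eq_sign_iff_mul_pos {x y : ℝ} (hx : x ≠ 0) (hy : y ≠ 0) :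
    ((SignType.sign x : SignType) : ℝ) = ((SignType.sign y : SignType) : ℝ) ↔ 0 < x * y := by
  rcases lt_or_gt_of_ne hx with hx | hx <;> rcases lt_or_gt_of_ne hy with hy | hy
  · simp [sign_neg hx, sign_neg hy, mul_pos_of_neg_of_neg hx hy]
  · simp only [sign_neg hx, sign_pos hy, (mul_neg_of_neg_of_pos hx hy).not_gt, iff_false]
    norm_num
  · simp only [sign_pos hx, sign_neg hy, (mul_neg_of_pos_of_neg hx hy).not_gt, iff_false]
    norm_num
  · simp [sign_pos hx, sign_pos hy, mul_pos hx hy]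

lemma paradox_eq_preimage {m : ℕ} (hm : Odd m) :
    paradox m = tripletsEquiv m Ranking ⁻¹' (agree 0 1 m ∩ agree 1 2 m) := by
  ext r
  have h : ∀ k, (majTriplets m (votes r k (k + 1)) : ℝ)
      = SignType.sign (∑ i, ballotMaj (tripletsEquiv m Ranking r i) k) := majTriplets_votes r
  have hne := sum_ballotMaj_ne_zero hm (tripletsEquiv m Ranking r)
  have h01 : majTriplets m (votes r 0 1) = majTriplets m (votes r 1 2)
      ↔ tripletsEquiv m Ranking r ∈ agree 0 1 m := by
    refine Iff.trans ?_ (sign_eq_sign_iff_mul_pos (hne 0) (hne 1))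
    rw [← h, ← h]
    exact Int.cast_inj.symm
  have h12 : majTriplets m (votes r 1 2) = majTriplets m (votes r 2 0)
      ↔ tripletsEquiv m Ranking r ∈ agree 1 2 m := by
    refine Iff.trans ?_ (sign_eq_sign_iff_mul_pos (hne 1) (hne 2))
    rw [← h, ← h]
    exact Int.cast_inj.symm
  exact and_congr h01 h12

/-- Among three signs, the number of agreeing pairs is three or one. -/
lemma two_mul_measureReal_inter_agree {m : ℕ} (hm : Odd m) {μ : Measure (Fin m → Fin 3 → Ranking)}
    [IsFiniteMeasure μ] (E : Set (Fin m → Fin 3 → Ranking)) :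
    2 * μ.real (E ∩ (agree 0 1 m ∩ agree 1 2 m))
      = μ.real (E ∩ agree 0 1 m) + μ.real (E ∩ agree 1 2 m) + μ.real (E ∩ agree 2 0 m)
        - μ.real E := by
  have key : ∀ x y z : ℝ, x ≠ 0 → y ≠ 0 → z ≠ 0 →
      ((0 < z * x ∧ (0 < x * y ∨ 0 < y * z)) ↔ (0 < x * y ∧ 0 < y * z)) ∧
      (0 < x * y ∨ 0 < y * z ∨ 0 < z * x) := by
    intro x y z hx hy hz
    rcases lt_or_gt_of_ne hx with hx | hx <;> rcases lt_or_gt_of_ne hy with hy | hy <;>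
      rcases lt_or_gt_of_ne hz with hz | hz <;>
      simp [mul_pos_iff, hx, hy, hz, hx.not_gt, hy.not_gt, hz.not_gt]
  have hk := fun ω => key _ _ _ (sum_ballotMaj_ne_zero hm ω 0) (sum_ballotMaj_ne_zero hm ω 1)
    (sum_ballotMaj_ne_zero hm ω 2)
  have hAB : (E ∩ agree 0 1 m) ∩ (E ∩ agree 1 2 m) = E ∩ (agree 0 1 m ∩ agree 1 2 m) :=
    (Set.inter_inter_distrib_left _ _ _).symm
  have hABC : ((E ∩ agree 0 1 m) ∪ (E ∩ agree 1 2 m)) ∩ (E ∩ agree 2 0 m)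
      = E ∩ (agree 0 1 m ∩ agree 1 2 m) := by
    ext ω
    have := (hk ω).1
    simp only [Set.mem_inter_iff, Set.mem_union, agree, Set.mem_ofPred_eq]
    tauto
  have hU : ((E ∩ agree 0 1 m) ∪ (E ∩ agree 1 2 m)) ∪ (E ∩ agree 2 0 m) = E := by
    ext ω
    have := (hk ω).2
    simp only [Set.mem_inter_iff, Set.mem_union, agree, Set.mem_ofPred_eq]
    tauto
  have h1 := measureReal_union_add_inter (μ := μ) (s := E ∩ agree 0 1 m) (t := E ∩ agree 1 2 m)
    (Set.toFinite _).measurableSet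
  have h2 := measureReal_union_add_inter (μ := μ) (s := (E ∩ agree 0 1 m) ∪ (E ∩ agree 1 2 m))
    (t := E ∩ agree 2 0 m) (Set.toFinite _).measurableSet
  rw [hAB] at h1
  rw [hABC, hU] at h2
  linarith

lemma oddAtTop_le : oddAtTop ≤ atTop := inf_le_left

lemma eventually_odd : ∀ᶠ m in oddAtTop, Odd m :=
  mem_inf_of_right (mem_principal_self _)

/-- The conditional probability of the paradox is determined by the asymptotics, to the order
`L ^ (-3)` of the probability of the conditioning events, of the three probabilities of
agreement. -/
lemma tendsto_cond_paradox {E : (m : ℕ) → Set (Fin m → Fin 3 → Ranking)}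
    {F : (m : ℕ) → Set (Fin (3 * m) → Ranking)}
    (hEF : ∀ᶠ m in oddAtTop, F m = tripletsEquiv m Ranking ⁻¹' E m) {L : ℕ → ℝ}
    (hL : Tendsto L oddAtTop atTop) {D w : ℝ} (hD : D ≠ 0)
    (h : Tendsto (fun m : ℕ => L m ^ 3 *
      (Measure.pi fun _ : Fin m => impartialCulture 3).real (E m)) oddAtTop (𝓝 D))
    (ha : ∀ i j : Fin 3, i ≠ j → Tendsto (fun m : ℕ => L m ^ 3 *
      (Measure.pi fun _ : Fin m => impartialCulture 3).real (E m ∩ agree i j m))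
      oddAtTop (𝓝 (D * w))) :
    Tendsto (fun m : ℕ => (cond (impartialCulture (3 * m)) (F m)).real (paradox m)) oddAtTop
      (𝓝 ((3 * w - 1) / 2)) := by
  have hlim := ((((ha 0 1 (by decide)).add (ha 1 2 (by decide))).add (ha 2 0 (by decide))).sub
    h).div (h.const_mul 2) (mul_ne_zero two_ne_zero hD)
  have e : (D * w + D * w + D * w - D) / (2 * D) = (3 * w - 1) / 2 := by
    field_simp; ring
  rw [e] at hlim
  refine hlim.congr' ?_
  filter_upwards [hEF, eventually_odd, hL.eventually_gt_atTop 0] with m hF hm hLm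
  rw [Measure.real, cond_apply (Set.toFinite _).measurableSet, ENNReal.toReal_mul,
    ENNReal.toReal_inv, ← Measure.real, ← Measure.real, paradox_eq_preimage hm, hF,
    ← Set.preimage_inter, impartialCulture_real_preimage, impartialCulture_real_preimage]
  have h2 := two_mul_measureReal_inter_agree hm
    (μ := Measure.pi fun _ : Fin m => impartialCulture 3) (E m)
  have hL3 : L m ^ 3 ≠ 0 := (pow_pos hLm 3).ne'
  simp only [Pi.div_apply]
  set x := (Measure.pi fun _ : Fin m => impartialCulture 3).real
    (E m ∩ (agree 0 1 m ∩ agree 1 2 m))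
  rw [← mul_add, ← mul_add, ← mul_sub, ← h2, mul_left_comm 2, mul_div_mul_left _ _ hL3,
    mul_div_mul_left _ _ two_ne_zero, inv_mul_eq_div]

end Paradox

/-! ### Close margins -/

section CloseMargins

lemma votes_swap {n : ℕ} (r : Fin n → Ranking) {k k' : Fin 3} (h : k ≠ k') (i : Fin n) :
    votes r k' k i = -votes r k k' i := by
  have hne : r i k ≠ r i k' := fun e => h ((r i).injective e)
  rcases lt_or_gt_of_ne hne with hlt | hlt
  · simp [votes, hlt, hlt.not_gt]
  · simp [votes, hlt, hlt.not_gt]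

lemma margin_swap {n : ℕ} (r : Fin n → Ranking) {k k' : Fin 3} (h : k ≠ k') :
    margin r k' k = -margin r k k' := by
  simp [margin, votes_swap r h, Finset.sum_neg_distrib]

lemma margin_eq_sum {m : ℕ} (r : Fin (3 * m) → Ranking) (k : Fin 3) :
    (margin r k (k + 1) : ℝ) = ∑ i, ballotSum (tripletsEquiv m Ranking r i) k := by
  rw [margin, ← (tripletIndex m).sum_comp, Fintype.sum_prod_type, Int.cast_sum]
  refine Finset.sum_congr rfl fun i _ => ?_
  rw [Fin.sum_univ_three]
  rfl

lemma closeMargins_eq_preimage (m : ℕ) (d : ℝ) :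
    closeMargins (3 * m) d = tripletsEquiv m Ranking ⁻¹' latentBox 1 0 m d := by
  ext r
  simp only [closeMargins, latentBox, Set.mem_preimage, Set.mem_ofPred_eq, one_mul, zero_mul,
    sub_zero, ← margin_eq_sum]
  refine ⟨fun h k => h k (k + 1) (by revert k; decide), fun h k k' hkk => ?_⟩
  have hc : k' = k + 1 ∨ k = k' + 1 := by revert k k'; decide
  rcases hc with rfl | rfl
  · exact h k
  · rw [margin_swap r hkk.symm, Int.cast_neg, abs_neg]
    exact h k'

/-- Powers of the logarithm grow slower than any linear function. -/
lemma eventually_log_div_pow_le {c : ℝ} (hc : 0 < c) :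
    ∀ᶠ m : ℕ in atTop, (Real.log m / c) ^ 4 ≤ m := by
  have h := (Real.isLittleO_pow_log_id_atTop (n := 4)).bound (pow_pos hc 4)
  have h2 := tendsto_natCast_atTop_atTop (R := ℝ) |>.eventually h
  filter_upwards [h2] with m hm
  rw [id, Real.norm_eq_abs, Real.norm_eq_abs, Nat.abs_cast] at hm
  rw [div_pow, div_le_iff₀ (pow_pos hc 4), mul_comm]
  exact (le_abs_self _).trans hm

lemma tendsto_log_div {c : ℝ} (hc : 0 < c) :
    Tendsto (fun m : ℕ => Real.log m / c) atTop atTop :=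
  (Real.tendsto_log_atTop.comp tendsto_natCast_atTop_atTop).atTop_div_const hc

/-- The limiting probability of the paradox given close margins. -/
theorem tendsto_cond_closeMargins :
    Tendsto (fun m : ℕ => (cond (impartialCulture (3 * m))
        (closeMargins (3 * m) (√(3 * m : ℕ) / Real.log (3 * m : ℕ)))).real (paradox m))
      oddAtTop (𝓝 ((3 * (1 / 2 + Real.arcsin (partialCorr 1 0) / Real.pi) - 1) / 2)) := by
  have h3 : (0 : ℝ) < √3 := Real.sqrt_pos.2 (by norm_num)
  -- with this `L`, the threshold `√n / log n` for `n = 3 m` is `√m / L m`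
  set L : ℕ → ℝ := fun m => Real.log ((3 * m : ℕ) : ℝ) / √3 with hLdef
  have ht : Tendsto (fun m : ℕ => 3 * m) atTop atTop :=
    tendsto_id.const_mul_atTop' (by norm_num)
  have hL : Tendsto L atTop atTop := (tendsto_log_div h3).comp ht
  have hLm : ∀ᶠ m : ℕ in atTop, L m ^ 4 ≤ m := by
    filter_upwards [ht.eventually (eventually_log_div_pow_le (one_pos : (0 : ℝ) < 1))] with m hm
    rw [div_one] at hm
    push_cast at hm
    have h9 : √(3 : ℝ) ^ 4 = 9 := by
      rw [show (4 : ℕ) = 2 * 2 from rfl, pow_mul, Real.sq_sqrt (by norm_num)]; norm_num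
    rw [hLdef]
    simp only
    rw [div_pow, h9, div_le_iff₀ (by norm_num)]
    push_cast
    have : (0 : ℝ) ≤ m := Nat.cast_nonneg m
    linarith
  have hp : (1 : ℝ) ≠ 0 := one_ne_zero
  have hE : ∀ m : ℕ, closeMargins (3 * m) (√(3 * m : ℕ) / Real.log (3 * m : ℕ))
      = tripletsEquiv m Ranking ⁻¹' latentBox 1 0 m (√m / L m) := fun m => by
    rw [closeMargins_eq_preimage]
    congr 2
    rw [hLdef]
    simp only
    rw [div_div_eq_mul_div, ← Real.sqrt_mul (Nat.cast_nonneg m)]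
    push_cast
    rw [mul_comm (m : ℝ) 3]
  exact tendsto_cond_paradox (Eventually.of_forall hE) (hL.mono_left oddAtTop_le)
    (boxDensity_pos hp).ne' ((tendsto_latentBox hp one_ne_zero hL hLm).mono_left oddAtTop_le)
    fun i j hij => (tendsto_latentBox_inter_agree hp one_ne_zero hij hL hLm).mono_left oddAtTop_le

end CloseMargins

/-! ### Noisy election values and latent sums -/

section Calibration

open Real

lemma tendsto_log_div_sqrt : Tendsto (fun m : ℕ => log m / √m) atTop (𝓝 0) := by
  have h := (isLittleO_log_rpow_atTop (r := 1 / 2) (by norm_num)).tendsto_div_nhds_zero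
  refine (h.comp tendsto_natCast_atTop_atTop).congr fun m => ?_
  simp [sqrt_eq_rpow]

lemma sqrt_two_div_pi_mul : √(2 / π) * √(π / 2) = 1 := by
  rw [← sqrt_mul (by positivity), div_mul_div_comm, mul_comm 2 π, div_self (by positivity),
    sqrt_one]

/-- If the latent sum `S` is well inside the threshold `√v √(π / 2) √m / log m`, then the noisy
election value `D` is at most `1 / log m`. -/
lemma eventually_abs_le_of_abs_sum_le {v a C : ℝ} (hv : 0 < v) (ha : a ∈ Set.Ioo (0 : ℝ) 1) :
    ∀ᶠ m : ℕ in atTop, ∀ S V D : ℝ, |D - gaussErf (S / √V)| ≤ C / √m → a ^ 2 * v * m ≤ V →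
      |S| ≤ √m / (log m / (a ^ 2 * (√v * √(π / 2)))) → |D| ≤ 1 / log m := by
  have ht : Tendsto (fun m : ℕ => C * (log m / √m)) atTop (𝓝 0) := by
    simpa using tendsto_log_div_sqrt.const_mul C
  filter_upwards [ht.eventually_lt_const (sub_pos.2 ha.2), eventually_gt_atTop 1]
    with m hm1 hm S V D hD hV hS
  have hm0 : (0 : ℝ) < m := by exact_mod_cast (by omega : 0 < m)
  have hl : 0 < log m := log_pos (by exact_mod_cast hm)
  have hsm : 0 < √(m : ℝ) := sqrt_pos.2 hm0
  have hsv : 0 < √v := sqrt_pos.2 hv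
  have ha0 := ha.1
  have hVs : a * √v * √m ≤ √V := by
    refine le_sqrt_of_sq_le ?_
    rw [mul_pow, mul_pow, sq_sqrt hv.le, sq_sqrt hm0.le]
    exact hV
  have hVpos : 0 < √V := lt_of_lt_of_le (by positivity) hVs
  have hx : |S| / √V ≤ a * √(π / 2) / log m := by
    rw [div_le_iff₀ hVpos]
    calc |S| ≤ √m / (log m / (a ^ 2 * (√v * √(π / 2)))) := hS
      _ = a * √(π / 2) / log m * (a * √v * √m) := by field_simp
      _ ≤ _ := by gcongr
  have hg : |gaussErf (S / √V)| ≤ a / log m := by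
    rw [abs_gaussErf, abs_div, abs_of_pos hVpos]
    refine (gaussErf_le (by positivity)).trans ?_
    calc √(2 / π) * (|S| / √V) ≤ √(2 / π) * (a * √(π / 2) / log m) := by gcongr
      _ = (√(2 / π) * √(π / 2)) * (a / log m) := by ring
      _ = a / log m := by rw [sqrt_two_div_pi_mul, one_mul]
  have hC : C / √m ≤ (1 - a) / log m := by
    rw [le_div_iff₀ hl, div_mul_eq_mul_div, mul_div_assoc]
    exact hm1.le
  calc |D| ≤ |D - gaussErf (S / √V)| + |gaussErf (S / √V)| := by
        simpa using abs_add_le (D - gaussErf (S / √V)) (gaussErf (S / √V))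
    _ ≤ (1 - a) / log m + a / log m := add_le_add (hD.trans hC) hg
    _ = 1 / log m := by ring

/-- If the noisy election value `D` is at most `1 / log m`, then the latent sum `S` does not exceed
the threshold `√v √(π / 2) √m / log m` by much. -/
lemma eventually_abs_sum_le_of_abs_le {v a C : ℝ} (hv : 0 < v) (ha : 1 < a) :
    ∀ᶠ m : ℕ in atTop, ∀ S V D : ℝ, |D - gaussErf (S / √V)| ≤ C / √m → 0 < V → V ≤ a ^ 2 * v * m →
      |D| ≤ 1 / log m → |S| ≤ √m / (log m / (a ^ 2 * (√v * √(π / 2)))) := by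
  have ht : Tendsto (fun m : ℕ => 1 + C * (log m / √m)) atTop (𝓝 1) := by
    simpa using (tendsto_log_div_sqrt.const_mul C).const_add 1
  have ht2 : Tendsto (fun m : ℕ => a * exp (-(a * √(π / 2) / log m) ^ 2 / 2)) atTop (𝓝 a) := by
    have h0 : Tendsto (fun m : ℕ => a * √(π / 2) / log m) atTop (𝓝 0) :=
      tendsto_const_nhds.div_atTop (tendsto_log_atTop.comp tendsto_natCast_atTop_atTop)
    have hc : Continuous fun x : ℝ => a * exp (-x ^ 2 / 2) := by fun_prop
    have := (hc.tendsto 0).comp h0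
    simpa [Function.comp_def] using this
  filter_upwards [ht.eventually_lt ht2 ha, eventually_gt_atTop 1]
    with m hm1 hm S V D hD hV0 hV hDl
  have hm0 : (0 : ℝ) < m := by exact_mod_cast (by omega : 0 < m)
  have hl : 0 < log m := log_pos (by exact_mod_cast hm)
  have hsm : 0 < √(m : ℝ) := sqrt_pos.2 hm0
  have hsv : 0 < √v := sqrt_pos.2 hv
  have ha0 : 0 < a := one_pos.trans ha
  have hVs : √V ≤ a * √v * √m := by
    refine sqrt_le_iff.2 ⟨by positivity, ?_⟩
    rw [mul_pow, mul_pow, sq_sqrt hv.le, sq_sqrt hm0.le]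
    exact hV
  have hVpos : 0 < √V := sqrt_pos.2 hV0
  set x₀ := a * √(π / 2) / log m with hx₀
  have hx₀pos : 0 ≤ x₀ := by positivity
  have hx : |S| / √V ≤ x₀ := by
    by_contra! hlt
    have h1 : gaussErf (|S| / √V) ≤ 1 / log m + C / √m := by
      have : gaussErf (|S| / √V) = |gaussErf (S / √V)| := by
        rw [abs_gaussErf, abs_div, abs_of_pos hVpos]
      rw [this]
      have h2 := abs_sub_abs_le_abs_sub (gaussErf (S / √V)) D
      rw [abs_sub_comm] at h2
      linarith
    have h2 := (le_gaussErf hx₀pos).trans_lt (gaussErf_strictMono hlt)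
    have h3 : √(2 / π) * (x₀ * exp (-x₀ ^ 2 / 2)) = a * exp (-x₀ ^ 2 / 2) / log m := by
      calc √(2 / π) * (x₀ * exp (-x₀ ^ 2 / 2))
          = (√(2 / π) * √(π / 2)) * (a * exp (-x₀ ^ 2 / 2) / log m) := by rw [hx₀]; ring
        _ = _ := by rw [sqrt_two_div_pi_mul, one_mul]
    have h4 : 1 / log m + C / √m = (1 + C * (log m / √m)) / log m := by
      field_simp
    rw [h3] at h2
    rw [h4] at h1
    have h5 := (h2.trans_le h1)
    rw [div_lt_div_iff_of_pos_right hl] at h5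
    exact absurd h5 hm1.le.not_gt
  rw [div_le_iff₀ hVpos] at hx
  calc |S| ≤ x₀ * √V := hx
    _ ≤ x₀ * (a * √v * √m) := by gcongr
    _ = √m / (log m / (a ^ 2 * (√v * √(π / 2)))) := by rw [hx₀]; field_simp

end Calibration

/-! ### Chebyshev's inequality for independent copies -/

section LawOfLargeNumbers

variable {Ω : Type*} [MeasurableSpace Ω] [Finite Ω] [MeasurableSingletonClass Ω]

/-- Chebyshev's inequality for a sum of independent copies of a variable with values in `[0, 1]`. -/
lemma measureReal_pi_abs_sum_sub_ge_le (P : Measure Ω) [IsProbabilityMeasure P] {X : Ω → ℝ}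
    (hX : ∀ ω, X ω ∈ Set.Icc (0 : ℝ) 1) {ε : ℝ} (hε : 0 < ε) {m : ℕ} (hm : 0 < m) :
    (Measure.pi fun _ : Fin m => P).real {ω | ε * m ≤ |∑ i, X (ω i) - m * ∫ x, X x ∂P|}
      ≤ 1 / (ε ^ 2 * m) := by
  have hm0 : (0 : ℝ) < m := Nat.cast_pos.2 hm
  have hmem : MemLp X 2 P := MemLp.of_bound (C := 1) (measurable_of_finite X).aestronglyMeasurable
    (Eventually.of_forall fun ω => by
      rw [Real.norm_eq_abs, abs_of_nonneg (hX ω).1]; exact (hX ω).2)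
  set Y : (Fin m → Ω) → ℝ := ∑ i, fun ω => X (ω i) with hY
  have hYa : ∀ ω, Y ω = ∑ i, X (ω i) := fun ω => by simp [hY]
  have hYmem : MemLp Y 2 (Measure.pi fun _ : Fin m => P) :=
    memLp_finsetSum' _ fun i _ => hmem.comp_measurePreserving
      (measurePreserving_eval (fun _ : Fin m => P) i)
  have hvar : Var[Y; Measure.pi fun _ : Fin m => P] ≤ m := by
    rw [hY, variance_sum_pi fun _ => hmem]
    have h1 : Var[X; P] ≤ 1 := (variance_le_sq_of_bounded
      (Eventually.of_forall hX) (measurable_of_finite X).aemeasurable).trans (by norm_num)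
    simpa using mul_le_mul_of_nonneg_left h1 hm0.le
  have hmean : ∫ ω, Y ω ∂(Measure.pi fun _ : Fin m => P) = m * ∫ x, X x ∂P := by
    simp_rw [hYa]
    rw [integral_finsetSum _ fun i _ => .of_finite]
    have : ∀ i : Fin m, ∫ ω : Fin m → Ω, X (ω i) ∂(Measure.pi fun _ : Fin m => P)
        = ∫ x, X x ∂P := fun i =>
      integral_comp_eval (μ := fun _ : Fin m => P) (i := i)
        (measurable_of_finite X).aestronglyMeasurable
    simp [this]
  have h := meas_ge_le_variance_div_sq hYmem (mul_pos hε hm0)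
  rw [hmean] at h
  simp_rw [hYa] at h
  rw [Measure.real]
  refine (ENNReal.toReal_mono ENNReal.ofReal_ne_top h).trans ?_
  rw [ENNReal.toReal_ofReal (div_nonneg (variance_nonneg _ _) (sq_nonneg _)), div_le_div_iff₀
    (by positivity) (by positivity)]
  calc _ ≤ (m : ℝ) * (ε ^ 2 * m) := by gcongr
    _ = _ := by ring

end LawOfLargeNumbers

/-! ### Limits between bounds -/

section Squeeze

/-- A limit in between limits that depend continuously on a parameter. -/
lemma tendsto_of_bounds_near_one {l : Filter ℕ} {u : ℕ → ℝ} {A : ℝ → ℝ} (hA : ContinuousAt A 1)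
    (hlo : ∀ a ∈ Set.Ioo (0 : ℝ) 1, ∀ b < A a, ∀ᶠ m in l, b < u m)
    (hhi : ∀ a, 1 < a → ∀ b > A a, ∀ᶠ m in l, u m < b) : Tendsto u l (𝓝 (A 1)) := by
  refine tendsto_order.2 ⟨fun b hb => ?_, fun b hb => ?_⟩
  · have h1 : ∀ᶠ a in 𝓝[<] (1 : ℝ), b < A a := (hA.eventually_const_lt hb).filter_mono inf_le_left
    have h2 : ∀ᶠ a in 𝓝[<] (1 : ℝ), a ∈ Set.Ioo (0 : ℝ) 1 := Ioo_mem_nhdsLT one_pos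
    obtain ⟨a, ha1, ha2⟩ := (h1.and h2).exists
    exact hlo a ha2 b ha1
  · have h1 : ∀ᶠ a in 𝓝[>] (1 : ℝ), A a < b := (hA.eventually_lt_const hb).filter_mono inf_le_left
    have h2 : ∀ᶠ a in 𝓝[>] (1 : ℝ), a ∈ Set.Ioi (1 : ℝ) := self_mem_nhdsWithin
    obtain ⟨a, ha1, ha2⟩ := (h1.and h2).exists
    exact hhi a ha2 b ha1

end Squeeze

/-! ### Close noisy elections -/

section NoisyElections

open Real
open scoped RealInnerProductSpace

/-- The profiles, grouped into triplets of voters, whose three noisy election values are at most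
`1 / log m` in absolute value. -/
noncomputable def noiseBox (p q : ℝ) (m : ℕ) : Set (Fin m → Fin 3 → Ranking) :=
  {ω | ∀ k, |signIntegral fun i => latentVec p q (ω i) k| ≤ 1 / log m}

/-- The profiles, grouped into triplets of voters, for which the residual variance of one of the
three noisy elections is far from its mean `v m`. -/
def atypical (p q v ε : ℝ) (m : ℕ) : Set (Fin m → Fin 3 → Ranking) :=
  {ω | ∃ k, ε * m ≤ |∑ i, (1 - latentVec p q (ω i) k ^ 2) - m * v|}

variable {p q : ℝ}

lemma integral_latentVec_apply_sq (k : Fin 3) :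
    ∫ ω, latentVec p q ω k ^ 2 ∂(impartialCulture 3) = 3 * p ^ 2 + q ^ 2 := by
  have h := integral_inner_latentVec_sq p q (EuclideanSpace.single k 1)
  have e : ∀ ω, ⟪latentVec p q ω, EuclideanSpace.single k (1 : ℝ)⟫ = latentVec p q ω k :=
    fun ω => by
    simp [EuclideanSpace.inner_single_right]
  simp_rw [e] at h
  rw [h, latentVarDiag, latentVarPerp]
  fin_cases k <;> simp <;> ring

lemma integral_one_sub_latentVec_sq (k : Fin 3) :
    ∫ ω, (1 - latentVec p q ω k ^ 2) ∂(impartialCulture 3) = 1 - (3 * p ^ 2 + q ^ 2) := by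
  rw [integral_sub .of_finite .of_finite, integral_latentVec_apply_sq]
  simp

lemma residual_pos_of_bound {β : ℝ} (hβ0 : 0 ≤ β) (hβ : β < 1)
    (hb : ∀ ω k, |latentVec p q ω k| ≤ β) : 0 < 1 - (3 * p ^ 2 + q ^ 2) := by
  have h : ∫ ω, latentVec p q ω 0 ^ 2 ∂(impartialCulture 3) ≤ ∫ _, β ^ 2 ∂(impartialCulture 3) :=
    integral_mono .of_finite .of_finite fun ω => sq_le_sq.2 ((hb ω 0).trans (le_abs_self β))
  rw [integral_latentVec_apply_sq] at h
  have h2 : β ^ 2 < 1 := by nlinarith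
  simp only [integral_const, smul_eq_mul, probReal_univ, one_mul] at h
  linarith

lemma measureReal_atypical_le {β : ℝ} (hβ : β < 1) (hb : ∀ ω k, |latentVec p q ω k| ≤ β) {ε : ℝ}
    (hε : 0 < ε) {m : ℕ} (hm : 0 < m) :
    (Measure.pi fun _ : Fin m => impartialCulture 3).real
      (atypical p q (1 - (3 * p ^ 2 + q ^ 2)) ε m) ≤ 3 / (ε ^ 2 * m) := by
  have hX : ∀ k ω, 1 - latentVec p q ω k ^ 2 ∈ Set.Icc (0 : ℝ) 1 := fun k ω => by
    have h := hb ω k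
    have h1 : latentVec p q ω k ^ 2 ≤ 1 := by
      rw [sq_le_one_iff_abs_le_one]; linarith
    exact ⟨by linarith, by linarith [sq_nonneg (latentVec p q ω k)]⟩
  have h := fun k => measureReal_pi_abs_sum_sub_ge_le (impartialCulture 3) (hX k) hε hm
  simp only [integral_one_sub_latentVec_sq] at h
  have e : atypical p q (1 - (3 * p ^ 2 + q ^ 2)) ε m = ⋃ k, {ω : Fin m → Fin 3 → Ranking |
      ε * m ≤ |∑ i, (1 - latentVec p q (ω i) k ^ 2) - m * (1 - (3 * p ^ 2 + q ^ 2))|} := by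
    ext ω; simp [atypical]
  rw [e]
  refine (measureReal_iUnion_fintype_le _).trans ?_
  refine (Finset.sum_le_sum fun k _ => h k).trans (le_of_eq ?_)
  simp
  ring

lemma tendsto_log_pow_mul_atypical {β : ℝ} (hβ : β < 1) (hb : ∀ ω k, |latentVec p q ω k| ≤ β)
    {ε : ℝ} (hε : 0 < ε) :
    Tendsto (fun m : ℕ => log m ^ 3 * (Measure.pi fun _ : Fin m => impartialCulture 3).real
      (atypical p q (1 - (3 * p ^ 2 + q ^ 2)) ε m)) atTop (𝓝 0) := by
  have h := (isLittleO_pow_log_id_atTop (n := 3)).tendsto_div_nhds_zero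
  have h2 : Tendsto (fun m : ℕ => log m ^ 3 / m * (3 / ε ^ 2)) atTop (𝓝 0) := by
    simpa using (h.comp tendsto_natCast_atTop_atTop).mul_const (3 / ε ^ 2)
  refine squeeze_zero' ?_ ?_ h2
  · filter_upwards [eventually_gt_atTop 0] with m hm
    have : 0 ≤ log (m : ℝ) := log_natCast_nonneg m
    positivity
  · filter_upwards [eventually_gt_atTop 0] with m hm
    have h0 : 0 ≤ log (m : ℝ) := log_natCast_nonneg m
    calc _ ≤ log (m : ℝ) ^ 3 * (3 / (ε ^ 2 * m)) := by
          gcongr; exact measureReal_atypical_le hβ hb hε hm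
      _ = _ := by
          have : (m : ℝ) ≠ 0 := by positivity
          field_simp

lemma eventually_latentBox_subset_noiseBox {β : ℝ} (hβ0 : 0 ≤ β) (hβ : β < 1)
    (hb : ∀ ω k, |latentVec p q ω k| ≤ β) {v a : ℝ} (hv : 0 < v) (ha : a ∈ Set.Ioo (0 : ℝ) 1) :
    ∀ᶠ m : ℕ in atTop, latentBox p q m (√m / (log m / (a ^ 2 * (√v * √(π / 2)))))
      ⊆ noiseBox p q m ∪ atypical p q v (v * (1 - a ^ 2)) m := by
  obtain ⟨C, -, hC⟩ := exists_abs_signIntegral_sub_gaussErf_le hβ0 hβ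
  filter_upwards [eventually_abs_le_of_abs_sum_le (C := C) hv ha, eventually_gt_atTop 0]
    with m hmain hm ω hω
  by_contra hnot
  simp only [Set.mem_union, not_or, atypical, Set.mem_ofPred_eq, not_exists, not_le] at hnot
  refine hnot.1 fun k => hmain _ _ _ (hC m (fun i => latentVec p q (ω i) k) hm fun i => hb _ _) ?_
    (hω k)
  have := (abs_lt.1 (hnot.2 k)).1
  linarith

lemma eventually_noiseBox_subset_latentBox {β : ℝ} (hβ0 : 0 ≤ β) (hβ : β < 1)
    (hb : ∀ ω k, |latentVec p q ω k| ≤ β) {v a : ℝ} (hv : 0 < v) (ha : 1 < a) :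
    ∀ᶠ m : ℕ in atTop, noiseBox p q m ⊆
      latentBox p q m (√m / (log m / (a ^ 2 * (√v * √(π / 2)))))
        ∪ atypical p q v (v * (a ^ 2 - 1)) m := by
  obtain ⟨C, -, hC⟩ := exists_abs_signIntegral_sub_gaussErf_le hβ0 hβ
  filter_upwards [eventually_abs_sum_le_of_abs_le (C := C) hv ha, eventually_gt_atTop 0]
    with m hmain hm ω hω
  by_contra hnot
  simp only [Set.mem_union, not_or, atypical, Set.mem_ofPred_eq, not_exists, not_le] at hnot
  refine hnot.1 fun k => hmain _ _ _ (hC m (fun i => latentVec p q (ω i) k) hm fun i => hb _ _) ?_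
    ?_ (hω k)
  · have : Nonempty (Fin m) := ⟨⟨0, hm⟩⟩
    refine Finset.sum_pos (fun i _ => ?_) Finset.univ_nonempty
    have h := hb (ω i) k
    have : latentVec p q (ω i) k ^ 2 < 1 := by
      rw [sq_lt_one_iff_abs_lt_one]; linarith
    linarith
  · have := (abs_lt.1 (hnot.2 k)).2
    linarith

/-- The asymptotics of the probability of small latent sums, jointly with events `O m`, carry over
to close noisy elections: these are squeezed between boxes for the latent sums whose thresholds
differ by factors `a ^ 2` close to `1`, up to atypical profiles, whose probability is negligible. -/
lemma tendsto_noiseBox {β : ℝ} (hβ0 : 0 ≤ β) (hβ : β < 1)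
    (hb : ∀ ω k, |latentVec p q ω k| ≤ β) {O : (m : ℕ) → Set (Fin m → Fin 3 → Ranking)} {w : ℝ}
    (hO : ∀ L : ℕ → ℝ, Tendsto L atTop atTop → (∀ᶠ m : ℕ in atTop, L m ^ 4 ≤ m) →
      Tendsto (fun m : ℕ => L m ^ 3 * (Measure.pi fun _ : Fin m => impartialCulture 3).real
        (latentBox p q m (√m / L m) ∩ O m)) atTop (𝓝 w)) :
    Tendsto (fun m : ℕ => log m ^ 3 * (Measure.pi fun _ : Fin m => impartialCulture 3).real
      (noiseBox p q m ∩ O m)) atTop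
      (𝓝 ((√(1 - (3 * p ^ 2 + q ^ 2)) * √(π / 2)) ^ 3 * w)) := by
  have hv := residual_pos_of_bound hβ0 hβ hb
  set v := 1 - (3 * p ^ 2 + q ^ 2) with hvdef
  set μ : (m : ℕ) → Measure (Fin m → Fin 3 → Ranking) :=
    fun m => Measure.pi fun _ : Fin m => impartialCulture 3 with hμ
  have hsv : 0 < √v := sqrt_pos.2 hv
  have hbox : ∀ a : ℝ, 0 < a → Tendsto (fun m : ℕ => log m ^ 3 * (μ m).real
      (latentBox p q m (√m / (log m / (a ^ 2 * (√v * √(π / 2))))) ∩ O m)) atTop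
      (𝓝 ((a ^ 2 * (√v * √(π / 2))) ^ 3 * w)) := by
    intro a ha
    have hc : 0 < a ^ 2 * (√v * √(π / 2)) := by positivity
    refine ((hO _ (tendsto_log_div hc) (eventually_log_div_pow_le hc)).const_mul
      ((a ^ 2 * (√v * √(π / 2))) ^ 3)).congr fun m => ?_
    rw [← mul_assoc, ← mul_pow, mul_div_cancel₀ _ hc.ne']
  have hA : ContinuousAt (fun a : ℝ => (a ^ 2 * (√v * √(π / 2))) ^ 3 * w) 1 := by fun_prop
  have hsub : ∀ (m : ℕ) (A B C D : Set (Fin m → Fin 3 → Ranking)), A ⊆ B ∪ C →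
      log m ^ 3 * (μ m).real (A ∩ D)
        ≤ log m ^ 3 * (μ m).real (B ∩ D) + log m ^ 3 * (μ m).real C := by
    intro m A B C D h
    have h0 : 0 ≤ log (m : ℝ) := log_natCast_nonneg m
    rw [← mul_add]
    refine mul_le_mul_of_nonneg_left ?_ (pow_nonneg h0 3)
    refine (measureReal_mono (fun ω hω => ?_)).trans (measureReal_union_le (B ∩ D) C)
    exact (h hω.1).imp (fun hB => ⟨hB, hω.2⟩) id
  have hmain := tendsto_of_bounds_near_one (l := atTop)
    (u := fun m : ℕ => log m ^ 3 * (μ m).real (noiseBox p q m ∩ O m)) hA ?_ ?_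
  · simpa using hmain
  · intro a ha b hba
    have hε : 0 < v * (1 - a ^ 2) := mul_pos hv (by nlinarith [ha.1, ha.2])
    have hlim := (hbox a ha.1).sub (tendsto_log_pow_mul_atypical hβ hb hε)
    rw [sub_zero] at hlim
    filter_upwards [hlim.eventually_const_lt hba,
      eventually_latentBox_subset_noiseBox hβ0 hβ hb hv ha] with m hm hs
    have := hsub m _ _ _ (O m) hs
    linarith
  · intro a ha b hba
    have hε : 0 < v * (a ^ 2 - 1) := mul_pos hv (by nlinarith)
    have hlim := (hbox a (one_pos.trans ha)).add (tendsto_log_pow_mul_atypical hβ hb hε)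
    rw [add_zero] at hlim
    filter_upwards [hlim.eventually_lt_const hba,
      eventually_noiseBox_subset_latentBox hβ0 hβ hb hv ha] with m hm hs
    have := hsub m _ _ _ (O m) hs
    linarith

lemma latentVec_apply_eq_noisyMajority (ρ : ℝ) (ω : Fin 3 → Ranking) (k : Fin 3) :
    latentVec (ρ / 2) (ρ ^ 3 / 2) ω k = noisyMajority ρ (votes ω k (k + 1)) := rfl

lemma noiseOp_majTriplets_votes {m : ℕ} (hm : Odd m) (ρ : ℝ) (r : Fin (3 * m) → Ranking)
    (k : Fin 3) : noiseOp ρ (fun y => (majTriplets m y : ℝ)) (votes r k (k + 1))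
      = signIntegral fun i => latentVec (ρ / 2) (ρ ^ 3 / 2) (tripletsEquiv m Ranking r i) k :=
  noiseOp_majTriplets hm ρ _

lemma closeNoise_eq_preimage {m : ℕ} (hm : Odd m) (ρ : ℝ) :
    closeNoise m ρ (√m / log m)
      = tripletsEquiv m Ranking ⁻¹' noiseBox (ρ / 2) (ρ ^ 3 / 2) m := by
  ext r
  have h0 : noiseOp ρ (fun y => (majTriplets m y : ℝ)) (votes r 0 1) = _ :=
    noiseOp_majTriplets_votes hm ρ r 0
  have h1 : noiseOp ρ (fun y => (majTriplets m y : ℝ)) (votes r 1 2) = _ :=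
    noiseOp_majTriplets_votes hm ρ r 1
  have h2 : noiseOp ρ (fun y => (majTriplets m y : ℝ)) (votes r 2 0) = _ :=
    noiseOp_majTriplets_votes hm ρ r 2
  have hm0 : (0 : ℝ) < m := Nat.cast_pos.2 hm.pos
  have hd : √(m : ℝ) / log m / √m = 1 / log m := by
    rw [div_right_comm, div_self (sqrt_pos.2 hm0).ne']
  rw [Set.mem_preimage, closeNoise, noiseBox, Set.mem_ofPred_eq, Set.mem_ofPred_eq, hd, h0, h1, h2,
    max_le_iff, max_le_iff]
  refine ⟨fun ⟨⟨a, b⟩, c⟩ k => ?_, fun h => ⟨⟨h 0, h 1⟩, h 2⟩⟩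
  fin_cases k
  exacts [a, b, c]

/-- The limiting probability of the paradox given close noisy elections. -/
theorem tendsto_cond_closeNoise {ρ : ℝ} (hρ : ρ ∈ Set.Ioo (0 : ℝ) 1) :
    Tendsto (fun m : ℕ => (cond (impartialCulture (3 * m))
        (closeNoise m ρ (√m / log m))).real (paradox m)) oddAtTop
      (𝓝 ((3 * (1 / 2 + arcsin (partialCorr (ρ / 2) (ρ ^ 3 / 2)) / π) - 1) / 2)) := by
  obtain ⟨hβ0, hβ⟩ := noisyMajority_bound_lt_one hρ
  have hb : ∀ ω k, |latentVec (ρ / 2) (ρ ^ 3 / 2) ω k| ≤ 3 * ρ / 2 - ρ ^ 3 / 2 := fun ω k => by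
    rw [latentVec_apply_eq_noisyMajority]
    exact abs_noisyMajority_le ⟨hρ.1.le, hρ.2.le⟩ _
  have hp : ρ / 2 ≠ 0 := (half_pos hρ.1).ne'
  have hpq : ρ / 2 ≠ ρ ^ 3 / 2 := by
    have h2 : ρ ^ 2 < 1 := by nlinarith [hρ.1, hρ.2]
    have : ρ ^ 3 < ρ := by
      calc ρ ^ 3 = ρ * ρ ^ 2 := by ring
        _ < ρ * 1 := mul_lt_mul_of_pos_left h2 hρ.1
        _ = ρ := mul_one ρ
    intro h
    linarith
  have hv := residual_pos_of_bound hβ0 hβ hb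
  have hE : ∀ᶠ m in oddAtTop, closeNoise m ρ (√m / log m)
      = tripletsEquiv m Ranking ⁻¹' noiseBox (ρ / 2) (ρ ^ 3 / 2) m := by
    filter_upwards [eventually_odd] with m hm using closeNoise_eq_preimage hm ρ
  refine tendsto_cond_paradox (L := fun m : ℕ => log m)
    (D := (√(1 - (3 * (ρ / 2) ^ 2 + (ρ ^ 3 / 2) ^ 2)) * √(π / 2)) ^ 3
      * boxDensity (ρ / 2) (ρ ^ 3 / 2)) hE
    ((tendsto_log_atTop.comp tendsto_natCast_atTop_atTop).mono_left oddAtTop_le)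
    (mul_pos (pow_pos (mul_pos (sqrt_pos.2 hv) (sqrt_pos.2 (by positivity))) 3)
      (boxDensity_pos hp)).ne' ?_ fun i j hij => ?_
  · have h := tendsto_noiseBox hβ0 hβ hb (O := fun _ => Set.univ)
      (w := boxDensity (ρ / 2) (ρ ^ 3 / 2)) fun L hL hLm => by
        simpa using tendsto_latentBox hp hpq hL hLm
    simp only [Set.inter_univ] at h
    exact h.mono_left oddAtTop_le
  · have h := tendsto_noiseBox hβ0 hβ hb (O := fun m => agree i j m)
      fun L hL hLm => tendsto_latentBox_inter_agree hp hpq hij hL hLm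
    rw [mul_assoc]
    exact h.mono_left oddAtTop_le

end NoisyElections

/-! ### Numerical values -/

section Values

open Real

/-- The limiting probability of the paradox, as a function of the partial correlation `r`. -/
noncomputable def paradoxProb (r : ℝ) : ℝ := (3 * (1 / 2 + arcsin r / π) - 1) / 2

lemma paradoxProb_mono : Monotone paradoxProb := fun r s h => by
  have := monotone_arcsin h
  have hπ := pi_pos
  unfold paradoxProb
  gcongr

lemma continuous_paradoxProb : Continuous paradoxProb := by
  unfold paradoxProb
  have := continuous_arcsin
  fun_prop

lemma partialCorr_one_zero : partialCorr 1 0 = -1 / 27 := by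
  norm_num [partialCorr, residualDiag, residualPerp, latentVarDiag, latentVarPerp]

/-- The partial correlation of the majorities of a triplet in two elections, given their noisy
values. -/
noncomputable def noisyCorr (ρ : ℝ) : ℝ := -(27 + 175 * ρ ^ 4) / (729 + 525 * ρ ^ 4)

lemma partialCorr_noisy {ρ : ℝ} (hρ : ρ ≠ 0) :
    partialCorr (ρ / 2) (ρ ^ 3 / 2) = noisyCorr ρ := by
  have h1 : residualDiag (ρ / 2) (ρ ^ 3 / 2) = 4 / ρ ^ 2 * (25 / (27 + 25 * ρ ^ 4)) := by
    rw [residualDiag, latentVarDiag]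
    field_simp
    norm_num
  have h2 : residualPerp (ρ / 2) (ρ ^ 3 / 2) = 4 / ρ ^ 2 * (28 / (27 + 7 * ρ ^ 4)) := by
    rw [residualPerp, latentVarPerp]
    field_simp
    ring
  rw [partialCorr, h1, h2, ← mul_sub, mul_left_comm, ← mul_add,
    mul_div_mul_left _ _ (by positivity), noisyCorr, div_eq_div_iff (by positivity) (by positivity)]
  field_simp
  ring

lemma noisyCorr_zero : noisyCorr 0 = -1 / 27 := by norm_num [noisyCorr]

lemma continuous_noisyCorr : Continuous noisyCorr := by
  unfold noisyCorr
  exact Continuous.div (by fun_prop) (by fun_prop) fun ρ => by positivity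

lemma noisyCorr_mem {ρ : ℝ} (hρ : ρ ∈ Set.Ioo (0 : ℝ) 1) :
    noisyCorr ρ ∈ Set.Icc (-101 / 627) (-1 / 27) := by
  have h0 : 0 ≤ ρ ^ 4 := by positivity
  have h1 : ρ ^ 4 ≤ 1 := pow_le_one₀ hρ.1.le hρ.2.le
  rw [noisyCorr, Set.mem_Icc, div_le_div_iff₀ (by norm_num) (by positivity),
    div_le_div_iff₀ (by positivity) (by norm_num)]
  constructor <;> linarith

/-- The value `-101 / 627` is that of `noisyCorr` at `ρ = 1`. -/
lemma arcsin_lower : -0.1675 ≤ arcsin (-101 / 627) := by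
  have hπ := pi_gt_three
  rw [le_arcsin_iff_sin_le ⟨by linarith, by linarith⟩ ⟨by norm_num, by norm_num⟩, sin_neg]
  have := sin_gt_sub_cube (x := 0.1675) (by norm_num)
  norm_num at this ⊢
  linarith

lemma seventeen_percent_le_paradoxProb : 0.17 ≤ paradoxProb (-101 / 627) := by
  have hπ := pi_gt_d4
  have h := arcsin_lower
  -- `1 / 4 + 3 x / 2 = 0.17` at `x = -4 / 75`
  have : -(4 / 75) ≤ arcsin (-101 / 627) / π := by
    rw [le_div_iff₀ pi_pos]
    linarith
  rw [paradoxProb]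
  linarith

lemma abs_paradoxProb_sub_le : |paradoxProb (-1 / 27) - 0.232| ≤ 0.0005 := by
  have hπ := pi_gt_d4
  have hπ2 := pi_lt_d4
  have h1 : -0.0386 ≤ arcsin (-1 / 27) := by
    rw [le_arcsin_iff_sin_le ⟨by linarith, by linarith⟩ ⟨by norm_num, by norm_num⟩, sin_neg]
    have := sin_gt_sub_cube (x := 0.0386) (by norm_num)
    norm_num at this ⊢
    linarith
  have h2 : arcsin (-1 / 27) ≤ -1 / 27 := by
    rw [arcsin_le_iff_le_sin ⟨by norm_num, by norm_num⟩ ⟨by linarith, by linarith⟩,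
      neg_div, sin_neg]
    have := sin_lt (x := 1 / 27) (by norm_num)
    linarith
  -- with `x = arcsin r / π` the probability is `1 / 4 + 3 x / 2`, so `x` has to be in
  -- `[-0.01233…, -0.01166…]`
  have h3 : -0.01233 ≤ arcsin (-1 / 27) / π := by
    rw [le_div_iff₀ pi_pos]
    linarith
  have h4 : arcsin (-1 / 27) / π ≤ -0.01167 := by
    rw [div_le_iff₀ pi_pos]
    linarith
  rw [paradoxProb, abs_le]
  constructor <;> linarith

end Values

end CondorcetTriplets

theorem mainTheorem5 :
    ∃ (αstar : ℝ) (α : ℝ → ℝ),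
      -- `αstar` is the limiting probability given that the vote margins are `√n / log n`-close
      Tendsto
        (fun m : ℕ => (cond (impartialCulture (3 * m))
          (closeMargins (3 * m) (√(3 * m : ℕ) / Real.log (3 * m : ℕ)))).real (paradox m))
        oddAtTop (𝓝 αstar) ∧
      |αstar - 0.232| ≤ 0.0005 ∧
      (∀ ρ ∈ Set.Ioo (0 : ℝ) 1,
        Tendsto
          (fun m : ℕ => (cond (impartialCulture (3 * m))
            (closeNoise m ρ (√m / Real.log m))).real (paradox m))
          oddAtTop (𝓝 (α ρ)) ∧
        α ρ ∈ Set.Icc 0.17 αstar) ∧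
      Tendsto α (𝓝[>] 0) (𝓝 αstar) := by
  refine ⟨paradoxProb (-1 / 27), fun ρ => paradoxProb (noisyCorr ρ), ?_, abs_paradoxProb_sub_le,
    fun ρ hρ => ⟨?_, ?_, ?_⟩, ?_⟩
  · rw [← partialCorr_one_zero]
    exact tendsto_cond_closeMargins
  · change Tendsto _ _ (𝓝 (paradoxProb (noisyCorr ρ)))
    rw [← partialCorr_noisy hρ.1.ne']
    exact tendsto_cond_closeNoise hρ
  · exact seventeen_percent_le_paradoxProb.trans (paradoxProb_mono (noisyCorr_mem hρ).1)
  · exact paradoxProb_mono (noisyCorr_mem hρ).2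
  · rw [← noisyCorr_zero]
    exact ((continuous_paradoxProb.comp continuous_noisyCorr).tendsto 0).mono_left inf_le_left
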